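/- Let $(N^3,h)$ and $(B^2,h_1)$ be smooth Riemannian manifolds without boundary and let $\pi:(N^3,h)\to(B^2,h_1)$ be a Riemannian submersion with totally geodesic fibres. Let $\gamma:I\to B$ be a smooth curve on an open interval $I$, parametrized by arclength, and let $\Sigma=\bigcup_{s\in I}\pi^{-1}(\gamma(s))$ be the Hopf cylinder over $\gamma$. If $\gamma$ is not injective, the union is understood as a disjoint union: $\Sigma=\{(s,x)\in I\times N:\pi(x)=\gamma(s)\}$. Let $\varphi:\Sigma\to N$, $(s,x)\mapsto x$, be the corresponding immersion, with induced metric $\varphi^*h$. Let $\{X,V,\xi\}$ be a smooth orthonormal frame along $\varphi$ adapted to the cylinder: $X$ and $V$ are vector fields on $\Sigma$ (identified with their images under $d\varphi$), where $X$ is horizontal with $d\pi(X)=\gamma'$ (so the integral curves of $X$ are the horizontal lifts of $\gamma$) and $V$ is vertical of length one, and $\xi$ is a unit normal field of $\varphi$. Let $$\kappa=\langle\nabla_XX,\xi\rangle,\qquad \tau=\langle\nabla_X\xi,V\rangle=-\langle\nabla_XV,\xi\rangle$$ be the geodesic curvature and the torsion of the horizontal lifts of $\gamma$ with respect to this frame,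 where $\nabla$ is the Levi-Civita connection of $h$, and write $\kappa'=X(\kappa)$, $\kappa''=XX(\kappa)$ for the derivatives with respect to arclength along the lifts. ${\rm Ric}^N$ denotes the Ricci curvature of $(N,h)$, the trace of $Z\mapsto R^N(Z,Y)W$ being ${\rm Ric}^N(Y,W)$, where $R^N(X,Y)Z=[\nabla_X,\nabla_Y]Z-\nabla_{[X,Y]}Z$. A smooth map $\phi:(M,g)\to(N,h)$ is called biharmonic if it satisfies the Euler–Lagrange equation of the bienergy $\frac12\int|\tau(\phi)|^2v_g$, where $\tau(\phi)={\rm Trace}_g\nabla d\phi$ is the tension field, that is, $${\rm Trace}_g(\nabla^\phi\nabla^\phi-\nabla^\phi_{\nabla^M})\tau(\phi)-{\rm Trace}_gR^N(d\phi,\tau(\phi))d\phi=0 .$$ Let $f:\Sigma\to(0,\infty)$ be smooth. Then the conformal immersion $\varphi:(\Sigma,\bar g=f^{-1}\varphi^*h)\to(N^3,h)$ is biharmonic if and only if the following system holds on $\Sigma$: $$\begin{cases} \kappa''-\kappa^3-2\kappa\tau^2+\kappa\,{\rm Ric}^N(\xi,\xi)+2\kappa'X(\ln f)+\kappa\{XX(\ln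 f)+VV(\ln f)+(X\ln f)^2+(V\ln f)^2\}=0,\\ 3\kappa\kappa'-2\kappa\,{\rm Ric}^N(\xi,X)+2\kappa^2X(\ln f)-2\kappa\tau V(\ln f)=0,\\ \kappa'\tau+\kappa\,{\rm Ric}^N(\xi,V)+\kappa\tau X(\ln f)=0. \end{cases}$$ -/

import Mathlib

open scoped Manifold ContDiff

noncomputable section

namespace HopfCyl

/-! ### Riemannian geometry in coordinates

`G : ℝⁿ → Matrix` is the matrix field of a metric in a coordinate chart, `Φ : ℝᵐ → ℝⁿ` the
coordinate expression of a map, `W : ℝᵐ → (Fin n → ℝ)` the components of a vector field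
along `Φ`. -/

/-- The partial derivative `∂ᵢ u` at `y`. -/
def pd {m : ℕ} (i : Fin m) (u : EuclideanSpace ℝ (Fin m) → ℝ) (y : EuclideanSpace ℝ (Fin m)) : ℝ :=
  fderiv ℝ u y (EuclideanSpace.single i 1)

/-- The Christoffel symbol `Γᵏᵢⱼ = ½ gᵏˡ (∂ᵢ gⱼₗ + ∂ⱼ gᵢₗ - ∂ₗ gᵢⱼ)`. -/
def christoffel {n : ℕ} (G : EuclideanSpace ℝ (Fin n) → Matrix (Fin n) (Fin n) ℝ)
    (k i j : Fin n) (y : EuclideanSpace ℝ (Fin n)) : ℝ :=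
  (1 / 2 : ℝ) * ∑ l, (G y)⁻¹ k l *
    (pd i (fun z => G z j l) y + pd j (fun z => G z i l) y - pd l (fun z => G z i j) y)

/-- The `∂ₗ`-component of `R(∂ᵢ, ∂ⱼ)∂ₖ`, where
`R(X, Y)Z = ∇_X ∇_Y Z - ∇_Y ∇_X Z - ∇_[X,Y] Z`. -/
def riemann {n : ℕ} (G : EuclideanSpace ℝ (Fin n) → Matrix (Fin n) (Fin n) ℝ)
    (l i j k : Fin n) (y : EuclideanSpace ℝ (Fin n)) : ℝ :=
  pd i (christoffel G l j k) y - pd j (christoffel G l i k) y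
    + ∑ q, (christoffel G l i q y * christoffel G q j k y
        - christoffel G l j q y * christoffel G q i k y)

/-- `Ric(∂ⱼ, ∂ₖ)`, the trace of `Z ↦ R(Z, ∂ⱼ)∂ₖ`. -/
def ricciCoord {n : ℕ} (G : EuclideanSpace ℝ (Fin n) → Matrix (Fin n) (Fin n) ℝ)
    (j k : Fin n) (y : EuclideanSpace ℝ (Fin n)) : ℝ :=
  ∑ i, riemann G i i j k y

/-- Components of `∇^Φ_{∂ᵢ} W`, the pull-back of the Levi-Civita connection of `H` applied to a
vector field `W` along `Φ`. -/
def nabla {m n : ℕ} (H : EuclideanSpace ℝ (Fin n) → Matrix (Fin n) (Fin n) ℝ)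
    (Φ : EuclideanSpace ℝ (Fin m) → EuclideanSpace ℝ (Fin n)) (i : Fin m)
    (W : EuclideanSpace ℝ (Fin m) → Fin n → ℝ) (y : EuclideanSpace ℝ (Fin m)) (a : Fin n) : ℝ :=
  pd i (fun z => W z a) y
    + ∑ b, ∑ c, christoffel H a b c (Φ y) * pd i (fun z => Φ z b) y * W y c

/-- Components of `dΦ(∂ⱼ)`. -/
def dmap {m n : ℕ} (Φ : EuclideanSpace ℝ (Fin m) → EuclideanSpace ℝ (Fin n)) (j : Fin m)
    (y : EuclideanSpace ℝ (Fin m)) (a : Fin n) : ℝ :=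
  pd j (fun z => Φ z a) y

/-- Components of the tension field `τ(Φ) = Trace_G ∇dΦ` of `Φ : (ℝᵐ, G) → (ℝⁿ, H)`. -/
def tensionCoord {m n : ℕ} (G : EuclideanSpace ℝ (Fin m) → Matrix (Fin m) (Fin m) ℝ)
    (H : EuclideanSpace ℝ (Fin n) → Matrix (Fin n) (Fin n) ℝ)
    (Φ : EuclideanSpace ℝ (Fin m) → EuclideanSpace ℝ (Fin n))
    (y : EuclideanSpace ℝ (Fin m)) (a : Fin n) : ℝ :=
  ∑ i, ∑ j, (G y)⁻¹ i j *
    (nabla H Φ i (dmap Φ j) y a - ∑ k, christoffel G k i j y * dmap Φ k y a)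

/-- Components of the bitension field
`τ₂(Φ) = Trace_G (∇^Φ ∇^Φ - ∇^Φ_{∇^G}) τ(Φ) - Trace_G R^H(dΦ, τ(Φ)) dΦ`. -/
def bitensionCoord {m n : ℕ} (G : EuclideanSpace ℝ (Fin m) → Matrix (Fin m) (Fin m) ℝ)
    (H : EuclideanSpace ℝ (Fin n) → Matrix (Fin n) (Fin n) ℝ)
    (Φ : EuclideanSpace ℝ (Fin m) → EuclideanSpace ℝ (Fin n))
    (y : EuclideanSpace ℝ (Fin m)) (a : Fin n) : ℝ :=
  ∑ i, ∑ j, (G y)⁻¹ i j *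
    (nabla H Φ i (nabla H Φ j (tensionCoord G H Φ)) y a
      - ∑ k, christoffel G k i j y * nabla H Φ k (tensionCoord G H Φ) y a
      - ∑ b, ∑ c, ∑ d, riemann H a b c d (Φ y)
          * dmap Φ i y b * tensionCoord G H Φ y c * dmap Φ j y d)

/-! ### Riemannian geometry on manifolds

Points `x` of a manifold are studied in the preferred chart `extChartAt (𝓡 n) x`; all the objects
below are tensorial, so that the choice of the chart does not matter. -/

/-- A field of (bilinear) forms on the tangent spaces of `M`. -/
abbrev FormField (n : ℕ) (M : Type*) [TopologicalSpace M]
    [ChartedSpace (EuclideanSpace ℝ (Fin n)) M] :=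
  ∀ x : M, TangentSpace (𝓡 n) x → TangentSpace (𝓡 n) x → ℝ

/-- A smooth Riemannian metric on `M`. -/
abbrev RiemMetric (n : ℕ) (M : Type*) [TopologicalSpace M]
    [ChartedSpace (EuclideanSpace ℝ (Fin n)) M] [IsManifold (𝓡 n) ∞ M] :=
  Bundle.ContMDiffRiemannianMetric (𝓡 n) ∞ (EuclideanSpace ℝ (Fin n))
    (fun x : M => TangentSpace (𝓡 n) x)

/-- The metric as a field of forms, `⟨v, w⟩ = h_x(v, w)`. -/
def RiemMetric.form {n : ℕ} {M : Type*} [TopologicalSpace M]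
    [ChartedSpace (EuclideanSpace ℝ (Fin n)) M] [IsManifold (𝓡 n) ∞ M]
    (h : RiemMetric n M) : FormField n M :=
  fun x v w => h.inner x v w

section

variable {m n : ℕ}
  {M : Type*} [TopologicalSpace M] [ChartedSpace (EuclideanSpace ℝ (Fin m)) M]
  {N : Type*} [TopologicalSpace N] [ChartedSpace (EuclideanSpace ℝ (Fin n)) N]

/-- The coordinate vector field `∂ᵢ` of the chart at `x₀`, at the point with coordinates `y`. -/
def coordVec (x₀ : M) (i : Fin m) (y : EuclideanSpace ℝ (Fin m)) :
    TangentSpace (𝓡 m) ((extChartAt (𝓡 m) x₀).symm y) :=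
  mfderiv 𝓘(ℝ, EuclideanSpace ℝ (Fin m)) (𝓡 m) (extChartAt (𝓡 m) x₀).symm y
    (EuclideanSpace.single i (1 : ℝ) : EuclideanSpace ℝ (Fin m))

/-- The matrix `g(∂ᵢ, ∂ⱼ)` of `g` in the chart at `x₀`, as a function of the coordinates. -/
def coordMetric (g : FormField m M) (x₀ : M) (y : EuclideanSpace ℝ (Fin m)) :
    Matrix (Fin m) (Fin m) ℝ :=
  Matrix.of fun i j => g ((extChartAt (𝓡 m) x₀).symm y) (coordVec x₀ i y) (coordVec x₀ j y)

/-- The components of the tangent vector `v` at `x` in the chart at `x₀`. -/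
def coords (x₀ x : M) (v : TangentSpace (𝓡 m) x) : EuclideanSpace ℝ (Fin m) :=
  mfderiv (𝓡 m) 𝓘(ℝ, EuclideanSpace ℝ (Fin m)) (extChartAt (𝓡 m) x₀) x v

/-- The tangent vector at `x` whose components in the chart at `x` are `w`. -/
def ofCoords (x : M) (w : Fin m → ℝ) : TangentSpace (𝓡 m) x :=
  mfderiv 𝓘(ℝ, EuclideanSpace ℝ (Fin m)) (𝓡 m) (extChartAt (𝓡 m) x).symm (extChartAt (𝓡 m) x x)
    (WithLp.toLp 2 w : EuclideanSpace ℝ (Fin m))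

/-- The Ricci curvature `Ric(v, w)` of the metric `h`. -/
def Ric (h : FormField n N) (x : N) (v w : TangentSpace (𝓡 n) x) : ℝ :=
  ∑ j, ∑ k, ricciCoord (coordMetric h x) j k (extChartAt (𝓡 n) x x)
    * coords x x v j * coords x x w k

/-- For a vector field `W` along `φ : M → (N, h)`, the covariant derivative `∇^φ_v W` in direction
`v ∈ T_p M`, with respect to the Levi-Civita connection of `h`. -/
def covDeriv (h : FormField n N) (φ : M → N) (W : ∀ p : M, TangentSpace (𝓡 n) (φ p)) (p : M)
    (v : TangentSpace (𝓡 m) p) : TangentSpace (𝓡 n) (φ p) :=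
  ofCoords (φ p) fun a => ∑ i, coords p p v i *
    nabla (coordMetric h (φ p)) (writtenInExtChartAt (𝓡 m) (𝓡 n) p φ) i
      (fun y b => coords (φ p) (φ ((extChartAt (𝓡 m) p).symm y))
        (W ((extChartAt (𝓡 m) p).symm y)) b)
      (extChartAt (𝓡 m) p p) a

/-- The map `φ : (M, g) → (N, h)` is biharmonic: its bitension field vanishes identically. -/
def IsBiharmonic (g : FormField m M) (h : FormField n N) (φ : M → N) : Prop :=
  ∀ (p : M) (a : Fin n), bitensionCoord (coordMetric g p) (coordMetric h (φ p))
    (writtenInExtChartAt (𝓡 m) (𝓡 n) p φ) (extChartAt (𝓡 m) p p) a = 0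

/-- The conformal metric `f⁻¹ φ*h`. -/
def conformalPullback (f : M → ℝ) (φ : M → N) (h : FormField n N) : FormField m M := fun p v w =>
  (f p)⁻¹ * h (φ p) (mfderiv (𝓡 m) (𝓡 n) φ p v) (mfderiv (𝓡 m) (𝓡 n) φ p w)

/-- `π : (N, h) → (B, h₁)` is a Riemannian submersion: a smooth submersion whose differential maps
the orthogonal complement of `ker dπ` isometrically. -/
structure IsRiemannianSubmersion (h : FormField n N) (h₁ : FormField m M) (π : N → M) : Prop where
  smooth : ContMDiff (𝓡 n) (𝓡 m) ∞ π
  submersion : ∀ x : N, Function.Surjective (mfderiv (𝓡 n) (𝓡 m) π x)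
  isometric : ∀ (x : N) (v w : TangentSpace (𝓡 n) x),
    (∀ u : TangentSpace (𝓡 n) x, mfderiv (𝓡 n) (𝓡 m) π x u = 0 → h x v u = 0) →
    (∀ u : TangentSpace (𝓡 n) x, mfderiv (𝓡 n) (𝓡 m) π x u = 0 → h x w u = 0) →
    h₁ (π x) (mfderiv (𝓡 n) (𝓡 m) π x v) (mfderiv (𝓡 n) (𝓡 m) π x w) = h x v w

/-- The fibres of `π` are totally geodesic in `(N, h)`: for every local vertical vector field `W`
and every vertical vector `u`, the vector `∇_u W` is vertical. -/
def HasTotallyGeodesicFibres [IsManifold (𝓡 n) ∞ N] (h : FormField n N) (π : N → M) : Prop :=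
  ∀ (U : Set N) (W : ∀ x : N, TangentSpace (𝓡 n) x), IsOpen U →
    ContMDiffOn (𝓡 n) (𝓡 n).tangent ∞
      (fun x => (⟨x, W x⟩ : TangentBundle (𝓡 n) N)) U →
    (∀ x ∈ U, mfderiv (𝓡 n) (𝓡 m) π x (W x) = 0) →
    ∀ x ∈ U, ∀ u : TangentSpace (𝓡 n) x, mfderiv (𝓡 n) (𝓡 m) π x u = 0 →
      mfderiv (𝓡 n) (𝓡 m) π x (covDeriv h (fun x : N => x) W x u) = 0

end

section

variable {B : Type*} [TopologicalSpace B] [ChartedSpace (EuclideanSpace ℝ (Fin 2)) B]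
  {N : Type*} [TopologicalSpace N] [ChartedSpace (EuclideanSpace ℝ (Fin 3)) N]
  {S : Type*} [TopologicalSpace S] [ChartedSpace (EuclideanSpace ℝ (Fin 2)) S]

/-- The derivative `X(u)` of the function `u` along the vector field `X`. -/
def dirDeriv (X : ∀ p : S, TangentSpace (𝓡 2) p) (u : S → ℝ) (p : S) : ℝ :=
  mfderiv (𝓡 2) 𝓘(ℝ, ℝ) u p (X p)

/-- The velocity `γ'(t)`. -/
def velocity (γ : ℝ → B) (t : ℝ) : TangentSpace (𝓡 2) (γ t) :=
  mfderiv 𝓘(ℝ, ℝ) (𝓡 2) γ t (1 : ℝ)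

/-- `γ : J → (B, h₁)` is a smooth curve on an open interval, parametrized by arclength (hence
regular). -/
structure IsArclengthCurve (h₁ : FormField 2 B) (J : Set ℝ) (γ : ℝ → B) : Prop where
  isOpen : IsOpen J
  ordConnected : J.OrdConnected
  smooth : ContMDiffOn 𝓘(ℝ, ℝ) (𝓡 2) ∞ γ J
  unit : ∀ t ∈ J, h₁ (γ t) (velocity γ t) (velocity γ t) = 1

/-- The surface `S`, with the map `φ : S → N` and the function `s : S → J`, is the Hopf cylinder
`⋃_{t ∈ J} π⁻¹(γ(t))`. As `γ` need not be injective, it is the disjoint union of the fibres over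
the points of `J`: `p ↦ (s p, φ p)` embeds `S` smoothly onto `{(t, x) ∈ J × N | π x = γ t}`, and
`φ` is an immersion. -/
structure IsHopfCylinder (π : N → B) (J : Set ℝ) (γ : ℝ → B) (s : S → ℝ) (φ : S → N) :
    Prop where
  smooth_s : ContMDiff (𝓡 2) 𝓘(ℝ, ℝ) ∞ s
  smooth_φ : ContMDiff (𝓡 2) (𝓡 3) ∞ φ
  immersion : ∀ p : S, Function.Injective (mfderiv (𝓡 2) (𝓡 3) φ p)
  embedding : Topology.IsEmbedding fun p : S => (s p, φ p)
  range_eq : Set.range (fun p : S => (s p, φ p)) = {q : ℝ × N | q.1 ∈ J ∧ π q.2 = γ q.1}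

/-- `{X, V, ξ}` is an orthonormal frame adapted to the Hopf cylinder `φ : S → (N, h)`: `X` is
horizontal and projects to `γ'`, i.e. the integral curves of `X` are the horizontal lifts of `γ`
parametrized by arclength, `V` is a unit vertical field, and `ξ` is a unit normal field. -/
structure IsAdaptedFrame [IsManifold (𝓡 3) ∞ N] [IsManifold (𝓡 2) ∞ S]
    (h : FormField 3 N) (π : N → B) (γ : ℝ → B) (s : S → ℝ) (φ : S → N)
    (X V : ∀ p : S, TangentSpace (𝓡 2) p) (ξ : ∀ p : S, TangentSpace (𝓡 3) (φ p)) : Prop where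
  smooth_X : ContMDiff (𝓡 2) (𝓡 2).tangent ∞ (fun p => (⟨p, X p⟩ : TangentBundle (𝓡 2) S))
  smooth_V : ContMDiff (𝓡 2) (𝓡 2).tangent ∞ (fun p => (⟨p, V p⟩ : TangentBundle (𝓡 2) S))
  smooth_ξ : ContMDiff (𝓡 2) (𝓡 3).tangent ∞ (fun p => (⟨φ p, ξ p⟩ : TangentBundle (𝓡 3) N))
  horizontal : ∀ (p : S) (u : TangentSpace (𝓡 3) (φ p)), mfderiv (𝓡 3) (𝓡 2) π (φ p) u = 0 →
    h (φ p) (mfderiv (𝓡 2) (𝓡 3) φ p (X p)) u = 0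
  lift : ∀ p : S, (mfderiv (𝓡 3) (𝓡 2) π (φ p) (mfderiv (𝓡 2) (𝓡 3) φ p (X p)) :
    EuclideanSpace ℝ (Fin 2)) = velocity γ (s p)
  vertical : ∀ p : S, mfderiv (𝓡 3) (𝓡 2) π (φ p) (mfderiv (𝓡 2) (𝓡 3) φ p (V p)) = 0
  unit_V : ∀ p : S,
    h (φ p) (mfderiv (𝓡 2) (𝓡 3) φ p (V p)) (mfderiv (𝓡 2) (𝓡 3) φ p (V p)) = 1
  unit_ξ : ∀ p : S, h (φ p) (ξ p) (ξ p) = 1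
  normal : ∀ (p : S) (v : TangentSpace (𝓡 2) p),
    h (φ p) (ξ p) (mfderiv (𝓡 2) (𝓡 3) φ p v) = 0

/-- The geodesic curvature `κ = ⟨∇_X X, ξ⟩` of the horizontal lifts of `γ`. -/
def geodCurvature (h : FormField 3 N) (φ : S → N) (X : ∀ p : S, TangentSpace (𝓡 2) p)
    (ξ : ∀ p : S, TangentSpace (𝓡 3) (φ p)) (p : S) : ℝ :=
  h (φ p) (covDeriv h φ (fun q => mfderiv (𝓡 2) (𝓡 3) φ q (X q)) p (X p)) (ξ p)

/-- The torsion `τ = ⟨∇_X ξ, V⟩ = -⟨∇_X V, ξ⟩` of the horizontal lifts of `γ`; their Frenet frame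
is `X, ξ, V`. -/
def geodTorsion (h : FormField 3 N) (φ : S → N) (X V : ∀ p : S, TangentSpace (𝓡 2) p)
    (ξ : ∀ p : S, TangentSpace (𝓡 3) (φ p)) (p : S) : ℝ :=
  h (φ p) (covDeriv h φ ξ p (X p)) (mfderiv (𝓡 2) (𝓡 3) φ p (V p))

end

end HopfCyl

end

/-! Everything is local, so the geometry is read in the charts at `p` and `φ p`, where the frame
becomes fields `x`, `v` on an open subset of the plane and a field `ξ` along the coordinate map `Φ`.
Write X, V also for the images of `x`, `v` under dΦ.

Three facts come from the submersion. The fibres are geodesics, so ∇_V V = 0. The fields commute: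
[X,V] kills the parameter s because Xs = 1 and Vs = 0, hence it is vertical, and its V-component
⟨∇_X V,V⟩ - ⟨∇_V X,V⟩ = ⟨X,∇_V V⟩ vanishes (`IsAdaptedFrame.brk_eq_zero`). Finally Vκ = 0, because κ
is the geodesic curvature of γ in the base (`IsSubmersionOn.curvatureFn_eq`,
`IsSubmersionOn.dd_curvatureFn`).

Orthonormality, [X,V] = 0 and ∇_V V = 0 force the frame equations ∇_X X = κξ, ∇_X V = ∇_V X = -τξ,
∇_X ξ = -κX + τV, ∇_V ξ = τX. Commuting the derivatives of ξ gives R(X,V)ξ = (Xτ + Vκ)X - (Vτ)V,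
that is, Ric(ξ,V) = Xτ + Vκ and Ric(ξ,X) = Vτ (`IsFrameOn.ricci_ξ_v`, `IsFrameOn.ricci_ξ_x`).

For the metric f⁻¹φ*h the commuting fields X, V are orthogonal of equal length, so their
accelerations add up to zero (`IsConformalOn.acceleration`). Consequently the trace of a second
covariant derivative is f(∇_X∇_X + ∇_V∇_V) with no first-order correction
(`IsConformalOn.trace_nabla`). The tension field is therefore uξ with u = fκ, and the bitension
field is f times ∇_X∇_X(uξ) + ∇_V∇_V(uξ) - u(R(X,ξ)X + R(V,ξ)V).

Expanding with the frame equations, Vκ = 0 and the two Ricci identities, the components along ξ, X,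
V are f², -f² and 2f² times the left-hand sides of the three equations
(`IsConformalOn.bitension_eq_zero_iff`). Since f is positive, the equivalence follows. The remaining
work is the passage between manifolds and charts, above all the chart independence of the covariant
derivative (`coords_covDeriv`). -/

set_option linter.unusedSectionVars false

noncomputable section

namespace HopfCyl

/-! ### Calculus of partial derivatives -/

section PartialDerivatives

variable {m n : ℕ} {U : Set (EuclideanSpace ℝ (Fin m))}

theorem _root_.ContDiffOn.differentiableAt_of_isOpen {E F : Type*} [NormedAddCommGroup E]
    [NormedSpace ℝ E] [NormedAddCommGroup F] [NormedSpace ℝ F] {u : E → F} {U : Set E} {y : E}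
    (hu : ContDiffOn ℝ ∞ u U) (hU : IsOpen U) (hy : y ∈ U) : DifferentiableAt ℝ u y :=
  (hu.contDiffAt (hU.mem_nhds hy)).differentiableAt (by simp)

theorem pd_add {i : Fin m} {u v : EuclideanSpace ℝ (Fin m) → ℝ} {y : EuclideanSpace ℝ (Fin m)}
    (hu : DifferentiableAt ℝ u y) (hv : DifferentiableAt ℝ v y) :
    pd i (fun z => u z + v z) y = pd i u y + pd i v y := by
  simp only [pd]; rw [fderiv_fun_add hu hv]; rfl

theorem pd_sub {i : Fin m} {u v : EuclideanSpace ℝ (Fin m) → ℝ} {y : EuclideanSpace ℝ (Fin m)}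
    (hu : DifferentiableAt ℝ u y) (hv : DifferentiableAt ℝ v y) :
    pd i (fun z => u z - v z) y = pd i u y - pd i v y := by
  simp only [pd]; rw [fderiv_fun_sub hu hv]; rfl

theorem pd_mul {i : Fin m} {u v : EuclideanSpace ℝ (Fin m) → ℝ} {y : EuclideanSpace ℝ (Fin m)}
    (hu : DifferentiableAt ℝ u y) (hv : DifferentiableAt ℝ v y) :
    pd i (fun z => u z * v z) y = u y * pd i v y + pd i u y * v y := by
  simp only [pd]; rw [fderiv_fun_mul hu hv]; simp [mul_comm]

theorem pd_const (i : Fin m) (c : ℝ) (y : EuclideanSpace ℝ (Fin m)) :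
    pd i (fun _ => c) y = 0 := by
  simp [pd]

theorem pd_sum {ι : Type*} {s : Finset ι} {i : Fin m} {u : ι → EuclideanSpace ℝ (Fin m) → ℝ}
    {y : EuclideanSpace ℝ (Fin m)} (hu : ∀ a ∈ s, DifferentiableAt ℝ (u a) y) :
    pd i (fun z => ∑ a ∈ s, u a z) y = ∑ a ∈ s, pd i (u a) y := by
  simp only [pd]; rw [fderiv_fun_sum hu]; simp

theorem pd_congr {i : Fin m} {u v : EuclideanSpace ℝ (Fin m) → ℝ} (hU : IsOpen U)
    (h : ∀ y ∈ U, u y = v y) {y : EuclideanSpace ℝ (Fin m)} (hy : y ∈ U) :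
    pd i u y = pd i v y := by
  have : u =ᶠ[nhds y] v := Filter.eventually_of_mem (hU.mem_nhds hy) h
  simp only [pd, this.fderiv_eq]

theorem pd_contDiffOn {u : EuclideanSpace ℝ (Fin m) → ℝ} (hU : IsOpen U)
    (hu : ContDiffOn ℝ ∞ u U) (i : Fin m) : ContDiffOn ℝ ∞ (pd i u) U :=
  (hu.fderiv_of_isOpen hU (by simp)).clm_apply contDiffOn_const

theorem fderiv_apply_eq_sum {u : EuclideanSpace ℝ (Fin m) → ℝ} (y v : EuclideanSpace ℝ (Fin m)) :
    fderiv ℝ u y v = ∑ i, v i * pd i u y := by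
  have hv : v = ∑ i, v i • EuclideanSpace.single i (1 : ℝ) := by
    ext j; simp [Finset.sum_apply, Pi.single_apply]
  conv_lhs => rw [hv]
  simp [pd]

theorem pd_comm {u : EuclideanSpace ℝ (Fin m) → ℝ} (hU : IsOpen U)
    (hu : ContDiffOn ℝ ∞ u U) {y : EuclideanSpace ℝ (Fin m)} (hy : y ∈ U) (i j : Fin m) :
    pd i (pd j u) y = pd j (pd i u) y := by
  have hat := hu.contDiffAt (hU.mem_nhds hy)
  have hs : IsSymmSndFDerivAt ℝ u y := hat.isSymmSndFDerivAt (by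
    rw [minSmoothness_of_isRCLikeNormedField]
    exact WithTop.coe_le_coe.2 (le_top (a := (2 : ℕ∞))))
  have hd : DifferentiableAt ℝ (fderiv ℝ u) y :=
    (hu.fderiv_of_isOpen hU (m := ∞) (by simp)).differentiableAt_of_isOpen hU hy
  have key : ∀ k l : Fin m, pd k (pd l u) y = fderiv ℝ (fderiv ℝ u) y
      (EuclideanSpace.single k 1) (EuclideanSpace.single l 1) := by
    intro k l
    unfold pd
    rw [fderiv_clm_apply hd (differentiableAt_const _)]
    simp
  rw [key, key]
  exact hs _ _

theorem pd_comp {g : EuclideanSpace ℝ (Fin n) → ℝ}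
    {Φ : EuclideanSpace ℝ (Fin m) → EuclideanSpace ℝ (Fin n)} {y : EuclideanSpace ℝ (Fin m)}
    (hg : DifferentiableAt ℝ g (Φ y)) (hΦ : DifferentiableAt ℝ Φ y) (i : Fin m) :
    pd i (fun z => g (Φ z)) y = ∑ a, pd a g (Φ y) * pd i (fun z => Φ z a) y := by
  have h1 : fderiv ℝ (fun z => g (Φ z)) y = (fderiv ℝ g (Φ y)).comp (fderiv ℝ Φ y) :=
    fderiv_comp y hg hΦ
  have h2 : ∀ a, pd i (fun z => Φ z a) y = (fderiv ℝ Φ y (EuclideanSpace.single i 1)) a := by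
    intro a
    have : HasFDerivAt (fun z => Φ z a)
      ((EuclideanSpace.proj a : EuclideanSpace ℝ (Fin n) →L[ℝ] ℝ).comp (fderiv ℝ Φ y)) y :=
      (EuclideanSpace.proj a : EuclideanSpace ℝ (Fin n) →L[ℝ] ℝ).hasFDerivAt.comp y
        hΦ.hasFDerivAt
    simp [pd, this.fderiv]
  unfold pd at h2 ⊢
  rw [h1, ContinuousLinearMap.comp_apply, fderiv_apply_eq_sum]
  exact Finset.sum_congr rfl fun a _ => by rw [h2 a, mul_comm]; rfl

theorem differentiableAt_of_components {Φ : EuclideanSpace ℝ (Fin m) → EuclideanSpace ℝ (Fin n)}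
    (hU : IsOpen U) (hΦ : ∀ a, ContDiffOn ℝ ∞ (fun z => Φ z a) U)
    {y : EuclideanSpace ℝ (Fin m)} (hy : y ∈ U) : DifferentiableAt ℝ Φ y :=
  (contDiffOn_euclidean.2 hΦ).differentiableAt_of_isOpen hU hy

theorem comp_contDiffOn {Ω : Set (EuclideanSpace ℝ (Fin n))} {g : EuclideanSpace ℝ (Fin n) → ℝ}
    {Φ : EuclideanSpace ℝ (Fin m) → EuclideanSpace ℝ (Fin n)}
    (hg : ContDiffOn ℝ ∞ g Ω) (hΦ : ∀ a, ContDiffOn ℝ ∞ (fun z => Φ z a) U)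
    (hm : Set.MapsTo Φ U Ω) : ContDiffOn ℝ ∞ (fun z => g (Φ z)) U :=
  hg.comp (contDiffOn_euclidean.2 hΦ) hm

end PartialDerivatives

/-! ### Metrics given by matrices -/

/-- The bilinear form with matrix `A`. -/
def ip {n : ℕ} (A : Matrix (Fin n) (Fin n) ℝ) (v w : Fin n → ℝ) : ℝ :=
  ∑ a, ∑ b, A a b * v a * w b

/-- The Christoffel symbols of the first kind. -/
def lowChristoffel {n : ℕ} (H : EuclideanSpace ℝ (Fin n) → Matrix (Fin n) (Fin n) ℝ)
    (l i j : Fin n) (y : EuclideanSpace ℝ (Fin n)) : ℝ :=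
  (1 / 2 : ℝ) * (pd i (fun z => H z j l) y + pd j (fun z => H z i l) y - pd l (fun z => H z i j) y)

/-- `H` is a smooth field of invertible symmetric matrices on the open set `Ω`. -/
structure IsMetricOn {n : ℕ} (H : EuclideanSpace ℝ (Fin n) → Matrix (Fin n) (Fin n) ℝ)
    (Ω : Set (EuclideanSpace ℝ (Fin n))) : Prop where
  isOpen : IsOpen Ω
  smooth : ∀ i j, ContDiffOn ℝ ∞ (fun z => H z i j) Ω
  symm : ∀ z ∈ Ω, ∀ i j, H z i j = H z j i
  det : ∀ z ∈ Ω, IsUnit (H z).det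

section Metric

variable {n : ℕ}

theorem ip_add_left (A : Matrix (Fin n) (Fin n) ℝ) (v v' w : Fin n → ℝ) :
    ip A (v + v') w = ip A v w + ip A v' w := by
  simp [ip, mul_add, add_mul, Finset.sum_add_distrib]

theorem ip_add_right (A : Matrix (Fin n) (Fin n) ℝ) (v w w' : Fin n → ℝ) :
    ip A v (w + w') = ip A v w + ip A v w' := by
  simp [ip, mul_add, Finset.sum_add_distrib]

theorem ip_smul_left (A : Matrix (Fin n) (Fin n) ℝ) (c : ℝ) (v w : Fin n → ℝ) :
    ip A (c • v) w = c * ip A v w := by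
  simp only [ip, Finset.mul_sum, Pi.smul_apply, smul_eq_mul]
  exact Finset.sum_congr rfl fun _ _ => Finset.sum_congr rfl fun _ _ => by ring

theorem ip_smul_right (A : Matrix (Fin n) (Fin n) ℝ) (c : ℝ) (v w : Fin n → ℝ) :
    ip A v (c • w) = c * ip A v w := by
  simp only [ip, Finset.mul_sum, Pi.smul_apply, smul_eq_mul]
  exact Finset.sum_congr rfl fun _ _ => Finset.sum_congr rfl fun _ _ => by ring

theorem ip_zero_left (A : Matrix (Fin n) (Fin n) ℝ) (w : Fin n → ℝ) : ip A 0 w = 0 := by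
  simp [ip]

theorem ip_zero_right (A : Matrix (Fin n) (Fin n) ℝ) (w : Fin n → ℝ) : ip A w 0 = 0 := by
  simp [ip]

theorem ip_neg_left (A : Matrix (Fin n) (Fin n) ℝ) (v w : Fin n → ℝ) :
    ip A (-v) w = -ip A v w := by
  simp [ip]

theorem ip_neg_right (A : Matrix (Fin n) (Fin n) ℝ) (v w : Fin n → ℝ) :
    ip A v (-w) = -ip A v w := by
  simp [ip]

theorem ip_sub_left (A : Matrix (Fin n) (Fin n) ℝ) (v v' w : Fin n → ℝ) :
    ip A (v - v') w = ip A v w - ip A v' w := by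
  rw [sub_eq_add_neg, ip_add_left, ip_neg_left, sub_eq_add_neg]

theorem ip_sub_right (A : Matrix (Fin n) (Fin n) ℝ) (v w w' : Fin n → ℝ) :
    ip A v (w - w') = ip A v w - ip A v w' := by
  rw [sub_eq_add_neg, ip_add_right, ip_neg_right, sub_eq_add_neg]

theorem ip_sum_left {ι : Type*} (s : Finset ι) (A : Matrix (Fin n) (Fin n) ℝ)
    (v : ι → Fin n → ℝ) (w : Fin n → ℝ) :
    ip A (∑ k ∈ s, v k) w = ∑ k ∈ s, ip A (v k) w := by
  classical
  induction s using Finset.induction_on with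
  | empty => simp [ip]
  | insert a s ha ih => rw [Finset.sum_insert ha, Finset.sum_insert ha, ip_add_left, ih]

theorem ip_sum_right {ι : Type*} (s : Finset ι) (A : Matrix (Fin n) (Fin n) ℝ)
    (v : ι → Fin n → ℝ) (w : Fin n → ℝ) :
    ip A w (∑ k ∈ s, v k) = ∑ k ∈ s, ip A w (v k) := by
  classical
  induction s using Finset.induction_on with
  | empty => simp [ip]
  | insert a s ha ih => rw [Finset.sum_insert ha, Finset.sum_insert ha, ip_add_right, ih]

theorem ip_comm {A : Matrix (Fin n) (Fin n) ℝ} (hA : ∀ i j, A i j = A j i) (v w : Fin n → ℝ) :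
    ip A v w = ip A w v := by
  rw [ip, ip, Finset.sum_comm]
  exact Finset.sum_congr rfl fun i _ => Finset.sum_congr rfl fun j _ => by rw [hA]; ring

theorem ip_single_left (A : Matrix (Fin n) (Fin n) ℝ) (k : Fin n) (w : Fin n → ℝ) :
    ip A (Pi.single k 1) w = ∑ b, A k b * w b := by
  simp [ip, Pi.single_apply]

theorem ip_single_right (A : Matrix (Fin n) (Fin n) ℝ) (k : Fin n) (v : Fin n → ℝ) :
    ip A v (Pi.single k 1) = ∑ b, A b k * v b := by
  simp [ip, Pi.single_apply]

theorem ip_single_single (A : Matrix (Fin n) (Fin n) ℝ) (k l : Fin n) :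
    ip A (Pi.single k 1) (Pi.single l 1) = A k l := by
  simp [ip, Pi.single_apply]

theorem eq_zero_of_ip_right {A : Matrix (Fin n) (Fin n) ℝ} (hA : IsUnit A.det) {v : Fin n → ℝ}
    (h : ∀ w, ip A w v = 0) : v = 0 := by
  have h0 : A.mulVec v = 0 := by
    ext k
    have := h (Pi.single k 1)
    rw [ip_single_left] at this
    simpa [Matrix.mulVec, dotProduct] using this
  have := congrArg (A⁻¹.mulVec) h0
  rwa [Matrix.mulVec_mulVec, Matrix.nonsing_inv_mul _ hA, Matrix.one_mulVec,
    Matrix.mulVec_zero] at this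

/-- A family of `n` orthonormal vectors inverts the Gram matrix. -/
theorem inv_eq_of_orthonormal {A : Matrix (Fin n) (Fin n) ℝ} {e : Fin n → Fin n → ℝ}
    (he : ∀ i j, ip A (e i) (e j) = if i = j then 1 else 0) :
    A * (Matrix.of fun a b => ∑ i, e i a * e i b) = 1 := by
  set M : Matrix (Fin n) (Fin n) ℝ := Matrix.of e with hM
  have h1 : M * (A * M.transpose) = 1 := by
    ext i j
    rw [Matrix.one_apply, ← he i j]
    simp only [Matrix.mul_apply, Matrix.transpose_apply, hM, Matrix.of_apply, ip, Finset.mul_sum]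
    exact Finset.sum_congr rfl fun _ _ => Finset.sum_congr rfl fun _ _ => by ring
  -- The matrices are square, so a left inverse of A Mᵀ is also a right inverse; Mᵀ M is the sum of
  -- the matrices e_i e_iᵀ.
  have h2 : A * M.transpose * M = 1 := mul_eq_one_comm.1 h1
  rw [Matrix.mul_assoc] at h2
  convert h2 using 2
  ext a b
  simp [Matrix.mul_apply, hM]

theorem ip_expand_of_orthonormal {A : Matrix (Fin n) (Fin n) ℝ} {e : Fin n → Fin n → ℝ}
    (he : ∀ i j, ip A (e i) (e j) = if i = j then 1 else 0) (w : Fin n → ℝ) :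
    w = ∑ i, ip A (e i) w • e i := by
  have h := mul_eq_one_comm.1 (inv_eq_of_orthonormal he)
  have h2 : w = ((Matrix.of fun a b => ∑ i, e i a * e i b) * A).mulVec w := by
    rw [h, Matrix.one_mulVec]
  conv_lhs => rw [h2]
  ext a
  simp only [Matrix.mulVec, dotProduct, Matrix.mul_apply, Matrix.of_apply, ip, Finset.sum_apply,
    Pi.smul_apply, smul_eq_mul, Finset.sum_mul]
  rw [Finset.sum_comm_cycle]
  refine Finset.sum_congr rfl fun i _ => ?_
  rw [Finset.sum_comm]
  exact Finset.sum_congr rfl fun _ _ => Finset.sum_congr rfl fun _ _ => by ring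

theorem det_contDiffOn {m : ℕ} {U : Set (EuclideanSpace ℝ (Fin m))}
    {A : EuclideanSpace ℝ (Fin m) → Matrix (Fin n) (Fin n) ℝ}
    (hA : ∀ i j, ContDiffOn ℝ ∞ (fun z => A z i j) U) : ContDiffOn ℝ ∞ (fun z => (A z).det) U := by
  simp only [Matrix.det_apply]
  exact ContDiffOn.sum fun σ _ => (contDiffOn_prod fun i _ => hA _ _).const_smul _

theorem inv_contDiffOn {m : ℕ} {U : Set (EuclideanSpace ℝ (Fin m))}
    {A : EuclideanSpace ℝ (Fin m) → Matrix (Fin n) (Fin n) ℝ}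
    (hA : ∀ i j, ContDiffOn ℝ ∞ (fun z => A z i j) U) (hdet : ∀ z ∈ U, IsUnit (A z).det)
    (i j : Fin n) : ContDiffOn ℝ ∞ (fun z => (A z)⁻¹ i j) U := by
  simp only [Matrix.inv_def, Ring.inverse_eq_inv', Matrix.smul_apply, smul_eq_mul,
    Matrix.adjugate_apply]
  refine ((det_contDiffOn hA).inv fun z hz => (hdet z hz).ne_zero).mul (det_contDiffOn ?_)
  intro k l
  simp only [Matrix.updateRow_apply]
  split_ifs
  · exact contDiffOn_const
  · exact hA k l

variable {H : EuclideanSpace ℝ (Fin n) → Matrix (Fin n) (Fin n) ℝ}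
  {Ω : Set (EuclideanSpace ℝ (Fin n))}

theorem IsMetricOn.christoffel_contDiffOn (hH : IsMetricOn H Ω) (k i j : Fin n) :
    ContDiffOn ℝ ∞ (christoffel H k i j) Ω := by
  unfold christoffel
  refine contDiffOn_const.mul (ContDiffOn.sum fun l _ => ?_)
  have h := fun a b c => pd_contDiffOn hH.isOpen (hH.smooth b c) a
  exact (inv_contDiffOn hH.smooth hH.det k l).mul (((h i j l).add (h j i l)).sub (h l i j))

theorem lowChristoffel_eq {y : EuclideanSpace ℝ (Fin n)} (hdet : IsUnit (H y).det)
    (l i j : Fin n) : ∑ k, H y l k * christoffel H k i j y = lowChristoffel H l i j y := by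
  have h : (fun k => christoffel H k i j y) =
      ((H y)⁻¹).mulVec fun l => lowChristoffel H l i j y := by
    ext k
    simp only [christoffel, lowChristoffel, Matrix.mulVec, dotProduct, Finset.mul_sum]
    exact Finset.sum_congr rfl fun _ _ => by ring
  have h2 := congrArg ((H y).mulVec) h
  rw [Matrix.mulVec_mulVec, Matrix.mul_nonsing_inv _ hdet, Matrix.one_mulVec] at h2
  exact congrFun h2 l

theorem IsMetricOn.pd_symm (hH : IsMetricOn H Ω) {y : EuclideanSpace ℝ (Fin n)} (hy : y ∈ Ω)
    (k i j : Fin n) : pd k (fun z => H z i j) y = pd k (fun z => H z j i) y :=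
  pd_congr hH.isOpen (fun z hz => hH.symm z hz i j) hy

theorem IsMetricOn.christoffel_comm (hH : IsMetricOn H Ω) {y : EuclideanSpace ℝ (Fin n)}
    (hy : y ∈ Ω) (k i j : Fin n) : christoffel H k i j y = christoffel H k j i y := by
  unfold christoffel
  congr 1
  refine Finset.sum_congr rfl fun l _ => ?_
  rw [hH.pd_symm hy l i j]; ring

/-- In the sum of the two first-kind symbols the other derivatives of the metric cancel by symmetry.
This is ∇H = 0 in coordinates, the source of `pd_ip`. -/
theorem IsMetricOn.pd_eq (hH : IsMetricOn H Ω) {y : EuclideanSpace ℝ (Fin n)} (hy : y ∈ Ω)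
    (k i j : Fin n) : pd k (fun z => H z i j) y =
      lowChristoffel H i k j y + lowChristoffel H j k i y := by
  unfold lowChristoffel
  rw [hH.pd_symm hy j k i, hH.pd_symm hy i k j, hH.pd_symm hy k j i]
  ring

end Metric

end HopfCyl

end

noncomputable section

namespace HopfCyl

/-! ### The pull-back connection -/

/-- `Φ` maps the open set `U` smoothly into `Ω`. -/
structure IsMapOn {m n : ℕ} (Φ : EuclideanSpace ℝ (Fin m) → EuclideanSpace ℝ (Fin n))
    (U : Set (EuclideanSpace ℝ (Fin m))) (Ω : Set (EuclideanSpace ℝ (Fin n))) : Prop where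
  isOpen : IsOpen U
  smooth : ∀ a, ContDiffOn ℝ ∞ (fun z => Φ z a) U
  mapsTo : Set.MapsTo Φ U Ω

/-- The components of `W` are smooth on `U`. -/
def IsFieldOn {m n : ℕ} (W : EuclideanSpace ℝ (Fin m) → Fin n → ℝ)
    (U : Set (EuclideanSpace ℝ (Fin m))) : Prop :=
  ∀ a, ContDiffOn ℝ ∞ (fun y => W y a) U

/-- The connection matrix of the pull-back connection. -/
def conn {m n : ℕ} (H : EuclideanSpace ℝ (Fin n) → Matrix (Fin n) (Fin n) ℝ)
    (Φ : EuclideanSpace ℝ (Fin m) → EuclideanSpace ℝ (Fin n)) (i : Fin m)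
    (a c : Fin n) (y : EuclideanSpace ℝ (Fin m)) : ℝ :=
  ∑ b, christoffel H a b c (Φ y) * pd i (fun z => Φ z b) y

/-- The components of `R(u, v)w`. -/
def curv {n : ℕ} (H : EuclideanSpace ℝ (Fin n) → Matrix (Fin n) (Fin n) ℝ)
    (z : EuclideanSpace ℝ (Fin n)) (u v w : Fin n → ℝ) (a : Fin n) : ℝ :=
  ∑ b, ∑ c, ∑ d, riemann H a b c d z * u b * v c * w d

section Connection

variable {m n l : ℕ} {U : Set (EuclideanSpace ℝ (Fin m))} {Ω : Set (EuclideanSpace ℝ (Fin n))}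
  {H : EuclideanSpace ℝ (Fin n) → Matrix (Fin n) (Fin n) ℝ}
  {Φ : EuclideanSpace ℝ (Fin m) → EuclideanSpace ℝ (Fin n)}
  {W Z : EuclideanSpace ℝ (Fin m) → Fin n → ℝ} {y : EuclideanSpace ℝ (Fin m)}

theorem IsFieldOn.diff (hW : IsFieldOn W U) (hU : IsOpen U) (hy : y ∈ U) (a : Fin n) :
    DifferentiableAt ℝ (fun y => W y a) y :=
  (hW a).differentiableAt_of_isOpen hU hy

theorem IsMapOn.differentiableAt (hΦ : IsMapOn Φ U Ω) (hy : y ∈ U) : DifferentiableAt ℝ Φ y :=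
  differentiableAt_of_components hΦ.isOpen hΦ.smooth hy

theorem IsMapOn.comp_smooth (hΦ : IsMapOn Φ U Ω) {g : EuclideanSpace ℝ (Fin n) → ℝ}
    (hg : ContDiffOn ℝ ∞ g Ω) : ContDiffOn ℝ ∞ (fun z => g (Φ z)) U :=
  comp_contDiffOn hg hΦ.smooth hΦ.mapsTo

theorem IsMapOn.dmap_field (hΦ : IsMapOn Φ U Ω) (j : Fin m) : IsFieldOn (dmap Φ j) U :=
  fun a => pd_contDiffOn hΦ.isOpen (hΦ.smooth a) j

theorem IsMapOn.pd_comp (hΦ : IsMapOn Φ U Ω) (hΩ : IsOpen Ω) {g : EuclideanSpace ℝ (Fin n) → ℝ}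
    (hg : ContDiffOn ℝ ∞ g Ω) (hy : y ∈ U) (i : Fin m) :
    pd i (fun z => g (Φ z)) y = ∑ a, pd a g (Φ y) * pd i (fun z => Φ z a) y :=
  HopfCyl.pd_comp (hg.differentiableAt_of_isOpen hΩ (hΦ.mapsTo hy)) (hΦ.differentiableAt hy) i

/-- Isolating the connection matrix presents the covariant derivative as a partial derivative plus a
linear term, the form used in all later expansions. -/
theorem nabla_eq (i : Fin m) (a : Fin n) :
    nabla H Φ i W y a = pd i (fun z => W z a) y + ∑ c, conn H Φ i a c y * W y c := by
  simp only [nabla, conn, Finset.sum_mul]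
  rw [Finset.sum_comm]

theorem conn_contDiffOn (hH : IsMetricOn H Ω) (hΦ : IsMapOn Φ U Ω) (i : Fin m) (a c : Fin n) :
    ContDiffOn ℝ ∞ (conn H Φ i a c) U :=
  ContDiffOn.sum fun b _ => (hΦ.comp_smooth (hH.christoffel_contDiffOn a b c)).mul
    (pd_contDiffOn hΦ.isOpen (hΦ.smooth b) i)

theorem IsFieldOn.nabla (hW : IsFieldOn W U) (hH : IsMetricOn H Ω) (hΦ : IsMapOn Φ U Ω)
    (i : Fin m) : IsFieldOn (nabla H Φ i W) U := by
  intro a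
  simp only [nabla_eq]
  exact (pd_contDiffOn hΦ.isOpen (hW a) i).add
    (ContDiffOn.sum fun c _ => (conn_contDiffOn hH hΦ i a c).mul (hW c))

theorem IsFieldOn.add (hW : IsFieldOn W U) (hZ : IsFieldOn Z U) :
    IsFieldOn (fun y => W y + Z y) U := fun a => (hW a).add (hZ a)

theorem IsFieldOn.smul (hW : IsFieldOn W U) {u : EuclideanSpace ℝ (Fin m) → ℝ}
    (hu : ContDiffOn ℝ ∞ u U) : IsFieldOn (fun y => u y • W y) U := fun a => hu.mul (hW a)

theorem ip_contDiffOn (hH : IsMetricOn H Ω) (hΦ : IsMapOn Φ U Ω) (hW : IsFieldOn W U)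
    (hZ : IsFieldOn Z U) : ContDiffOn ℝ ∞ (fun z => ip (H (Φ z)) (W z) (Z z)) U :=
  ContDiffOn.sum fun a _ => ContDiffOn.sum fun b _ =>
    ((hΦ.comp_smooth (hH.smooth a b)).mul (hW a)).mul (hZ b)

theorem nabla_congr (hU : IsOpen U) (h : ∀ y ∈ U, W y = Z y) (hy : y ∈ U) (i : Fin m) :
    nabla H Φ i W y = nabla H Φ i Z y := by
  ext a
  rw [nabla_eq, nabla_eq, pd_congr hU (fun z hz => congrFun (h z hz) a) hy, h y hy]

theorem nabla_add (hU : IsOpen U) (hW : IsFieldOn W U) (hZ : IsFieldOn Z U) (hy : y ∈ U)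
    (i : Fin m) : nabla H Φ i (fun y => W y + Z y) y = nabla H Φ i W y + nabla H Φ i Z y := by
  ext a
  simp only [nabla_eq, Pi.add_apply, mul_add, Finset.sum_add_distrib]
  rw [pd_add (hW.diff hU hy a) (hZ.diff hU hy a)]
  ring

theorem nabla_smul (hU : IsOpen U) (hW : IsFieldOn W U) {u : EuclideanSpace ℝ (Fin m) → ℝ}
    (hu : ContDiffOn ℝ ∞ u U) (hy : y ∈ U) (i : Fin m) :
    nabla H Φ i (fun y => u y • W y) y = pd i u y • W y + u y • nabla H Φ i W y := by
  ext a
  simp only [nabla_eq, Pi.add_apply, Pi.smul_apply, smul_eq_mul, mul_add, Finset.mul_sum]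
  rw [pd_mul (hu.differentiableAt_of_isOpen hU hy) (hW.diff hU hy a)]
  have : ∀ c, conn H Φ i a c y * (u y * W y c) = u y * (conn H Φ i a c y * W y c) := fun c => by
    ring
  simp only [this]
  ring

theorem conn_lower (hH : IsMetricOn H Ω) (hΦ : IsMapOn Φ U Ω) (hy : y ∈ U) (i : Fin m)
    (a c : Fin n) : ∑ k, H (Φ y) a k * conn H Φ i k c y =
      ∑ b, lowChristoffel H a b c (Φ y) * pd i (fun z => Φ z b) y := by
  simp only [conn, Finset.mul_sum]
  rw [Finset.sum_comm]
  refine Finset.sum_congr rfl fun b _ => ?_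
  rw [← lowChristoffel_eq (hH.det _ (hΦ.mapsTo hy)), Finset.sum_mul]
  exact Finset.sum_congr rfl fun _ _ => by ring

theorem pd_metric_comp (hH : IsMetricOn H Ω) (hΦ : IsMapOn Φ U Ω) (hy : y ∈ U) (i : Fin m)
    (a b : Fin n) : pd i (fun z => H (Φ z) a b) y =
      ∑ k, H (Φ y) a k * conn H Φ i k b y + ∑ k, H (Φ y) b k * conn H Φ i k a y := by
  rw [conn_lower hH hΦ hy, conn_lower hH hΦ hy, hΦ.pd_comp hH.isOpen (hH.smooth a b) hy,
    ← Finset.sum_add_distrib]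
  refine Finset.sum_congr rfl fun c _ => ?_
  rw [hH.pd_eq (hΦ.mapsTo hy), add_mul]

/-- The pull-back connection is metric. -/
theorem pd_ip (hH : IsMetricOn H Ω) (hΦ : IsMapOn Φ U Ω) (hW : IsFieldOn W U)
    (hZ : IsFieldOn Z U) (hy : y ∈ U) (i : Fin m) :
    pd i (fun z => ip (H (Φ z)) (W z) (Z z)) y =
      ip (H (Φ y)) (nabla H Φ i W y) (Z y) + ip (H (Φ y)) (W y) (nabla H Φ i Z y) := by
  have hU := hΦ.isOpen
  have hsm := fun a b => hΦ.comp_smooth (hH.smooth a b)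
  have hd : ∀ {u : EuclideanSpace ℝ (Fin m) → ℝ}, ContDiffOn ℝ ∞ u U → DifferentiableAt ℝ u y :=
    fun h => h.differentiableAt_of_isOpen hU hy
  have h1 : pd i (fun z => ip (H (Φ z)) (W z) (Z z)) y = ∑ a, ∑ b,
      ((∑ k, H (Φ y) a k * conn H Φ i k b y + ∑ k, H (Φ y) b k * conn H Φ i k a y)
          * W y a * Z y b
        + H (Φ y) a b * pd i (fun z => W z a) y * Z y b
        + H (Φ y) a b * W y a * pd i (fun z => Z z b) y) := by
    simp only [ip]
    rw [pd_sum fun a _ => hd (ContDiffOn.sum fun b _ => ((hsm a b).mul (hW a)).mul (hZ b))]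
    refine Finset.sum_congr rfl fun a _ => ?_
    rw [pd_sum fun b _ => hd (((hsm a b).mul (hW a)).mul (hZ b))]
    refine Finset.sum_congr rfl fun b _ => ?_
    rw [pd_mul (hd ((hsm a b).mul (hW a))) (hd (hZ b)), pd_mul (hd (hsm a b)) (hd (hW a)),
      pd_metric_comp hH hΦ hy]
    ring
  have hs := hH.symm _ (hΦ.mapsTo hy)
  have h2 : ip (H (Φ y)) (nabla H Φ i W y) (Z y) = ∑ a, ∑ b,
      (H (Φ y) a b * pd i (fun z => W z a) y * Z y b
        + (∑ k, H (Φ y) b k * conn H Φ i k a y) * W y a * Z y b) := by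
    simp only [ip, nabla_eq, mul_add, add_mul, Finset.sum_add_distrib, Finset.mul_sum,
      Finset.sum_mul]
    congr 1
    rw [Finset.sum_comm_cycle]
    refine Finset.sum_congr rfl fun a _ => ?_
    rw [Finset.sum_comm]
    refine Finset.sum_congr rfl fun b _ => Finset.sum_congr rfl fun c _ => ?_
    rw [hs b c]; ring
  have h3 : ip (H (Φ y)) (W y) (nabla H Φ i Z y) = ∑ a, ∑ b,
      (H (Φ y) a b * W y a * pd i (fun z => Z z b) y
        + (∑ k, H (Φ y) a k * conn H Φ i k b y) * W y a * Z y b) := by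
    simp only [ip, nabla_eq, mul_add, Finset.sum_add_distrib, Finset.mul_sum,
      Finset.sum_mul]
    congr 1
    refine Finset.sum_congr rfl fun a _ => ?_
    rw [Finset.sum_comm]
    exact Finset.sum_congr rfl fun b _ => Finset.sum_congr rfl fun c _ => by ring
  rw [h1, h2, h3, ← Finset.sum_add_distrib]
  refine Finset.sum_congr rfl fun a _ => ?_
  rw [← Finset.sum_add_distrib]
  exact Finset.sum_congr rfl fun b _ => by ring

/-- The Levi-Civita connection is torsion-free. -/
theorem nabla_dmap_comm (hH : IsMetricOn H Ω) (hΦ : IsMapOn Φ U Ω) (hy : y ∈ U) (i j : Fin m) :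
    nabla H Φ i (dmap Φ j) y = nabla H Φ j (dmap Φ i) y := by
  ext a
  unfold nabla
  congr 1
  · exact pd_comm hΦ.isOpen (hΦ.smooth a) hy i j
  · rw [Finset.sum_comm]
    refine Finset.sum_congr rfl fun b _ => Finset.sum_congr rfl fun c _ => ?_
    rw [hH.christoffel_comm (hΦ.mapsTo hy)]
    simp only [dmap]; ring

/-- The terms containing second derivatives of Φ are kept apart: they are symmetric in `i` and `j`
and drop out of the curvature. -/
theorem pd_conn (hH : IsMetricOn H Ω) (hΦ : IsMapOn Φ U Ω) (hy : y ∈ U) (i j : Fin m)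
    (a d : Fin n) : pd i (conn H Φ j a d) y =
      ∑ c, christoffel H a c d (Φ y) * pd i (pd j (fun z => Φ z c)) y
      + ∑ b, ∑ c, pd b (christoffel H a c d) (Φ y) * dmap Φ i y b * dmap Φ j y c := by
  have hU := hΦ.isOpen
  have h1 := fun c => hΦ.comp_smooth (hH.christoffel_contDiffOn a c d)
  have h2 := fun c => pd_contDiffOn hU (hΦ.smooth c) j
  have hd : ∀ {u : EuclideanSpace ℝ (Fin m) → ℝ}, ContDiffOn ℝ ∞ u U → DifferentiableAt ℝ u y :=
    fun h => h.differentiableAt_of_isOpen hU hy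
  have : pd i (conn H Φ j a d) y = pd i (fun y => ∑ b, christoffel H a b d (Φ y) *
    pd j (fun z => Φ z b) y) y := rfl
  rw [this, pd_sum fun c _ => hd ((h1 c).mul (h2 c)), Finset.sum_comm, ← Finset.sum_add_distrib]
  refine Finset.sum_congr rfl fun c _ => ?_
  rw [pd_mul (hd (h1 c)) (hd (h2 c)),
    hΦ.pd_comp hH.isOpen (hH.christoffel_contDiffOn a c d) hy, Finset.sum_mul]
  rfl

/-- The curvature of the connection matrices. -/
theorem conn_curv (hH : IsMetricOn H Ω) (hΦ : IsMapOn Φ U Ω) (hy : y ∈ U) (i j : Fin m)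
    (a d : Fin n) :
    pd i (conn H Φ j a d) y - pd j (conn H Φ i a d) y
      + ∑ q, (conn H Φ i a q y * conn H Φ j q d y - conn H Φ j a q y * conn H Φ i q d y) =
    ∑ b, ∑ c, riemann H a b c d (Φ y) * dmap Φ i y b * dmap Φ j y c := by
  -- Second derivatives of Φ cancel by symmetry; what is left are the derivatives and products of
  -- Christoffel symbols that make up `riemann`, contracted with dΦ(∂ᵢ) and dΦ(∂ⱼ).
  have e1 : ∑ c, christoffel H a c d (Φ y) * pd i (pd j (fun z => Φ z c)) y =
      ∑ c, christoffel H a c d (Φ y) * pd j (pd i (fun z => Φ z c)) y :=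
    Finset.sum_congr rfl fun c _ => by rw [pd_comm hΦ.isOpen (hΦ.smooth c) hy i j]
  have e2 : ∀ i j : Fin m, ∑ q, conn H Φ i a q y * conn H Φ j q d y = ∑ b, ∑ c,
      (∑ q, christoffel H a b q (Φ y) * christoffel H q c d (Φ y))
        * dmap Φ i y b * dmap Φ j y c := by
    intro i j
    simp only [conn, Finset.sum_mul_sum]
    simp only [Finset.sum_mul]
    rw [← Finset.sum_comm_cycle]
    refine Finset.sum_congr rfl fun b _ => Finset.sum_congr rfl fun c _ =>
      Finset.sum_congr rfl fun q _ => ?_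
    simp only [dmap]; ring
  have e3 : ∑ b, ∑ c, pd b (christoffel H a c d) (Φ y) * dmap Φ j y b * dmap Φ i y c =
      ∑ b, ∑ c, pd c (christoffel H a b d) (Φ y) * dmap Φ i y b * dmap Φ j y c := by
    rw [Finset.sum_comm]
    exact Finset.sum_congr rfl fun b _ => Finset.sum_congr rfl fun c _ => by ring
  have e4 : ∑ b, ∑ c, (∑ q, christoffel H a b q (Φ y) * christoffel H q c d (Φ y))
        * dmap Φ j y b * dmap Φ i y c = ∑ b, ∑ c,
      (∑ q, christoffel H a c q (Φ y) * christoffel H q b d (Φ y))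
        * dmap Φ i y b * dmap Φ j y c := by
    rw [Finset.sum_comm]
    exact Finset.sum_congr rfl fun b _ => Finset.sum_congr rfl fun c _ => by ring
  rw [pd_conn hH hΦ hy, pd_conn hH hΦ hy, Finset.sum_sub_distrib, e1, e2, e2, e3, e4]
  simp only [riemann, add_mul, sub_mul, Finset.sum_add_distrib, Finset.sum_sub_distrib]
  ring

/-- Arranged by the order of differentiation of `W`: the second- and first-order parts are symmetric
in `i` and `j`, so the commutator involves only `W` itself. -/
theorem nabla_nabla (hH : IsMetricOn H Ω) (hΦ : IsMapOn Φ U Ω) (hW : IsFieldOn W U) (hy : y ∈ U)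
    (i j : Fin m) (a : Fin n) : nabla H Φ i (nabla H Φ j W) y a =
      pd i (pd j (fun z => W z a)) y
      + ∑ c, (conn H Φ j a c y * pd i (fun z => W z c) y
        + conn H Φ i a c y * pd j (fun z => W z c) y)
      + ∑ d, (pd i (conn H Φ j a d) y
        + ∑ q, conn H Φ i a q y * conn H Φ j q d y) * W y d := by
  have hU := hΦ.isOpen
  have h1 := fun c => conn_contDiffOn hH hΦ j a c
  have hd : ∀ {u : EuclideanSpace ℝ (Fin m) → ℝ}, ContDiffOn ℝ ∞ u U → DifferentiableAt ℝ u y :=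
    fun h => h.differentiableAt_of_isOpen hU hy
  rw [nabla_eq]
  simp only [nabla_eq]
  rw [pd_add (hd (pd_contDiffOn hU (hW a) j))
      (hd (ContDiffOn.sum fun c _ => (h1 c).mul (hW c))),
    pd_sum fun c _ => hd ((h1 c).mul (hW c))]
  have e : ∑ c, pd i (fun z => conn H Φ j a c z * W z c) y =
      ∑ c, (conn H Φ j a c y * pd i (fun z => W z c) y + pd i (conn H Φ j a c) y * W y c) :=
    Finset.sum_congr rfl fun c _ => pd_mul (hd (h1 c)) (hd (hW c))
  have e2 : ∑ c, conn H Φ i a c y * ∑ d, conn H Φ j c d y * W y d =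
      ∑ d, (∑ q, conn H Φ i a q y * conn H Φ j q d y) * W y d := by
    simp only [Finset.mul_sum, Finset.sum_mul]
    rw [Finset.sum_comm]
    exact Finset.sum_congr rfl fun b _ => Finset.sum_congr rfl fun c _ => by ring
  rw [e]
  simp only [mul_add, add_mul, Finset.sum_add_distrib]
  rw [e2]
  ring

/-- The Ricci identity. -/
theorem nabla_nabla_sub (hH : IsMetricOn H Ω) (hΦ : IsMapOn Φ U Ω) (hW : IsFieldOn W U)
    (hy : y ∈ U) (i j : Fin m) :
    nabla H Φ i (nabla H Φ j W) y - nabla H Φ j (nabla H Φ i W) y =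
      curv H (Φ y) (dmap Φ i y) (dmap Φ j y) (W y) := by
  ext a
  have e : curv H (Φ y) (dmap Φ i y) (dmap Φ j y) (W y) a =
      ∑ d, (pd i (conn H Φ j a d) y - pd j (conn H Φ i a d) y
      + ∑ q, (conn H Φ i a q y * conn H Φ j q d y - conn H Φ j a q y * conn H Φ i q d y))
      * W y d := by
    simp only [conn_curv hH hΦ hy, curv, Finset.sum_mul]
    rw [Finset.sum_comm_cycle]
  rw [e, Pi.sub_apply, nabla_nabla hH hΦ hW hy, nabla_nabla hH hΦ hW hy,
    pd_comm hΦ.isOpen (hW a) hy i j]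
  simp only [add_mul, sub_mul, Finset.sum_add_distrib, Finset.sum_sub_distrib]
  ring

/-- The Christoffel symbols of a pull-back of a metric. -/
theorem lowChristoffel_pullback (hH : IsMetricOn H Ω) (hΦ : IsMapOn Φ U Ω)
    {G : EuclideanSpace ℝ (Fin m) → Matrix (Fin m) (Fin m) ℝ}
    (hG : ∀ y ∈ U, ∀ i j, G y i j = ip (H (Φ y)) (dmap Φ i y) (dmap Φ j y)) (hy : y ∈ U)
    (l i j : Fin m) :
    lowChristoffel G l i j y = ip (H (Φ y)) (nabla H Φ i (dmap Φ j) y) (dmap Φ l y) := by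
  -- This is the Koszul formula for coordinate fields. Only first-kind symbols of `G` occur, so `G`
  -- may be degenerate, which is needed for the pull-back of the base metric under a submersion.
  have h : ∀ k i j, pd k (fun z => G z i j) y =
      ip (H (Φ y)) (nabla H Φ k (dmap Φ i) y) (dmap Φ j y)
        + ip (H (Φ y)) (dmap Φ i y) (nabla H Φ k (dmap Φ j) y) := fun k i j => by
    rw [pd_congr hΦ.isOpen (fun z hz => hG z hz i j) hy,
      pd_ip hH hΦ (hΦ.dmap_field i) (hΦ.dmap_field j) hy]
  have hs := ip_comm (hH.symm _ (hΦ.mapsTo hy))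
  rw [lowChristoffel, h, h, h, nabla_dmap_comm hH hΦ hy j i, nabla_dmap_comm hH hΦ hy l i,
    nabla_dmap_comm hH hΦ hy l j, hs (dmap Φ j y), hs (dmap Φ i y)]
  ring

end Connection

end HopfCyl

end

noncomputable section

namespace HopfCyl

/-! ### Naturality of the pull-back connection under composition of maps -/

section Composite

variable {m n l : ℕ} {U : Set (EuclideanSpace ℝ (Fin m))} {Ω : Set (EuclideanSpace ℝ (Fin n))}
  {Ω' : Set (EuclideanSpace ℝ (Fin l))}
  {H : EuclideanSpace ℝ (Fin n) → Matrix (Fin n) (Fin n) ℝ}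
  {K : EuclideanSpace ℝ (Fin l) → Matrix (Fin l) (Fin l) ℝ}
  {Φ : EuclideanSpace ℝ (Fin m) → EuclideanSpace ℝ (Fin n)}
  {ψ : EuclideanSpace ℝ (Fin n) → EuclideanSpace ℝ (Fin l)}
  {W Z : EuclideanSpace ℝ (Fin m) → Fin n → ℝ} {y : EuclideanSpace ℝ (Fin m)}

theorem IsMapOn.comp (hψ : IsMapOn ψ Ω Ω') (hΦ : IsMapOn Φ U Ω) :
    IsMapOn (fun z => ψ (Φ z)) U Ω' :=
  ⟨hΦ.isOpen, fun a => hΦ.comp_smooth (hψ.smooth a), fun _ hz => hψ.mapsTo (hΦ.mapsTo hz)⟩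

/-- The image under `dψ` of a vector field along `Φ`. -/
def pushAlong (ψ : EuclideanSpace ℝ (Fin n) → EuclideanSpace ℝ (Fin l))
    (Φ : EuclideanSpace ℝ (Fin m) → EuclideanSpace ℝ (Fin n))
    (W : EuclideanSpace ℝ (Fin m) → Fin n → ℝ) (y : EuclideanSpace ℝ (Fin m)) : Fin l → ℝ :=
  ∑ b, W y b • dmap ψ b (Φ y)

theorem pushAlong_field (hψ : IsMapOn ψ Ω Ω') (hΦ : IsMapOn Φ U Ω) (hW : IsFieldOn W U) :
    IsFieldOn (pushAlong ψ Φ W) U := by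
  intro a
  simp only [pushAlong, Finset.sum_apply, Pi.smul_apply, smul_eq_mul]
  exact ContDiffOn.sum fun b _ => (hW b).mul (hΦ.comp_smooth (hψ.dmap_field b a))

theorem dmap_comp (hψ : IsMapOn ψ Ω Ω') (hΦ : IsMapOn Φ U Ω) (hy : y ∈ U) (i : Fin m) :
    dmap (fun z => ψ (Φ z)) i y = pushAlong ψ Φ (dmap Φ i) y := by
  ext a
  simp only [pushAlong, Finset.sum_apply, Pi.smul_apply, smul_eq_mul]
  unfold dmap
  rw [hΦ.pd_comp hψ.isOpen (hψ.smooth a) hy]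
  exact Finset.sum_congr rfl fun _ _ => mul_comm _ _

/-- The covariant derivative of `dψ(W)`. -/
theorem nabla_pushAlong (hψ : IsMapOn ψ Ω Ω') (hΦ : IsMapOn Φ U Ω)
    (hW : IsFieldOn W U) (hy : y ∈ U) (i : Fin m) :
    nabla K (fun z => ψ (Φ z)) i (pushAlong ψ Φ W) y =
      ∑ b, pd i (fun z => W z b) y • dmap ψ b (Φ y)
        + ∑ c, ∑ b, (dmap Φ i y c * W y b) • nabla K ψ c (dmap ψ b) (Φ y) := by
  have hU := hΦ.isOpen
  have hd : ∀ {u : EuclideanSpace ℝ (Fin m) → ℝ}, ContDiffOn ℝ ∞ u U → DifferentiableAt ℝ u y :=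
    fun h => h.differentiableAt_of_isOpen hU hy
  ext a
  have h2 := fun b => hΦ.comp_smooth (hψ.dmap_field b a)
  have e1 : pd i (fun z => pushAlong ψ Φ W z a) y = ∑ b, pd i (fun z => W z b) y * dmap ψ b (Φ y) a
      + ∑ c, ∑ b, dmap Φ i y c * W y b * pd c (fun z => dmap ψ b z a) (Φ y) := by
    simp only [pushAlong, Finset.sum_apply, Pi.smul_apply, smul_eq_mul]
    rw [pd_sum fun b _ => hd ((hW b).mul (h2 b)), Finset.sum_comm, ← Finset.sum_add_distrib]
    refine Finset.sum_congr rfl fun b _ => ?_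
    rw [pd_mul (hd (hW b)) (hd (h2 b)), hΦ.pd_comp hψ.isOpen (hψ.dmap_field b a) hy, add_comm,
      Finset.mul_sum]
    congr 1
    exact Finset.sum_congr rfl fun c _ => by simp only [dmap]; ring
  have e2 : ∀ d, conn K (fun z => ψ (Φ z)) i a d y =
      ∑ c, dmap Φ i y c * conn K ψ c a d (Φ y) := by
    intro d
    have h3 : ∀ b, pd i (fun z => ψ (Φ z) b) y = ∑ c, dmap ψ c (Φ y) b * dmap Φ i y c :=
      fun b => hΦ.pd_comp hψ.isOpen (hψ.smooth b) hy i
    simp only [conn, h3, Finset.mul_sum]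
    rw [Finset.sum_comm]
    exact Finset.sum_congr rfl fun c _ => Finset.sum_congr rfl fun b _ => by
      simp only [dmap]; ring
  rw [nabla_eq, e1]
  simp only [e2, Pi.add_apply, Finset.sum_apply, Pi.smul_apply, smul_eq_mul, nabla_eq, mul_add,
    Finset.sum_add_distrib, pushAlong]
  rw [add_assoc]
  congr 2
  simp only [Finset.mul_sum, Finset.sum_mul]
  rw [Finset.sum_comm_cycle, Finset.sum_comm_cycle]
  rw [Finset.sum_comm]
  exact Finset.sum_congr rfl fun b _ => Finset.sum_congr rfl fun c _ =>
    Finset.sum_congr rfl fun d _ => by ring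

/-- Pairing of the covariant derivative of `dψ(W)` with `dψ(∂_l)`, in terms of the pulled-back
metric. -/
theorem ip_nabla_pushAlong (hK : IsMetricOn K Ω') (hψ : IsMapOn ψ Ω Ω') (hΦ : IsMapOn Φ U Ω)
    {G : EuclideanSpace ℝ (Fin n) → Matrix (Fin n) (Fin n) ℝ}
    (hG : ∀ z ∈ Ω, ∀ i j, G z i j = ip (K (ψ z)) (dmap ψ i z) (dmap ψ j z))
    (hW : IsFieldOn W U) (hy : y ∈ U) (i : Fin m) (q : Fin n) :
    ip (K (ψ (Φ y))) (nabla K (fun z => ψ (Φ z)) i (pushAlong ψ Φ W) y) (dmap ψ q (Φ y)) =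
      ∑ b, G (Φ y) b q * pd i (fun z => W z b) y
        + ∑ c, ∑ b, lowChristoffel G q c b (Φ y) * dmap Φ i y c * W y b := by
  have hz := hΦ.mapsTo hy
  -- The Hessian terms ∇dψ, paired with dψ, are the first-kind symbols of the pulled-back form; no
  -- inverse of `G` is required.
  rw [nabla_pushAlong hψ hΦ hW hy, ip_add_left, ip_sum_left, ip_sum_left]
  congr 1
  · exact Finset.sum_congr rfl fun b _ => by rw [ip_smul_left, hG _ hz, mul_comm]
  · refine Finset.sum_congr rfl fun c _ => ?_
    rw [ip_sum_left]
    refine Finset.sum_congr rfl fun b _ => ?_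
    rw [ip_smul_left, lowChristoffel_pullback hK hψ hG hz]
    ring

/-- Naturality of the covariant derivative under isometries. -/
theorem nabla_isometry (hK : IsMetricOn K Ω') (hH : IsMetricOn H Ω) (hψ : IsMapOn ψ Ω Ω')
    (hΦ : IsMapOn Φ U Ω)
    (hG : ∀ z ∈ Ω, ∀ i j, H z i j = ip (K (ψ z)) (dmap ψ i z) (dmap ψ j z))
    (hW : IsFieldOn W U) (hy : y ∈ U) (hsurj : ∀ t, ∃ c : Fin n → ℝ, t = ∑ q, c q • dmap ψ q (Φ y))
    (i : Fin m) :
    nabla K (fun z => ψ (Φ z)) i (pushAlong ψ Φ W) y = pushAlong ψ Φ (nabla H Φ i W) y := by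
  have hz := hΦ.mapsTo hy
  -- Since `K` is nondegenerate and the vectors dψ(∂_q) span by `hsurj`, the two sides may be
  -- compared through their pairings with these vectors.
  rw [← sub_eq_zero]
  refine eq_zero_of_ip_right (hK.det _ (hψ.mapsTo hz)) fun t => ?_
  obtain ⟨c, rfl⟩ := hsurj t
  rw [ip_sum_left]
  refine Finset.sum_eq_zero fun q _ => ?_
  rw [ip_smul_left, ip_comm (hK.symm _ (hψ.mapsTo hz)), ip_sub_left,
    ip_nabla_pushAlong hK hψ hΦ hG hW hy]
  have e : ip (K (ψ (Φ y))) (pushAlong ψ Φ (nabla H Φ i W) y) (dmap ψ q (Φ y)) =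
      ∑ b, H (Φ y) b q * nabla H Φ i W y b := by
    rw [pushAlong, ip_sum_left]
    exact Finset.sum_congr rfl fun b _ => by rw [ip_smul_left, hG _ hz, mul_comm]
  have e2 : ∑ b, H (Φ y) b q * ∑ d, conn H Φ i b d y * W y d =
      ∑ c, ∑ b, lowChristoffel H q c b (Φ y) * dmap Φ i y c * W y b := by
    have : ∀ d, ∑ b, H (Φ y) b q * conn H Φ i b d y =
        ∑ c, lowChristoffel H q c d (Φ y) * dmap Φ i y c := by
      intro d
      refine Eq.trans ?_ (conn_lower hH hΦ hy i q d)
      exact Finset.sum_congr rfl fun b _ => by rw [hH.symm _ hz]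
    rw [Finset.sum_comm]
    simp only [← Finset.sum_mul, ← this]
    simp only [Finset.mul_sum, Finset.sum_mul]
    rw [Finset.sum_comm]
    exact Finset.sum_congr rfl fun c _ => Finset.sum_congr rfl fun d _ => by ring
  rw [e]
  simp only [nabla_eq, mul_add, Finset.sum_add_distrib]
  rw [e2, sub_self, mul_zero]

/-- The covariant derivative under a change of variables in the source. -/
theorem nabla_comp_source {Φ : EuclideanSpace ℝ (Fin n) → EuclideanSpace ℝ (Fin l)}
    {θ : EuclideanSpace ℝ (Fin m) → EuclideanSpace ℝ (Fin n)}
    {W : EuclideanSpace ℝ (Fin n) → Fin l → ℝ} (hΦ : IsMapOn Φ Ω Ω') (hθ : IsMapOn θ U Ω)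
    (hW : IsFieldOn W Ω) (hy : y ∈ U) (i : Fin m) :
    nabla K (fun z => Φ (θ z)) i (fun z => W (θ z)) y =
      ∑ j, dmap θ i y j • nabla K Φ j W (θ y) := by
  ext a
  have e1 : ∀ b, pd i (fun z => Φ (θ z) b) y = ∑ j, pd j (fun z => Φ z b) (θ y) * dmap θ i y j :=
    fun b => hθ.pd_comp hΦ.isOpen (hΦ.smooth b) hy i
  have e2 : pd i (fun z => W (θ z) a) y = ∑ j, pd j (fun z => W z a) (θ y) * dmap θ i y j :=
    hθ.pd_comp hΦ.isOpen (hW a) hy i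
  have e3 : ∀ d, conn K (fun z => Φ (θ z)) i a d y = ∑ j, conn K Φ j a d (θ y) * dmap θ i y j := by
    intro d
    simp only [conn, e1, Finset.mul_sum, Finset.sum_mul]
    rw [Finset.sum_comm]
    exact Finset.sum_congr rfl fun c _ => Finset.sum_congr rfl fun b _ => by ring
  rw [nabla_eq, e2]
  simp only [e3, Finset.sum_apply, Pi.smul_apply, smul_eq_mul, nabla_eq, mul_add,
    Finset.sum_add_distrib, Finset.sum_mul, Finset.mul_sum]
  congr 1
  · exact Finset.sum_congr rfl fun c _ => mul_comm _ _
  · rw [Finset.sum_comm]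
    exact Finset.sum_congr rfl fun c _ => Finset.sum_congr rfl fun b _ => by ring

end Composite

/-! ### Symmetries of the curvature -/

section Curvature

variable {n : ℕ} {Ω : Set (EuclideanSpace ℝ (Fin n))}
  {H : EuclideanSpace ℝ (Fin n) → Matrix (Fin n) (Fin n) ℝ} {z : EuclideanSpace ℝ (Fin n)}

theorem curv_sum_smul_left {ι : Type*} (s : Finset ι) (c : ι → ℝ) (u : ι → Fin n → ℝ)
    (v w : Fin n → ℝ) : curv H z (∑ k ∈ s, c k • u k) v w = ∑ k ∈ s, c k • curv H z (u k) v w := by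
  ext a
  have h : ∀ u : Fin n → ℝ, curv H z u v w a =
      ∑ b, u b * ∑ c, ∑ d, riemann H a b c d z * v c * w d := fun u => by
    simp only [curv, Finset.mul_sum]
    exact Finset.sum_congr rfl fun b _ => Finset.sum_congr rfl fun c _ =>
      Finset.sum_congr rfl fun d _ => by ring
  simp only [Finset.sum_apply, Pi.smul_apply, smul_eq_mul, h]
  simp only [Finset.sum_mul]
  rw [Finset.sum_comm]
  refine Finset.sum_congr rfl fun i _ => ?_
  rw [Finset.mul_sum]
  exact Finset.sum_congr rfl fun b _ => mul_assoc _ _ _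

theorem curv_antisymm (u v w : Fin n → ℝ) : curv H z u v w = -curv H z v u w := by
  ext a
  simp only [curv, Pi.neg_apply]
  rw [Finset.sum_comm, ← Finset.sum_neg_distrib]
  refine Finset.sum_congr rfl fun b _ => ?_
  rw [← Finset.sum_neg_distrib]
  refine Finset.sum_congr rfl fun c _ => ?_
  rw [← Finset.sum_neg_distrib]
  refine Finset.sum_congr rfl fun d _ => ?_
  have : riemann H a c b d z = -riemann H a b c d z := by
    simp only [riemann, Finset.sum_sub_distrib]; ring
  rw [this]; ring

theorem curv_sum_smul_middle {ι : Type*} (s : Finset ι) (c : ι → ℝ) (v : ι → Fin n → ℝ)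
    (u w : Fin n → ℝ) : curv H z u (∑ k ∈ s, c k • v k) w = ∑ k ∈ s, c k • curv H z u (v k) w := by
  rw [curv_antisymm, curv_sum_smul_left, ← Finset.sum_neg_distrib]
  exact Finset.sum_congr rfl fun k _ => by rw [curv_antisymm _ u, smul_neg, neg_neg]

theorem curv_smul_middle (c : ℝ) (u v w : Fin n → ℝ) :
    curv H z u (c • v) w = c • curv H z u v w := by
  simpa using curv_sum_smul_middle (H := H) (z := z) {()} (fun _ => c) (fun _ => v) u w

theorem IsMetricOn.isMapOn_id (hH : IsMetricOn H Ω) : IsMapOn (fun z => z) Ω Ω :=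
  ⟨hH.isOpen, fun a => (contDiffOn_euclidean.1 contDiffOn_id) a, fun _ h => h⟩

theorem dmap_id (i : Fin n) (z : EuclideanSpace ℝ (Fin n)) :
    dmap (fun z : EuclideanSpace ℝ (Fin n) => z) i z = Pi.single i 1 := by
  ext a
  have : HasFDerivAt (fun z : EuclideanSpace ℝ (Fin n) => z a)
      (EuclideanSpace.proj a : EuclideanSpace ℝ (Fin n) →L[ℝ] ℝ) z :=
    (EuclideanSpace.proj a : EuclideanSpace ℝ (Fin n) →L[ℝ] ℝ).hasFDerivAt
  simp [dmap, pd, this.fderiv, Pi.single_apply]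

theorem sum_smul_single (u : Fin n → ℝ) : u = ∑ i, u i • (Pi.single i 1 : Fin n → ℝ) := by
  ext a
  simp [Finset.sum_apply, Pi.single_apply]

/-- Extend `w` and `t` by constant components. Second partial derivatives of ⟨w,t⟩ commute; in the
expansion by metric compatibility the mixed terms cancel, and the Ricci identity turns the rest into
the claim for coordinate directions. -/
theorem ip_curv_skew (hH : IsMetricOn H Ω) (hz : z ∈ Ω) (u v w t : Fin n → ℝ) :
    ip (H z) (curv H z u v w) t = -ip (H z) w (curv H z u v t) := by
  have key : ∀ i j : Fin n, ip (H z) (curv H z (Pi.single i 1) (Pi.single j 1) w) t =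
      -ip (H z) w (curv H z (Pi.single i 1) (Pi.single j 1) t) := by
    intro i j
    have hi := hH.isMapOn_id
    have hc : ∀ w : Fin n → ℝ, IsFieldOn (fun _ : EuclideanSpace ℝ (Fin n) => w) Ω :=
      fun w a => contDiffOn_const
    have hsm := ip_contDiffOn hH hi (hc w) (hc t)
    have h2 : ∀ i j : Fin n, pd i (pd j (fun z => ip (H z) w t)) z =
        (ip (H z) (nabla H (fun z => z) i (nabla H (fun z => z) j fun _ => w) z) t
          + ip (H z) (nabla H (fun z => z) j (fun _ => w) z) (nabla H (fun z => z) i (fun _ => t) z))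
        + (ip (H z) (nabla H (fun z => z) i (fun _ => w) z) (nabla H (fun z => z) j (fun _ => t) z)
          + ip (H z) w (nabla H (fun z => z) i (nabla H (fun z => z) j fun _ => t) z)) := by
      intro i j
      rw [pd_congr hH.isOpen (fun y hy => pd_ip hH hi (hc w) (hc t) hy j) hz,
        pd_add ((ip_contDiffOn hH hi ((hc w).nabla hH hi j)
          (hc t)).differentiableAt_of_isOpen hH.isOpen hz)
          ((ip_contDiffOn hH hi (hc w) ((hc t).nabla hH hi j)).differentiableAt_of_isOpen
            hH.isOpen hz),
        pd_ip hH hi ((hc w).nabla hH hi j) (hc t) hz,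
        pd_ip hH hi (hc w) ((hc t).nabla hH hi j) hz]
    have h3 := pd_comm hH.isOpen hsm hz i j
    rw [h2, h2] at h3
    have h4 := nabla_nabla_sub hH hi (hc w) hz i j
    have h5 := nabla_nabla_sub hH hi (hc t) hz i j
    rw [dmap_id, dmap_id] at h4 h5
    rw [← h4, ← h5, ip_sub_left, ip_sub_right]
    linarith
  rw [sum_smul_single u, curv_sum_smul_left, curv_sum_smul_left, ip_sum_left, ip_sum_right,
    ← Finset.sum_neg_distrib]
  refine Finset.sum_congr rfl fun i _ => ?_
  rw [ip_smul_left, ip_smul_right, sum_smul_single v, curv_sum_smul_middle, curv_sum_smul_middle,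
    ip_sum_left, ip_sum_right, ← mul_neg, ← Finset.sum_neg_distrib]
  congr 1
  refine Finset.sum_congr rfl fun j _ => ?_
  rw [ip_smul_left, ip_smul_right, key, mul_neg]

/-- The cyclic sum cancels termwise because the Christoffel symbols, and hence their derivatives,
are symmetric in the lower indices. -/
theorem riemann_bianchi (hH : IsMetricOn H Ω) (hz : z ∈ Ω) (l i j k : Fin n) :
    riemann H l i j k z + riemann H l j k i z + riemann H l k i j z = 0 := by
  have hp : ∀ p a b c, pd p (christoffel H a b c) z = pd p (christoffel H a c b) z :=
    fun p a b c => pd_congr hH.isOpen (fun y hy => hH.christoffel_comm hy a b c) hz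
  simp only [riemann, Finset.sum_sub_distrib]
  rw [hp i l k j, hp j l k i, hp k l j i]
  have hc : ∀ a b c, christoffel H a b c z = christoffel H a c b z := hH.christoffel_comm hz
  simp only [hc _ k j, hc _ k i, hc _ j i]
  ring

theorem curv_bianchi (hH : IsMetricOn H Ω) (hz : z ∈ Ω) (u v w : Fin n → ℝ) :
    curv H z u v w + curv H z v w u + curv H z w u v = 0 := by
  ext a
  have e1 : curv H z v w u a = ∑ b, ∑ c, ∑ d, riemann H a c d b z * u b * v c * w d := by
    rw [curv, Finset.sum_comm_cycle]
    exact Finset.sum_congr rfl fun b _ => Finset.sum_congr rfl fun c _ =>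
      Finset.sum_congr rfl fun d _ => by ring
  have e2 : curv H z w u v a = ∑ b, ∑ c, ∑ d, riemann H a d b c z * u b * v c * w d := by
    rw [curv, ← Finset.sum_comm_cycle]
    exact Finset.sum_congr rfl fun b _ => Finset.sum_congr rfl fun c _ =>
      Finset.sum_congr rfl fun d _ => by ring
  simp only [Pi.add_apply, Pi.zero_apply, e1, e2]
  simp only [curv, ← Finset.sum_add_distrib]
  refine Finset.sum_eq_zero fun b _ => Finset.sum_eq_zero fun c _ => Finset.sum_eq_zero fun d _ => ?_
  linear_combination (u b * v c * w d) * riemann_bianchi hH hz a b c d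

/-- The classical algebraic argument: four instances of the first Bianchi identity, one for each
choice of the slot left fixed, combined with the two skew symmetries. -/
theorem ip_curv_pair (hH : IsMetricOn H Ω) (hz : z ∈ Ω) (u v w t : Fin n → ℝ) :
    ip (H z) (curv H z u v w) t = ip (H z) (curv H z w t u) v := by
  have hs := ip_comm (hH.symm z hz)
  have sk : ∀ u v w t, ip (H z) (curv H z u v w) t = -ip (H z) (curv H z u v t) w :=
    fun u v w t => by rw [ip_curv_skew hH hz, hs]
  have as : ∀ u v w t, ip (H z) (curv H z u v w) t = -ip (H z) (curv H z v u w) t :=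
    fun u v w t => by rw [curv_antisymm, ip_neg_left]
  have bi : ∀ u v w t, ip (H z) (curv H z u v w) t + ip (H z) (curv H z v w u) t
      + ip (H z) (curv H z w u v) t = 0 := fun u v w t => by
    rw [← ip_add_left, ← ip_add_left, curv_bianchi hH hz, ip_zero_left]
  have b1 := bi u v w t
  have b2 := bi v w t u
  have b3 := bi w t u v
  have b4 := bi t u v w
  have s1 := sk v w u t
  have s2 := sk w u v t
  have s3 := sk w t v u
  have s4 := sk t u w v
  have s5 := sk u v t w
  have s6 := sk t v w u
  have a1 := as w u t v
  have a2 := as t v u w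
  have a3 := as u t v w
  have a4 := as w t u v
  have s7 := sk v t u w
  have s8 := sk u w v t
  have s9 := as u w t v
  have s10 := as t v w u
  have s11 := as u w v t
  linarith

/-- The Ricci curvature as a trace over an orthonormal basis. -/
theorem ricciCoord_eq_sum {e : Fin n → Fin n → ℝ}
    (he : ∀ i j, ip (H z) (e i) (e j) = if i = j then 1 else 0) (v w : Fin n → ℝ) :
    ∑ j, ∑ k, ricciCoord H j k z * v j * w k = ∑ i, ip (H z) (curv H z (e i) v w) (e i) := by
  have h := inv_eq_of_orthonormal he
  -- The sum of e_i ⊗ e_i is the inverse of the metric, so summing over the orthonormal basis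
  -- contracts the upper index with the first lower one.
  have h2 : ∀ b c, ∑ a, H z b a * ∑ i, e i a * e i c = if b = c then 1 else 0 := fun b c => by
    simpa [Matrix.mul_apply, Matrix.one_apply] using congrFun (congrFun h b) c
  have e1 : ∀ i, ip (H z) (curv H z (e i) v w) (e i) =
      ∑ b, ∑ c, (∑ a, H z b a * (e i a * e i c)) * curv H z (Pi.single c 1) v w b := by
    intro i
    conv_lhs => rw [sum_smul_single (e i), curv_sum_smul_left, ← sum_smul_single]
    simp only [ip, Finset.sum_apply, Pi.smul_apply, smul_eq_mul, Finset.mul_sum, Finset.sum_mul]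
    refine Finset.sum_congr rfl fun b _ => ?_
    rw [Finset.sum_comm]
    exact Finset.sum_congr rfl fun c _ => Finset.sum_congr rfl fun a _ => by ring
  have e2 : ∑ i, ip (H z) (curv H z (e i) v w) (e i) =
      ∑ b, ∑ c, (∑ a, H z b a * ∑ i, e i a * e i c) * curv H z (Pi.single c 1) v w b := by
    simp only [e1, Finset.mul_sum, Finset.sum_mul]
    rw [Finset.sum_comm]
    refine Finset.sum_congr rfl fun b _ => ?_
    rw [Finset.sum_comm]
    refine Finset.sum_congr rfl fun c _ => ?_
    rw [Finset.sum_comm]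
  rw [e2]
  simp only [h2, ite_mul, one_mul, zero_mul, Finset.sum_ite_eq, Finset.mem_univ, if_true]
  simp only [ricciCoord, Finset.sum_mul, curv, Pi.single_apply, mul_ite, mul_one, mul_zero,
    ite_mul, zero_mul, Finset.sum_ite_irrel, Finset.sum_const_zero, Finset.sum_ite_eq',
    Finset.mem_univ, if_true]
  rw [Finset.sum_comm_cycle]

end Curvature

end HopfCyl

end

noncomputable section

namespace HopfCyl

/-! ### Directional derivatives -/

/-- The derivative of the function `u` along the vector field `x`. -/
def dd {m : ℕ} (x : EuclideanSpace ℝ (Fin m) → Fin m → ℝ) (u : EuclideanSpace ℝ (Fin m) → ℝ)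
    (y : EuclideanSpace ℝ (Fin m)) : ℝ :=
  ∑ i, x y i * pd i u y

/-- The covariant derivative along the vector field `x` of a vector field along `Φ`. -/
def covD {m n : ℕ} (H : EuclideanSpace ℝ (Fin n) → Matrix (Fin n) (Fin n) ℝ)
    (Φ : EuclideanSpace ℝ (Fin m) → EuclideanSpace ℝ (Fin n))
    (x : EuclideanSpace ℝ (Fin m) → Fin m → ℝ) (W : EuclideanSpace ℝ (Fin m) → Fin n → ℝ)
    (y : EuclideanSpace ℝ (Fin m)) : Fin n → ℝ :=
  ∑ i, x y i • nabla H Φ i W y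

/-- The image `dΦ(x)` of the vector field `x`. -/
def push {m n : ℕ} (Φ : EuclideanSpace ℝ (Fin m) → EuclideanSpace ℝ (Fin n))
    (x : EuclideanSpace ℝ (Fin m) → Fin m → ℝ) (y : EuclideanSpace ℝ (Fin m)) : Fin n → ℝ :=
  ∑ i, x y i • dmap Φ i y

/-- The Lie bracket. -/
def brk {m : ℕ} (x w : EuclideanSpace ℝ (Fin m) → Fin m → ℝ) (y : EuclideanSpace ℝ (Fin m))
    (i : Fin m) : ℝ :=
  dd x (fun z => w z i) y - dd w (fun z => x z i) y

section Directional

variable {m n : ℕ} {U : Set (EuclideanSpace ℝ (Fin m))} {Ω : Set (EuclideanSpace ℝ (Fin n))}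
  {H : EuclideanSpace ℝ (Fin n) → Matrix (Fin n) (Fin n) ℝ}
  {Φ : EuclideanSpace ℝ (Fin m) → EuclideanSpace ℝ (Fin n)}
  {W Z : EuclideanSpace ℝ (Fin m) → Fin n → ℝ} {y : EuclideanSpace ℝ (Fin m)}
  {x w : EuclideanSpace ℝ (Fin m) → Fin m → ℝ} {u v : EuclideanSpace ℝ (Fin m) → ℝ}

theorem dd_contDiffOn (hU : IsOpen U) (hx : IsFieldOn x U) (hu : ContDiffOn ℝ ∞ u U) :
    ContDiffOn ℝ ∞ (dd x u) U :=
  ContDiffOn.sum fun i _ => (hx i).mul (pd_contDiffOn hU hu i)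

theorem dd_congr (hU : IsOpen U) (h : ∀ y ∈ U, u y = v y) (hy : y ∈ U) : dd x u y = dd x v y :=
  Finset.sum_congr rfl fun _ _ => by rw [pd_congr hU h hy]

theorem dd_const (c : ℝ) (y : EuclideanSpace ℝ (Fin m)) : dd x (fun _ => c) y = 0 := by
  simp [dd, pd_const]

theorem dd_eq_zero (hU : IsOpen U) {c : ℝ} (h : ∀ y ∈ U, u y = c) (hy : y ∈ U) :
    dd x u y = 0 := by
  rw [dd_congr hU h hy, dd_const]

theorem dd_add (hu : DifferentiableAt ℝ u y) (hv : DifferentiableAt ℝ v y) :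
    dd x (fun z => u z + v z) y = dd x u y + dd x v y := by
  simp only [dd, pd_add hu hv, mul_add, Finset.sum_add_distrib]

theorem dd_sub (hu : DifferentiableAt ℝ u y) (hv : DifferentiableAt ℝ v y) :
    dd x (fun z => u z - v z) y = dd x u y - dd x v y := by
  simp only [dd, pd_sub hu hv, mul_sub, Finset.sum_sub_distrib]

theorem dd_mul (hu : DifferentiableAt ℝ u y) (hv : DifferentiableAt ℝ v y) :
    dd x (fun z => u z * v z) y = u y * dd x v y + dd x u y * v y := by
  simp only [dd, pd_mul hu hv, Finset.mul_sum, Finset.sum_mul, ← Finset.sum_add_distrib]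
  exact Finset.sum_congr rfl fun _ _ => by ring

theorem covD_field (hH : IsMetricOn H Ω) (hΦ : IsMapOn Φ U Ω) (hx : IsFieldOn x U)
    (hW : IsFieldOn W U) : IsFieldOn (covD H Φ x W) U := by
  intro a
  simp only [covD, Finset.sum_apply, Pi.smul_apply, smul_eq_mul]
  exact ContDiffOn.sum fun i _ => (hx i).mul (hW.nabla hH hΦ i a)

theorem push_field (hΦ : IsMapOn Φ U Ω) (hx : IsFieldOn x U) : IsFieldOn (push Φ x) U := by
  intro a
  simp only [push, Finset.sum_apply, Pi.smul_apply, smul_eq_mul]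
  exact ContDiffOn.sum fun i _ => (hx i).mul (hΦ.dmap_field i a)

theorem covD_congr (hU : IsOpen U) (h : ∀ y ∈ U, W y = Z y) (hy : y ∈ U) :
    covD H Φ x W y = covD H Φ x Z y :=
  Finset.sum_congr rfl fun _ _ => by rw [nabla_congr hU h hy]

theorem covD_add (hU : IsOpen U) (hW : IsFieldOn W U) (hZ : IsFieldOn Z U) (hy : y ∈ U) :
    covD H Φ x (fun y => W y + Z y) y = covD H Φ x W y + covD H Φ x Z y := by
  simp only [covD, nabla_add hU hW hZ hy, smul_add, Finset.sum_add_distrib]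

theorem covD_smul (hU : IsOpen U) (hW : IsFieldOn W U) (hu : ContDiffOn ℝ ∞ u U) (hy : y ∈ U) :
    covD H Φ x (fun y => u y • W y) y = dd x u y • W y + u y • covD H Φ x W y := by
  simp only [covD, nabla_smul hU hW hu hy, smul_add, Finset.sum_add_distrib, dd, Finset.sum_smul,
    Finset.smul_sum, mul_smul]
  congr 1
  exact Finset.sum_congr rfl fun _ _ => smul_comm _ _ _

theorem covD_zero : covD H Φ x (fun _ => 0) y = 0 := by
  refine Finset.sum_eq_zero fun i _ => ?_
  ext a
  simp [nabla, pd_const]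

theorem dd_ip (hH : IsMetricOn H Ω) (hΦ : IsMapOn Φ U Ω) (hW : IsFieldOn W U)
    (hZ : IsFieldOn Z U) (hy : y ∈ U) :
    dd x (fun z => ip (H (Φ z)) (W z) (Z z)) y =
      ip (H (Φ y)) (covD H Φ x W y) (Z y) + ip (H (Φ y)) (W y) (covD H Φ x Z y) := by
  simp only [dd, pd_ip hH hΦ hW hZ hy, covD, ip_sum_left, ip_sum_right, ip_smul_left,
    ip_smul_right, mul_add, Finset.sum_add_distrib]

/-- The Leibniz rule for a one-form `B` evaluated on `w`. With B_j = dΦ(∂_j) it computes ∇_x dΦ(w),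
with B_j = ∇_j W it computes ∇_x ∇_w W; torsion, curvature and the trace formula all rest on it. -/
theorem covD_sum_smul {B : Fin m → EuclideanSpace ℝ (Fin m) → Fin n → ℝ} (hU : IsOpen U)
    (hw : IsFieldOn w U) (hB : ∀ j, IsFieldOn (B j) U) (hy : y ∈ U) :
    covD H Φ x (fun y => ∑ j, w y j • B j y) y =
      ∑ j, dd x (fun z => w z j) y • B j y
        + ∑ i, ∑ j, (x y i * w y j) • nabla H Φ i (B j) y := by
  have hn : ∀ i, nabla H Φ i (fun y => ∑ j, w y j • B j y) y =
      ∑ j, (pd i (fun z => w z j) y • B j y + w y j • nabla H Φ i (B j) y) := by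
    intro i
    -- Smoothness of the partial sums is carried through the induction because additivity of `nabla`
    -- requires it.
    have key : ∀ s : Finset (Fin m), IsFieldOn (fun y => ∑ j ∈ s, w y j • B j y) U ∧
        nabla H Φ i (fun y => ∑ j ∈ s, w y j • B j y) y =
        ∑ j ∈ s, (pd i (fun z => w z j) y • B j y + w y j • nabla H Φ i (B j) y) := by
      intro s
      induction s using Finset.induction_on with
      | empty =>
        refine ⟨fun a => ?_, ?_⟩
        · simpa using contDiffOn_const
        · ext a
          simp [nabla, pd_const]
      | insert j s hj ih =>
        simp only [Finset.sum_insert hj]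
        refine ⟨((hB j).smul (hw j)).add ih.1, ?_⟩
        rw [nabla_add hU ((hB j).smul (hw j)) ih.1 hy, ih.2, nabla_smul hU (hB j) (hw j) hy]
    exact (key Finset.univ).2
  simp only [covD, hn, Finset.sum_add_distrib, smul_add, Finset.smul_sum, dd, Finset.sum_smul,
    mul_smul]
  congr 1
  rw [Finset.sum_comm]

/-- The double sums cancel by the symmetry of ∇dΦ, leaving the derivatives of the coefficients,
which form the bracket. -/
theorem covD_push_sub (hH : IsMetricOn H Ω) (hΦ : IsMapOn Φ U Ω) (hx : IsFieldOn x U)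
    (hw : IsFieldOn w U) (hy : y ∈ U) :
    covD H Φ x (push Φ w) y - covD H Φ w (push Φ x) y = push Φ (brk x w) y := by
  have h := fun j => hΦ.dmap_field j
  have h1 : covD H Φ x (push Φ w) y = _ := covD_sum_smul (H := H) hΦ.isOpen hw h hy
  have h2 : covD H Φ w (push Φ x) y = _ := covD_sum_smul (H := H) hΦ.isOpen hx h hy
  have h3 : ∑ i, ∑ j, (w y i * x y j) • nabla H Φ i (dmap Φ j) y =
      ∑ i, ∑ j, (x y i * w y j) • nabla H Φ i (dmap Φ j) y := by
    rw [Finset.sum_comm]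
    exact Finset.sum_congr rfl fun i _ => Finset.sum_congr rfl fun j _ => by
      rw [nabla_dmap_comm hH hΦ hy, mul_comm]
  rw [h1, h2, h3]
  simp only [push, brk, sub_smul, Finset.sum_sub_distrib]
  abel

/-- Derivatives of the coefficients assemble into the bracket term; the double sums differ by the
Ricci identity for coordinate fields, contracted with `x` and `w`. -/
theorem covD_covD_sub (hH : IsMetricOn H Ω) (hΦ : IsMapOn Φ U Ω) (hx : IsFieldOn x U)
    (hw : IsFieldOn w U) (hW : IsFieldOn W U) (hy : y ∈ U) :
    covD H Φ x (covD H Φ w W) y - covD H Φ w (covD H Φ x W) y =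
      curv H (Φ y) (push Φ x y) (push Φ w y) (W y) + covD H Φ (brk x w) W y := by
  have h := fun j => hW.nabla hH hΦ j
  have h1 : covD H Φ x (covD H Φ w W) y = _ := covD_sum_smul (H := H) hΦ.isOpen hw h hy
  have h2 : covD H Φ w (covD H Φ x W) y = _ := covD_sum_smul (H := H) hΦ.isOpen hx h hy
  have h3 : ∑ i, ∑ j, (x y i * w y j) • nabla H Φ i (nabla H Φ j W) y
      - ∑ i, ∑ j, (w y i * x y j) • nabla H Φ i (nabla H Φ j W) y =
      curv H (Φ y) (push Φ x y) (push Φ w y) (W y) := by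
    rw [Finset.sum_comm (f := fun i j => (w y i * x y j) • nabla H Φ i (nabla H Φ j W) y),
      ← Finset.sum_sub_distrib, push, push, curv_sum_smul_left]
    refine Finset.sum_congr rfl fun i _ => ?_
    rw [← Finset.sum_sub_distrib, curv_sum_smul_middle, Finset.smul_sum]
    refine Finset.sum_congr rfl fun j _ => ?_
    rw [← nabla_nabla_sub hH hΦ hW hy]
    module
  rw [h1, h2, ← h3]
  simp only [covD, brk, sub_smul, Finset.sum_sub_distrib]
  abel

theorem dd_comm (hU : IsOpen U) (hx : IsFieldOn x U) (hw : IsFieldOn w U)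
    (hu : ContDiffOn ℝ ∞ u U) (hy : y ∈ U) :
    dd x (dd w u) y - dd w (dd x u) y = dd (brk x w) u y := by
  have hd : ∀ {u : EuclideanSpace ℝ (Fin m) → ℝ}, ContDiffOn ℝ ∞ u U → DifferentiableAt ℝ u y :=
    fun h => h.differentiableAt_of_isOpen hU hy
  have key : ∀ {x w : EuclideanSpace ℝ (Fin m) → Fin m → ℝ}, IsFieldOn w U →
      dd x (dd w u) y = ∑ j, dd x (fun z => w z j) y * pd j u y
        + ∑ i, ∑ j, x y i * w y j * pd i (pd j u) y := by
    intro x w hw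
    have : ∀ i, pd i (dd w u) y = ∑ j, (pd i (fun z => w z j) y * pd j u y
        + w y j * pd i (pd j u) y) := by
      intro i
      have h0 : pd i (dd w u) y = pd i (fun z => ∑ j, w z j * pd j u z) y := rfl
      rw [h0, pd_sum fun j _ => hd ((hw j).mul (pd_contDiffOn hU hu j))]
      refine Finset.sum_congr rfl fun j _ => ?_
      rw [pd_mul (hd (hw j)) (hd (pd_contDiffOn hU hu j)), add_comm]
    rw [dd]
    simp only [this, mul_add, Finset.sum_add_distrib, Finset.mul_sum, dd, Finset.sum_mul]
    congr 1
    · rw [Finset.sum_comm]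
      exact Finset.sum_congr rfl fun _ _ => Finset.sum_congr rfl fun _ _ => by ring
    · exact Finset.sum_congr rfl fun _ _ => Finset.sum_congr rfl fun _ _ => by ring
  have h3 : ∑ i, ∑ j, w y i * x y j * pd i (pd j u) y =
      ∑ i, ∑ j, x y i * w y j * pd i (pd j u) y := by
    rw [Finset.sum_comm]
    exact Finset.sum_congr rfl fun i _ => Finset.sum_congr rfl fun j _ => by
      rw [pd_comm hU hu hy]; ring
  rw [key hw, key hx, h3]
  conv_rhs => rw [dd]
  simp only [brk, sub_mul, Finset.sum_sub_distrib]
  ring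

theorem dd_comp (hΦ : IsMapOn Φ U Ω) (hΩ : IsOpen Ω) {g : EuclideanSpace ℝ (Fin n) → ℝ}
    (hg : ContDiffOn ℝ ∞ g Ω) (hy : y ∈ U) :
    dd x (fun z => g (Φ z)) y = ∑ a, push Φ x y a * pd a g (Φ y) := by
  simp only [dd, hΦ.pd_comp hΩ hg hy, push, Finset.sum_apply, Pi.smul_apply, smul_eq_mul,
    Finset.mul_sum, Finset.sum_mul]
  rw [Finset.sum_comm]
  exact Finset.sum_congr rfl fun i _ => Finset.sum_congr rfl fun j _ => by
    simp only [dmap]; ring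

theorem curv_sum_smul_right {z : EuclideanSpace ℝ (Fin n)} {ι : Type*} (s : Finset ι) (c : ι → ℝ)
    (w : ι → Fin n → ℝ) (u v : Fin n → ℝ) :
    curv H z u v (∑ k ∈ s, c k • w k) = ∑ k ∈ s, c k • curv H z u v (w k) := by
  ext a
  have h : ∀ w : Fin n → ℝ, curv H z u v w a =
      ∑ d, w d * ∑ b, ∑ c, riemann H a b c d z * u b * v c := fun w => by
    simp only [curv, Finset.mul_sum]
    rw [Finset.sum_comm_cycle]
    exact Finset.sum_congr rfl fun b _ => Finset.sum_congr rfl fun c _ =>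
      Finset.sum_congr rfl fun d _ => by ring
  simp only [Finset.sum_apply, Pi.smul_apply, smul_eq_mul, h]
  simp only [Finset.sum_mul]
  rw [Finset.sum_comm]
  refine Finset.sum_congr rfl fun i _ => ?_
  rw [Finset.mul_sum]
  exact Finset.sum_congr rfl fun b _ => mul_assoc _ _ _

end Directional

end HopfCyl

end

noncomputable section

namespace HopfCyl

/-! ### Adapted frames in coordinates -/

/-- `x`, `v` are the coordinate expressions of commuting orthonormal tangent fields and `ξ` that of
a unit normal field along `Φ`; the integral curves of `v` are geodesics. -/
structure IsFrameOn (H : EuclideanSpace ℝ (Fin 3) → Matrix (Fin 3) (Fin 3) ℝ)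
    (Φ : EuclideanSpace ℝ (Fin 2) → EuclideanSpace ℝ (Fin 3))
    (x v : EuclideanSpace ℝ (Fin 2) → Fin 2 → ℝ) (ξ : EuclideanSpace ℝ (Fin 2) → Fin 3 → ℝ)
    (U : Set (EuclideanSpace ℝ (Fin 2))) (Ω : Set (EuclideanSpace ℝ (Fin 3))) : Prop where
  metric : IsMetricOn H Ω
  map : IsMapOn Φ U Ω
  fx : IsFieldOn x U
  fv : IsFieldOn v U
  fξ : IsFieldOn ξ U
  xx : ∀ y ∈ U, ip (H (Φ y)) (push Φ x y) (push Φ x y) = 1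
  vv : ∀ y ∈ U, ip (H (Φ y)) (push Φ v y) (push Φ v y) = 1
  ξξ : ∀ y ∈ U, ip (H (Φ y)) (ξ y) (ξ y) = 1
  xv : ∀ y ∈ U, ip (H (Φ y)) (push Φ x y) (push Φ v y) = 0
  ξx : ∀ y ∈ U, ip (H (Φ y)) (ξ y) (push Φ x y) = 0
  ξv : ∀ y ∈ U, ip (H (Φ y)) (ξ y) (push Φ v y) = 0
  brk : ∀ y ∈ U, brk x v y = 0
  geod : ∀ y ∈ U, covD H Φ v (push Φ v) y = 0

/-- `⟨∇_x x, ξ⟩`. -/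
def curvatureFn (H : EuclideanSpace ℝ (Fin 3) → Matrix (Fin 3) (Fin 3) ℝ)
    (Φ : EuclideanSpace ℝ (Fin 2) → EuclideanSpace ℝ (Fin 3))
    (x : EuclideanSpace ℝ (Fin 2) → Fin 2 → ℝ) (ξ : EuclideanSpace ℝ (Fin 2) → Fin 3 → ℝ)
    (y : EuclideanSpace ℝ (Fin 2)) : ℝ :=
  ip (H (Φ y)) (covD H Φ x (push Φ x) y) (ξ y)

/-- `⟨∇_x ξ, v⟩`. -/
def torsionFn (H : EuclideanSpace ℝ (Fin 3) → Matrix (Fin 3) (Fin 3) ℝ)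
    (Φ : EuclideanSpace ℝ (Fin 2) → EuclideanSpace ℝ (Fin 3))
    (x v : EuclideanSpace ℝ (Fin 2) → Fin 2 → ℝ) (ξ : EuclideanSpace ℝ (Fin 2) → Fin 3 → ℝ)
    (y : EuclideanSpace ℝ (Fin 2)) : ℝ :=
  ip (H (Φ y)) (covD H Φ x ξ y) (push Φ v y)

namespace IsFrameOn

variable {H : EuclideanSpace ℝ (Fin 3) → Matrix (Fin 3) (Fin 3) ℝ}
    {Φ : EuclideanSpace ℝ (Fin 2) → EuclideanSpace ℝ (Fin 3)}
    {x v : EuclideanSpace ℝ (Fin 2) → Fin 2 → ℝ} {ξ : EuclideanSpace ℝ (Fin 2) → Fin 3 → ℝ}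
    {U : Set (EuclideanSpace ℝ (Fin 2))} {Ω : Set (EuclideanSpace ℝ (Fin 3))}
    {y : EuclideanSpace ℝ (Fin 2)}

theorem orthonormal (F : IsFrameOn H Φ x v ξ U Ω) (hy : y ∈ U) (i j : Fin 3) :
    ip (H (Φ y)) (![push Φ x y, push Φ v y, ξ y] i) (![push Φ x y, push Φ v y, ξ y] j) =
      if i = j then 1 else 0 := by
  have hs := ip_comm (F.metric.symm _ (F.map.mapsTo hy))
  fin_cases i <;> fin_cases j <;>
    simp [F.xx y hy, F.vv y hy, F.ξξ y hy, F.xv y hy, F.ξx y hy, F.ξv y hy,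
      hs (push Φ v y) (push Φ x y), hs (push Φ x y) (ξ y), hs (push Φ v y) (ξ y)]

theorem expand (F : IsFrameOn H Φ x v ξ U Ω) (hy : y ∈ U) (w : Fin 3 → ℝ) :
    w = ip (H (Φ y)) w (push Φ x y) • push Φ x y + ip (H (Φ y)) w (push Φ v y) • push Φ v y
      + ip (H (Φ y)) w (ξ y) • ξ y := by
  have h := ip_expand_of_orthonormal (F.orthonormal hy) w
  have hs := ip_comm (F.metric.symm _ (F.map.mapsTo hy))
  rw [Fin.sum_univ_three] at h
  simpa [hs _ w] using h

theorem fX (F : IsFrameOn H Φ x v ξ U Ω) : IsFieldOn (push Φ x) U := push_field F.map F.fx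

theorem fV (F : IsFrameOn H Φ x v ξ U Ω) : IsFieldOn (push Φ v) U := push_field F.map F.fv

theorem curvatureFn_contDiffOn (F : IsFrameOn H Φ x v ξ U Ω) :
    ContDiffOn ℝ ∞ (curvatureFn H Φ x ξ) U :=
  ip_contDiffOn F.metric F.map (covD_field F.metric F.map F.fx F.fX) F.fξ

theorem torsionFn_contDiffOn (F : IsFrameOn H Φ x v ξ U Ω) :
    ContDiffOn ℝ ∞ (torsionFn H Φ x v ξ) U :=
  ip_contDiffOn F.metric F.map (covD_field F.metric F.map F.fx F.fξ) F.fV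

theorem covD_v_x (F : IsFrameOn H Φ x v ξ U Ω) (hy : y ∈ U) :
    covD H Φ v (push Φ x) y = covD H Φ x (push Φ v) y := by
  have h := covD_push_sub F.metric F.map F.fx F.fv hy
  have h0 : push Φ (HopfCyl.brk x v) y = 0 := by simp [push, F.brk y hy]
  rw [h0, sub_eq_zero] at h
  exact h.symm

/-- Differentiating a constant inner product: the connection coefficients of an orthonormal frame
are skew. With `covD_v_x` and `geod` this determines all of them in terms of κ and τ. -/
theorem ip_covD (F : IsFrameOn H Φ x v ξ U Ω) (hy : y ∈ U)
    {w : EuclideanSpace ℝ (Fin 2) → Fin 2 → ℝ} {W Z : EuclideanSpace ℝ (Fin 2) → Fin 3 → ℝ}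
    (hW : IsFieldOn W U) (hZ : IsFieldOn Z U) {c : ℝ}
    (h : ∀ y ∈ U, ip (H (Φ y)) (W y) (Z y) = c) :
    ip (H (Φ y)) (covD H Φ w W y) (Z y) = -ip (H (Φ y)) (covD H Φ w Z y) (W y) := by
  have h1 := dd_ip (x := w) F.metric F.map hW hZ hy
  rw [dd_eq_zero F.map.isOpen h hy, ip_comm (F.metric.symm _ (F.map.mapsTo hy)) (W y)] at h1
  linarith

theorem ip_covD_self (F : IsFrameOn H Φ x v ξ U Ω) (hy : y ∈ U)
    {w : EuclideanSpace ℝ (Fin 2) → Fin 2 → ℝ} {W : EuclideanSpace ℝ (Fin 2) → Fin 3 → ℝ}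
    (hW : IsFieldOn W U) {c : ℝ} (h : ∀ y ∈ U, ip (H (Φ y)) (W y) (W y) = c) :
    ip (H (Φ y)) (covD H Φ w W y) (W y) = 0 := by
  have h1 := F.ip_covD (w := w) hy hW hW h
  linarith

/-- There is no V-component: ⟨∇_X X,V⟩ = -⟨∇_X V,X⟩ = -⟨∇_V X,X⟩ = 0, since X and V commute and X
has unit length. -/
theorem covD_x_x (F : IsFrameOn H Φ x v ξ U Ω) (hy : y ∈ U) :
    covD H Φ x (push Φ x) y = curvatureFn H Φ x ξ y • ξ y := by
  have h2 : ip (H (Φ y)) (covD H Φ x (push Φ x) y) (push Φ v y) = 0 := by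
    rw [F.ip_covD hy F.fX F.fV F.xv, ← F.covD_v_x hy, F.ip_covD_self hy F.fX F.xx, neg_zero]
  rw [F.expand hy (covD H Φ x (push Φ x) y), F.ip_covD_self hy F.fX F.xx, h2]
  simp [curvatureFn]

/-- Both tangential components vanish: the V-component because V is unit, the X-component because
∇_X V = ∇_V X and X is unit. -/
theorem covD_x_v (F : IsFrameOn H Φ x v ξ U Ω) (hy : y ∈ U) :
    covD H Φ x (push Φ v) y = -torsionFn H Φ x v ξ y • ξ y := by
  have h1 : ip (H (Φ y)) (covD H Φ x (push Φ v) y) (push Φ x y) = 0 := by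
    rw [← F.covD_v_x hy, F.ip_covD_self hy F.fX F.xx]
  have h3 : ip (H (Φ y)) (covD H Φ x (push Φ v) y) (ξ y) = -torsionFn H Φ x v ξ y := by
    rw [torsionFn, F.ip_covD hy F.fξ F.fV F.ξv, neg_neg]
  rw [F.expand hy (covD H Φ x (push Φ v) y), F.ip_covD_self hy F.fV F.vv, h1, h3]
  simp

theorem covD_x_ξ (F : IsFrameOn H Φ x v ξ U Ω) (hy : y ∈ U) :
    covD H Φ x ξ y = -curvatureFn H Φ x ξ y • push Φ x y
      + torsionFn H Φ x v ξ y • push Φ v y := by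
  rw [F.expand hy (covD H Φ x ξ y), F.ip_covD_self hy F.fξ F.ξξ, F.ip_covD hy F.fξ F.fX F.ξx]
  simp [curvatureFn, torsionFn]

/-- The X-component is -⟨∇_V X,ξ⟩ = -⟨∇_X V,ξ⟩ = τ, and the V-component is -⟨∇_V V,ξ⟩ = 0. -/
theorem covD_v_ξ (F : IsFrameOn H Φ x v ξ U Ω) (hy : y ∈ U) :
    covD H Φ v ξ y = torsionFn H Φ x v ξ y • push Φ x y := by
  rw [F.expand hy (covD H Φ v ξ y), F.ip_covD_self hy F.fξ F.ξξ, F.ip_covD hy F.fξ F.fX F.ξx,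
    F.ip_covD hy F.fξ F.fV F.ξv, F.covD_v_x hy, F.geod y hy, F.covD_x_v hy, ip_smul_left,
    F.ξξ y hy, ip_zero_left]
  simp

/-- The Codazzi equations of the cylinder. As [X,V] = 0, the left side is ∇_X(τX) - ∇_V(-κX + τV);
expanded by the frame equations, its normal terms κτξ cancel. -/
theorem curv_x_v (F : IsFrameOn H Φ x v ξ U Ω) (hy : y ∈ U) :
    curv H (Φ y) (push Φ x y) (push Φ v y) (ξ y) =
      (dd x (torsionFn H Φ x v ξ) y + dd v (curvatureFn H Φ x ξ) y) • push Φ x y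
        - dd v (torsionFn H Φ x v ξ) y • push Φ v y := by
  have hU := F.map.isOpen
  have h := covD_covD_sub F.metric F.map F.fx F.fv F.fξ hy
  have h0 : covD H Φ (HopfCyl.brk x v) ξ y = 0 := by simp [covD, F.brk y hy]
  have hτ := F.torsionFn_contDiffOn
  have hκ := F.curvatureFn_contDiffOn
  rw [h0, add_zero, covD_congr hU (fun z hz => F.covD_v_ξ hz) hy,
    covD_congr hU (fun z hz => F.covD_x_ξ hz) hy, covD_smul hU F.fX hτ hy,
    covD_add hU (F.fX.smul hκ.neg) (F.fV.smul hτ) hy, covD_smul hU F.fX hκ.neg hy,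
    covD_smul hU F.fV hτ hy, F.covD_x_x hy, F.covD_v_x hy, F.covD_x_v hy, F.geod y hy] at h
  have hn : dd v (fun z => -curvatureFn H Φ x ξ z) y = -dd v (curvatureFn H Φ x ξ) y := by
    have h1 := dd_sub (x := v) (differentiableAt_const (0 : ℝ))
      (hκ.differentiableAt_of_isOpen hU hy)
    simpa [dd_const] using h1
  rw [← h, hn]
  module

theorem ricci_eq (F : IsFrameOn H Φ x v ξ U Ω) (hy : y ∈ U) (u w : Fin 3 → ℝ) :
    ∑ j, ∑ k, ricciCoord H j k (Φ y) * u j * w k =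
      ip (H (Φ y)) (curv H (Φ y) (push Φ x y) u w) (push Φ x y)
      + ip (H (Φ y)) (curv H (Φ y) (push Φ v y) u w) (push Φ v y)
      + ip (H (Φ y)) (curv H (Φ y) (ξ y) u w) (ξ y) := by
  rw [ricciCoord_eq_sum (F.orthonormal hy), Fin.sum_univ_three]
  simp

theorem curv_self {z : EuclideanSpace ℝ (Fin 3)} (u w : Fin 3 → ℝ) : curv H z u u w = 0 := by
  have h := curv_antisymm (H := H) (z := z) u u w
  exact self_eq_neg.1 h

theorem ip_curv_self (F : IsFrameOn H Φ x v ξ U Ω) (hy : y ∈ U) (u w t : Fin 3 → ℝ) :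
    ip (H (Φ y)) (curv H (Φ y) u w t) t = 0 := by
  have h := ip_curv_skew F.metric (F.map.mapsTo hy) u w t t
  rw [ip_comm (F.metric.symm _ (F.map.mapsTo hy)) t] at h
  linarith

/-- Of the three traced terms only ⟨R(X,ξ)V,X⟩ survives, and pair symmetry converts it into
⟨R(X,V)ξ,X⟩, known from `curv_x_v`. This identity and `ricci_ξ_x` trade the derivatives of τ for
Ricci curvature. -/
theorem ricci_ξ_v (F : IsFrameOn H Φ x v ξ U Ω) (hy : y ∈ U) :
    ∑ j, ∑ k, ricciCoord H j k (Φ y) * ξ y j * push Φ v y k =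
      dd x (torsionFn H Φ x v ξ) y + dd v (curvatureFn H Φ x ξ) y := by
  have hz := F.map.mapsTo hy
  rw [F.ricci_eq hy, F.ip_curv_self hy, curv_self, ip_zero_left, ip_curv_pair F.metric hz,
    curv_antisymm, ip_neg_left, ip_curv_skew F.metric hz, F.curv_x_v hy, ip_sub_right,
    ip_smul_right, ip_smul_right, F.xx y hy, F.xv y hy]
  ring

theorem ricci_ξ_x (F : IsFrameOn H Φ x v ξ U Ω) (hy : y ∈ U) :
    ∑ j, ∑ k, ricciCoord H j k (Φ y) * ξ y j * push Φ x y k = dd v (torsionFn H Φ x v ξ) y := by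
  have hz := F.map.mapsTo hy
  rw [F.ricci_eq hy, F.ip_curv_self hy, curv_self, ip_zero_left, ip_curv_pair F.metric hz,
    ip_curv_skew F.metric hz, F.curv_x_v hy, ip_sub_right,
    ip_smul_right, ip_smul_right, F.vv y hy, ip_comm (F.metric.symm _ hz), F.xv y hy]
  ring

/-- The trace of `R(·, ξ)·` over the tangent frame. -/
theorem ip_trace_curv (F : IsFrameOn H Φ x v ξ U Ω) (hy : y ∈ U) (w : Fin 3 → ℝ) :
    ip (H (Φ y)) (curv H (Φ y) (push Φ x y) (ξ y) (push Φ x y)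
      + curv H (Φ y) (push Φ v y) (ξ y) (push Φ v y)) w =
      -∑ j, ∑ k, ricciCoord H j k (Φ y) * ξ y j * w k := by
  have hz := F.map.mapsTo hy
  have hs := ip_comm (F.metric.symm _ hz)
  rw [F.ricci_eq hy, curv_self, ip_zero_left, ip_add_left, ip_curv_skew F.metric hz,
    ip_curv_skew F.metric hz, hs (push Φ x y), hs (push Φ v y)]
  ring

/-- The frame equations for a general combination of frame fields. Here and in `covD_v_comb` this
serves for the second derivative of uξ, whose first derivative is such a combination. -/
theorem covD_x_comb (F : IsFrameOn H Φ x v ξ U Ω) (hy : y ∈ U)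
    {a b c : EuclideanSpace ℝ (Fin 2) → ℝ} (ha : ContDiffOn ℝ ∞ a U) (hb : ContDiffOn ℝ ∞ b U)
    (hc : ContDiffOn ℝ ∞ c U) :
    covD H Φ x (fun z => a z • ξ z + (b z • push Φ x z + c z • push Φ v z)) y =
      (dd x a y + b y * curvatureFn H Φ x ξ y - c y * torsionFn H Φ x v ξ y) • ξ y
      + (dd x b y - a y * curvatureFn H Φ x ξ y) • push Φ x y
      + (dd x c y + a y * torsionFn H Φ x v ξ y) • push Φ v y := by
  have hU := F.map.isOpen
  rw [covD_add hU (F.fξ.smul ha) ((F.fX.smul hb).add (F.fV.smul hc)) hy,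
    covD_add hU (F.fX.smul hb) (F.fV.smul hc) hy, covD_smul hU F.fξ ha hy,
    covD_smul hU F.fX hb hy, covD_smul hU F.fV hc hy, F.covD_x_x hy, F.covD_x_v hy,
    F.covD_x_ξ hy]
  module

theorem covD_v_comb (F : IsFrameOn H Φ x v ξ U Ω) (hy : y ∈ U)
    {a b c : EuclideanSpace ℝ (Fin 2) → ℝ} (ha : ContDiffOn ℝ ∞ a U) (hb : ContDiffOn ℝ ∞ b U)
    (hc : ContDiffOn ℝ ∞ c U) :
    covD H Φ v (fun z => a z • ξ z + (b z • push Φ x z + c z • push Φ v z)) y =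
      (dd v a y - b y * torsionFn H Φ x v ξ y) • ξ y
      + (dd v b y + a y * torsionFn H Φ x v ξ y) • push Φ x y + dd v c y • push Φ v y := by
  have hU := F.map.isOpen
  rw [covD_add hU (F.fξ.smul ha) ((F.fX.smul hb).add (F.fV.smul hc)) hy,
    covD_add hU (F.fX.smul hb) (F.fV.smul hc) hy, covD_smul hU F.fξ ha hy,
    covD_smul hU F.fX hb hy, covD_smul hU F.fV hc hy, F.covD_v_x hy, F.covD_x_v hy,
    F.covD_v_ξ hy, F.geod y hy]
  module

end IsFrameOn

end HopfCyl

end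

noncomputable section

namespace HopfCyl

/-! ### The bitension field of a conformal immersion -/

section Conformal

variable {H : EuclideanSpace ℝ (Fin 3) → Matrix (Fin 3) (Fin 3) ℝ}
    {Φ : EuclideanSpace ℝ (Fin 2) → EuclideanSpace ℝ (Fin 3)}
    {x v : EuclideanSpace ℝ (Fin 2) → Fin 2 → ℝ} {ξ : EuclideanSpace ℝ (Fin 2) → Fin 3 → ℝ}
    {U : Set (EuclideanSpace ℝ (Fin 2))} {Ω : Set (EuclideanSpace ℝ (Fin 3))}
    {y : EuclideanSpace ℝ (Fin 2)}

/-- `G = f⁻¹ Φ*H` on `U`. -/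
structure IsConformalOn (G : EuclideanSpace ℝ (Fin 2) → Matrix (Fin 2) (Fin 2) ℝ)
    (H : EuclideanSpace ℝ (Fin 3) → Matrix (Fin 3) (Fin 3) ℝ)
    (Φ : EuclideanSpace ℝ (Fin 2) → EuclideanSpace ℝ (Fin 3)) (f : EuclideanSpace ℝ (Fin 2) → ℝ)
    (U : Set (EuclideanSpace ℝ (Fin 2))) : Prop where
  smooth : ContDiffOn ℝ ∞ f U
  pos : ∀ y ∈ U, 0 < f y
  eq : ∀ y ∈ U, ∀ i j, G y i j = (f y)⁻¹ * ip (H (Φ y)) (dmap Φ i y) (dmap Φ j y)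

variable {G : EuclideanSpace ℝ (Fin 2) → Matrix (Fin 2) (Fin 2) ℝ}
  {f : EuclideanSpace ℝ (Fin 2) → ℝ}

theorem IsConformalOn.ip_eq (C : IsConformalOn G H Φ f U) (hy : y ∈ U)
    (a b : EuclideanSpace ℝ (Fin 2) → Fin 2 → ℝ) :
    ip (G y) (a y) (b y) = (f y)⁻¹ * ip (H (Φ y)) (push Φ a y) (push Φ b y) := by
  simp only [push, ip_sum_left, ip_sum_right, ip_smul_left, ip_smul_right]
  simp only [ip, C.eq y hy, Finset.mul_sum, Finset.sum_mul]
  rw [Finset.sum_comm]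
  refine Finset.sum_congr rfl fun _ _ => Finset.sum_congr rfl fun _ _ =>
    Finset.sum_congr rfl fun _ _ => Finset.sum_congr rfl fun _ _ => ?_
  ring

theorem IsConformalOn.orthonormal (C : IsConformalOn G H Φ f U) (F : IsFrameOn H Φ x v ξ U Ω)
    (hy : y ∈ U) (i j : Fin 2) :
    ip (f y • G y) (![x y, v y] i) (![x y, v y] j) = if i = j then 1 else 0 := by
  have hf := (C.pos y hy).ne'
  have h : ∀ a b, ip (f y • G y) a b = f y * ip (G y) a b := fun a b => by
    simp only [ip, Finset.mul_sum, Matrix.smul_apply, smul_eq_mul, mul_assoc]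
  have hs := ip_comm (F.metric.symm _ (F.map.mapsTo hy))
  fin_cases i <;> fin_cases j <;>
    simp [h, C.ip_eq hy, F.xx y hy, F.vv y hy, F.xv y hy, hs (push Φ v y) (push Φ x y), hf]

theorem IsConformalOn.mul_eq_one (C : IsConformalOn G H Φ f U) (F : IsFrameOn H Φ x v ξ U Ω)
    (hy : y ∈ U) :
    G y * (Matrix.of fun i j => f y * (x y i * x y j + v y i * v y j)) = 1 := by
  have h := inv_eq_of_orthonormal (C.orthonormal F hy)
  rw [Matrix.smul_mul, ← Matrix.mul_smul] at h
  rw [← h]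
  congr 1
  ext i j
  simp [Fin.sum_univ_two]

theorem IsConformalOn.inv_apply (C : IsConformalOn G H Φ f U) (F : IsFrameOn H Φ x v ξ U Ω)
    (hy : y ∈ U) (i j : Fin 2) :
    (G y)⁻¹ i j = f y * (x y i * x y j + v y i * v y j) := by
  rw [Matrix.inv_eq_right_inv (C.mul_eq_one F hy)]
  rfl

theorem IsConformalOn.isMetricOn (C : IsConformalOn G H Φ f U) (F : IsFrameOn H Φ x v ξ U Ω) :
    IsMetricOn G U where
  isOpen := F.map.isOpen
  smooth i j := by
    refine ContDiffOn.congr (f := fun y => (f y)⁻¹ * ip (H (Φ y)) (dmap Φ i y) (dmap Φ j y))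
      ?_ fun y hy => C.eq y hy i j
    exact (C.smooth.inv fun y hy => (C.pos y hy).ne').mul
      (ip_contDiffOn F.metric F.map (F.map.dmap_field i) (F.map.dmap_field j))
  symm y hy i j := by
    rw [C.eq y hy, C.eq y hy, ip_comm (F.metric.symm _ (F.map.mapsTo hy))]
  det y hy := by
    have h := congrArg Matrix.det (C.mul_eq_one F hy)
    rw [Matrix.det_mul, Matrix.det_one] at h
    exact IsUnit.of_mul_eq_one _ h

theorem push_id (a : EuclideanSpace ℝ (Fin 2) → Fin 2 → ℝ) :
    push (fun z => z) a = a := by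
  funext y
  simp only [push, dmap_id]
  exact (sum_smul_single (a y)).symm

theorem covD_id_apply (a b : EuclideanSpace ℝ (Fin 2) → Fin 2 → ℝ) (k : Fin 2) :
    covD G (fun z => z) a b y k = dd a (fun z => b z k) y
      + ∑ i, ∑ j, a y i * b y j * christoffel G k i j y := by
  have h : ∀ i c, pd i (fun z : EuclideanSpace ℝ (Fin 2) => z c) y =
      (Pi.single i 1 : Fin 2 → ℝ) c := fun i c => congrFun (dmap_id i y) c
  simp only [covD, Finset.sum_apply, Pi.smul_apply, smul_eq_mul, nabla, h, mul_add,
    Finset.sum_add_distrib, dd]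
  congr 1
  refine Finset.sum_congr rfl fun i _ => ?_
  rw [Finset.mul_sum]
  simp only [Pi.single_apply, mul_ite, mul_one, mul_zero, ite_mul, zero_mul,
    Finset.mul_sum]
  rw [Finset.sum_comm]
  refine Finset.sum_congr rfl fun j _ => ?_
  simp only [Finset.sum_ite_eq', Finset.mem_univ, if_true]
  ring

/-- The sum of the accelerations of the frame fields in the conformal metric vanishes. -/
theorem IsConformalOn.acceleration (C : IsConformalOn G H Φ f U) (F : IsFrameOn H Φ x v ξ U Ω)
    (hy : y ∈ U) :
    covD G (fun z => z) x x y + covD G (fun z => z) v v y = 0 := by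
  have hG := C.isMetricOn F
  have hi := hG.isMapOn_id
  have hs := ip_comm (hG.symm y hy)
  have hxx : ∀ y ∈ U, ip (G y) (x y) (x y) = (f y)⁻¹ := fun y hy => by
    rw [C.ip_eq hy, F.xx y hy, mul_one]
  have hvv : ∀ y ∈ U, ip (G y) (v y) (v y) = (f y)⁻¹ := fun y hy => by
    rw [C.ip_eq hy, F.vv y hy, mul_one]
  have hxv : ∀ y ∈ U, ip (G y) (x y) (v y) = 0 := fun y hy => by
    rw [C.ip_eq hy, F.xv y hy, mul_zero]
  have hc := covD_push_sub hG hi F.fx F.fv hy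
  rw [push_id, push_id, push_id, F.brk y hy, sub_eq_zero] at hc
  have dxx := fun w => dd_ip (x := w) hG hi F.fx F.fx hy
  have dvv := fun w => dd_ip (x := w) hG hi F.fv F.fv hy
  have dxv := fun w => dd_ip (x := w) hG hi F.fx F.fv hy
  simp only [dd_congr hG.isOpen hxx hy, dd_congr hG.isOpen hvv hy,
    dd_eq_zero hG.isOpen hxv hy] at dxx dvv dxv
  -- In the conformal metric ⟨x,∇_x x⟩ is half of x(f⁻¹), while ⟨x,∇_v v⟩ = -⟨∇_v x,v⟩ = -⟨∇_x v,v⟩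
  -- is minus half of it; the component along `v` is symmetric to this one.
  have h1 : ip (G y) (x y) (covD G (fun z => z) x x y + covD G (fun z => z) v v y) = 0 := by
    have := dxx x; have := dvv x; have := dxv v
    rw [← hc, hs _ (v y)] at this
    rw [hs (covD G (fun z => z) x x y)] at *
    rw [hs (covD G (fun z => z) x v y)] at *
    rw [ip_add_right]; linarith
  have h2 : ip (G y) (v y) (covD G (fun z => z) x x y + covD G (fun z => z) v v y) = 0 := by
    have := dvv v; have := dxx v; have := dxv x
    rw [← hc] at *
    rw [hs (covD G (fun z => z) v v y)] at *
    rw [hs (covD G (fun z => z) x v y)] at *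
    rw [hs (covD G (fun z => z) x x y)] at *
    rw [ip_add_right]; linarith
  have h := ip_expand_of_orthonormal (C.orthonormal F hy)
    (covD G (fun z => z) x x y + covD G (fun z => z) v v y)
  have h' : ∀ a b, ip (f y • G y) a b = f y * ip (G y) a b := fun a b => by
    simp only [ip, Finset.mul_sum, Matrix.smul_apply, smul_eq_mul, mul_assoc]
  rw [h, Fin.sum_univ_two]
  simp [h', h1, h2]

/-- The vanishing of the total acceleration, written in components. No derivative of `f` is left on
the right, an effect of the dimension two. -/
theorem IsConformalOn.trace_christoffel (C : IsConformalOn G H Φ f U)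
    (F : IsFrameOn H Φ x v ξ U Ω) (hy : y ∈ U) (k : Fin 2) :
    ∑ i, ∑ j, (G y)⁻¹ i j * christoffel G k i j y =
      -(f y * (dd x (fun z => x z k) y + dd v (fun z => v z k) y)) := by
  have h := congrFun (C.acceleration F hy) k
  rw [Pi.add_apply, covD_id_apply, covD_id_apply, Pi.zero_apply] at h
  have e : ∑ i, ∑ j, (G y)⁻¹ i j * christoffel G k i j y =
      f y * (∑ i, ∑ j, x y i * x y j * christoffel G k i j y
        + ∑ i, ∑ j, v y i * v y j * christoffel G k i j y) := by
    simp only [C.inv_apply F hy, ← Finset.sum_add_distrib, Finset.mul_sum]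
    exact Finset.sum_congr rfl fun _ _ => Finset.sum_congr rfl fun _ _ => by ring
  rw [e]
  linear_combination (f y) * h

theorem IsConformalOn.trace_smul (C : IsConformalOn G H Φ f U)
    (F : IsFrameOn H Φ x v ξ U Ω) (hy : y ∈ U) (A : Fin 2 → Fin 2 → Fin 3 → ℝ) :
    ∑ i, ∑ j, (G y)⁻¹ i j • A i j = f y • (∑ i, ∑ j, (x y i * x y j) • A i j
      + ∑ i, ∑ j, (v y i * v y j) • A i j) := by
  simp only [C.inv_apply F hy, ← Finset.sum_add_distrib, Finset.smul_sum]
  exact Finset.sum_congr rfl fun _ _ => Finset.sum_congr rfl fun _ _ => by module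

/-- The trace of a covariant derivative in the conformal metric. -/
theorem IsConformalOn.trace_nabla (C : IsConformalOn G H Φ f U)
    (F : IsFrameOn H Φ x v ξ U Ω) (hy : y ∈ U)
    {B : Fin 2 → EuclideanSpace ℝ (Fin 2) → Fin 3 → ℝ} (hB : ∀ j, IsFieldOn (B j) U) :
    ∑ i, ∑ j, (G y)⁻¹ i j •
      (nabla H Φ i (B j) y - ∑ k, christoffel G k i j y • B k y) =
    f y • (covD H Φ x (fun z => ∑ j, x z j • B j z) y
      + covD H Φ v (fun z => ∑ j, v z j • B j z) y) := by
  have hU := F.map.isOpen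
  -- The Christoffel correction is exactly the derivative of the frame coefficients that the Leibniz
  -- rule produces when they are moved inside ∇_x and ∇_v.
  have e : ∑ i, ∑ j, (G y)⁻¹ i j • ∑ k, christoffel G k i j y • B k y =
      ∑ k, (-(f y * (dd x (fun z => x z k) y + dd v (fun z => v z k) y))) • B k y := by
    simp only [← C.trace_christoffel F hy, Finset.smul_sum, Finset.sum_smul, smul_smul]
    rw [Finset.sum_comm_cycle]
  simp only [smul_sub, Finset.sum_sub_distrib]
  rw [e, C.trace_smul F hy, covD_sum_smul hU F.fx hB hy, covD_sum_smul hU F.fv hB hy]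
  simp only [neg_smul, Finset.sum_neg_distrib, mul_add, add_smul, Finset.sum_add_distrib,
    smul_add, Finset.smul_sum, smul_smul]
  abel

/-- The trace formula for the one-form dΦ gives f(∇_X X + ∇_V V), and the second acceleration is
zero. -/
theorem IsConformalOn.tension (C : IsConformalOn G H Φ f U)
    (F : IsFrameOn H Φ x v ξ U Ω) (hy : y ∈ U) :
    tensionCoord G H Φ y = (f y * curvatureFn H Φ x ξ y) • ξ y := by
  have h := C.trace_nabla F hy F.map.dmap_field
  have e : tensionCoord G H Φ y = ∑ i, ∑ j, (G y)⁻¹ i j •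
      (nabla H Φ i (dmap Φ j) y - ∑ k, christoffel G k i j y • dmap Φ k y) := by
    ext a
    simp [tensionCoord, Finset.sum_apply]
  have hx : covD H Φ x (fun z => ∑ j, x z j • dmap Φ j z) y = _ := F.covD_x_x hy
  have hv : covD H Φ v (fun z => ∑ j, v z j • dmap Φ j z) y = _ := F.geod y hy
  rw [e, h, hx, hv, add_zero, smul_smul]

/-- The trace formula is applied once more, to the one-form ∇(uξ). The tension field equals uξ only
on `U`, which suffices because `U` is open and the covariant derivative is local. -/
theorem IsConformalOn.bitension (C : IsConformalOn G H Φ f U)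
    (F : IsFrameOn H Φ x v ξ U Ω) (hy : y ∈ U) {u : EuclideanSpace ℝ (Fin 2) → ℝ}
    (hu : ∀ y, u y = f y * curvatureFn H Φ x ξ y) :
    bitensionCoord G H Φ y = f y • (covD H Φ x (covD H Φ x fun z => u z • ξ z) y
      + covD H Φ v (covD H Φ v fun z => u z • ξ z) y
      - u y • (curv H (Φ y) (push Φ x y) (ξ y) (push Φ x y)
        + curv H (Φ y) (push Φ v y) (ξ y) (push Φ v y))) := by
  have hU := F.map.isOpen
  have hT : ∀ y ∈ U, tensionCoord G H Φ y = u y • ξ y := fun y hy => by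
    rw [C.tension F hy, hu]
  have hus : ContDiffOn ℝ ∞ u U :=
    (C.smooth.mul F.curvatureFn_contDiffOn).congr fun y _ => hu y
  have hW : IsFieldOn (fun z => u z • ξ z) U := F.fξ.smul hus
  have hN : ∀ i, ∀ y ∈ U, nabla H Φ i (tensionCoord G H Φ) y =
      nabla H Φ i (fun z => u z • ξ z) y := fun i y hy => nabla_congr hU hT hy i
  have e : bitensionCoord G H Φ y = ∑ i, ∑ j, (G y)⁻¹ i j •
      (nabla H Φ i (nabla H Φ j fun z => u z • ξ z) y
        - ∑ k, christoffel G k i j y • nabla H Φ k (fun z => u z • ξ z) y)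
      - ∑ i, ∑ j, (G y)⁻¹ i j • curv H (Φ y) (dmap Φ i y) (u y • ξ y) (dmap Φ j y) := by
    ext a
    simp only [bitensionCoord, hT y hy, hN _ y hy, nabla_congr (H := H) (Φ := Φ) hU (hN _) hy]
    simp only [Pi.sub_apply, Finset.sum_apply, Pi.smul_apply, smul_eq_mul, mul_sub,
      Finset.sum_sub_distrib]
    rfl
  have e2 : ∀ w : EuclideanSpace ℝ (Fin 2) → Fin 2 → ℝ,
      ∑ i, ∑ j, (w y i * w y j) • curv H (Φ y) (dmap Φ i y) (u y • ξ y) (dmap Φ j y) =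
      u y • curv H (Φ y) (push Φ w y) (ξ y) (push Φ w y) := by
    intro w
    rw [push, curv_sum_smul_left, Finset.smul_sum]
    refine Finset.sum_congr rfl fun i _ => ?_
    rw [curv_sum_smul_right, Finset.smul_sum, Finset.smul_sum]
    refine Finset.sum_congr rfl fun j _ => ?_
    rw [curv_smul_middle]
    module
  rw [e, C.trace_nabla F hy fun j => hW.nabla F.metric F.map j, C.trace_smul F hy, e2, e2,
    smul_sub, smul_add]
  simp only [smul_add]
  rfl

end Conformal

end HopfCyl

end

noncomputable section

namespace HopfCyl

/-! ### The three frame components of the bitension field -/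

section Biharmonic

variable {H : EuclideanSpace ℝ (Fin 3) → Matrix (Fin 3) (Fin 3) ℝ}
    {Φ : EuclideanSpace ℝ (Fin 2) → EuclideanSpace ℝ (Fin 3)}
    {x v : EuclideanSpace ℝ (Fin 2) → Fin 2 → ℝ} {ξ : EuclideanSpace ℝ (Fin 2) → Fin 3 → ℝ}
    {U : Set (EuclideanSpace ℝ (Fin 2))} {Ω : Set (EuclideanSpace ℝ (Fin 3))}
    {y : EuclideanSpace ℝ (Fin 2)}
    {G : EuclideanSpace ℝ (Fin 2) → Matrix (Fin 2) (Fin 2) ℝ}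
    {f : EuclideanSpace ℝ (Fin 2) → ℝ}

theorem dd_log {w : EuclideanSpace ℝ (Fin 2) → Fin 2 → ℝ} (hf : DifferentiableAt ℝ f y)
    (h0 : f y ≠ 0) : dd w f y = f y * dd w (fun z => Real.log (f z)) y := by
  simp only [dd, Finset.mul_sum, pd]
  refine Finset.sum_congr rfl fun i _ => ?_
  rw [fderiv.log hf h0]
  simp only [_root_.smul_apply, smul_eq_mul]
  field_simp

/-- The bitension field of a conformal immersion vanishes at `y` if and only if its three frame
components do. -/
theorem IsConformalOn.bitension_eq_zero_iff (C : IsConformalOn G H Φ f U)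
    (F : IsFrameOn H Φ x v ξ U Ω) {κ τ L : EuclideanSpace ℝ (Fin 2) → ℝ}
    (hκ : κ = curvatureFn H Φ x ξ) (hτ : τ = torsionFn H Φ x v ξ)
    (hL : L = fun z => Real.log (f z)) (hv : ∀ y ∈ U, dd v κ y = 0) (hy : y ∈ U) :
    (∀ a, bitensionCoord G H Φ y a = 0) ↔
      dd x (dd x κ) y - κ y ^ 3 - 2 * κ y * τ y ^ 2
          + κ y * (∑ j, ∑ k, ricciCoord H j k (Φ y) * ξ y j * ξ y k)
          + 2 * dd x κ y * dd x L y
          + κ y * (dd x (dd x L) y + dd v (dd v L) y + dd x L y ^ 2 + dd v L y ^ 2) = 0 ∧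
      3 * κ y * dd x κ y - 2 * κ y * (∑ j, ∑ k, ricciCoord H j k (Φ y) * ξ y j * push Φ x y k)
          + 2 * κ y ^ 2 * dd x L y - 2 * κ y * τ y * dd v L y = 0 ∧
      dd x κ y * τ y + κ y * (∑ j, ∑ k, ricciCoord H j k (Φ y) * ξ y j * push Φ v y k)
          + κ y * τ y * dd x L y = 0 := by
  have hU := F.map.isOpen
  have hd : ∀ {u : EuclideanSpace ℝ (Fin 2) → ℝ}, ContDiffOn ℝ ∞ u U →
      ∀ y ∈ U, DifferentiableAt ℝ u y :=
    fun h y hy => h.differentiableAt_of_isOpen hU hy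
  have sκ : ContDiffOn ℝ ∞ κ U := hκ ▸ F.curvatureFn_contDiffOn
  have sτ : ContDiffOn ℝ ∞ τ U := hτ ▸ F.torsionFn_contDiffOn
  have sL : ContDiffOn ℝ ∞ L U := hL ▸ C.smooth.log fun y hy => (C.pos y hy).ne'
  have sx : ∀ {u : EuclideanSpace ℝ (Fin 2) → ℝ}, ContDiffOn ℝ ∞ u U → ContDiffOn ℝ ∞ (dd x u) U :=
    fun h => dd_contDiffOn hU F.fx h
  have sv : ∀ {u : EuclideanSpace ℝ (Fin 2) → ℝ}, ContDiffOn ℝ ∞ u U → ContDiffOn ℝ ∞ (dd v u) U :=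
    fun h => dd_contDiffOn hU F.fv h
  have df : ∀ w, ∀ y ∈ U, dd w f y = f y * dd w L y := fun w y hy => by
    rw [hL]; exact dd_log (hd C.smooth y hy) (C.pos y hy).ne'
  -- The coefficient of the tension field. Its derivatives are expressed through those of κ and ln
  -- f, with a factor `f` pulled out; Vκ = 0 shortens the ones along `v`.
  set u : EuclideanSpace ℝ (Fin 2) → ℝ := fun z => f z * κ z with hu
  have su : ContDiffOn ℝ ∞ u U := C.smooth.mul sκ
  have ux : ∀ y ∈ U, dd x u y = f y * (dd x κ y + κ y * dd x L y) := fun y hy => by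
    rw [hu, dd_mul (hd C.smooth y hy) (hd sκ y hy), df x y hy]; ring
  have uv : ∀ y ∈ U, dd v u y = f y * (κ y * dd v L y) := fun y hy => by
    rw [hu, dd_mul (hd C.smooth y hy) (hd sκ y hy), df v y hy, hv y hy]; ring
  have uxx : dd x (dd x u) y = f y * (dd x (dd x κ) y + 2 * dd x κ y * dd x L y
      + κ y * (dd x (dd x L) y + dd x L y ^ 2)) := by
    have hs : ContDiffOn ℝ ∞ (fun z => κ z * dd x L z) U := sκ.mul (sx sL)
    have hs2 : ContDiffOn ℝ ∞ (fun z => dd x κ z + κ z * dd x L z) U := (sx sκ).add hs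
    rw [dd_congr hU ux hy, dd_mul (hd C.smooth y hy) (hd hs2 y hy),
      dd_add (hd (sx sκ) y hy) (hd hs y hy), dd_mul (hd sκ y hy) (hd (sx sL) y hy), df x y hy]
    ring
  have uvv : dd v (dd v u) y = f y * (κ y * (dd v (dd v L) y + dd v L y ^ 2)) := by
    have hs : ContDiffOn ℝ ∞ (fun z => κ z * dd v L z) U := sκ.mul (sv sL)
    rw [dd_congr hU uv hy, dd_mul (hd C.smooth y hy) (hd hs y hy),
      dd_mul (hd sκ y hy) (hd (sv sL) y hy), df v y hy, hv y hy]
    ring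
  have hDx : ∀ y ∈ U, covD H Φ x (fun z => u z • ξ z) y = dd x u y • ξ y +
      ((-(u y * κ y)) • push Φ x y + (u y * τ y) • push Φ v y) := fun y hy => by
    rw [covD_smul hU F.fξ su hy, F.covD_x_ξ hy, hκ, hτ]; module
  -- The zero V-component is written out so that `covD_v_comb` applies.
  have hDv : ∀ y ∈ U, covD H Φ v (fun z => u z • ξ z) y = dd v u y • ξ y +
      ((u y * τ y) • push Φ x y + (0 : ℝ) • push Φ v y) := fun y hy => by
    rw [covD_smul hU F.fξ su hy, F.covD_v_ξ hy, hτ]; module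
  have suκ : ContDiffOn ℝ ∞ (fun z => u z * κ z) U := su.mul sκ
  have suτ : ContDiffOn ℝ ∞ (fun z => u z * τ z) U := su.mul sτ
  have hn : dd x (fun z => -(u z * κ z)) y = -(u y * dd x κ y + dd x u y * κ y) := by
    have h1 := dd_sub (x := x) (differentiableAt_const (0 : ℝ)) (hd suκ y hy)
    rw [dd_mul (hd su y hy) (hd sκ y hy)] at h1
    simpa [dd_const] using h1
  have hb := C.bitension F hy (u := u) fun z => by rw [hu, hκ]
  rw [covD_congr hU hDx hy, covD_congr hU hDv hy,
    F.covD_x_comb hy (sx su) suκ.neg suτ, F.covD_v_comb hy (sv su) suτ contDiffOn_const,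
    dd_const, hn, dd_mul (hd su y hy) (hd sτ y hy), dd_mul (hd su y hy) (hd sτ y hy),
    ← hκ, ← hτ, uxx, uvv, ux y hy, uv y hy] at hb
  -- With Vκ = 0 these read Xτ = Ric(ξ,V) and Vτ = Ric(ξ,X). Each adds to the Ricci term of the same
  -- component coming from the curvature trace, which explains the coefficient 2 of Ric(ξ,X) and the
  -- common factor 2 in the V-component.
  have rv := F.ricci_ξ_v hy
  have rx := F.ricci_ξ_x hy
  rw [← hκ, ← hτ, hv y hy, add_zero] at rv
  rw [← hτ] at rx
  have tr := F.ip_trace_curv hy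
  set Rξ := ∑ j, ∑ k, ricciCoord H j k (Φ y) * ξ y j * ξ y k
  set Rv := ∑ j, ∑ k, ricciCoord H j k (Φ y) * ξ y j * push Φ v y k
  set Rx := ∑ j, ∑ k, ricciCoord H j k (Φ y) * ξ y j * push Φ x y k
  set T := curv H (Φ y) (push Φ x y) (ξ y) (push Φ x y)
        + curv H (Φ y) (push Φ v y) (ξ y) (push Φ v y)
  have hf := (C.pos y hy).ne'
  have hs := ip_comm (F.metric.symm _ (F.map.mapsTo hy))
  have xξ : ip (H (Φ y)) (push Φ x y) (ξ y) = 0 := by rw [hs, F.ξx y hy]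
  have vξ : ip (H (Φ y)) (push Φ v y) (ξ y) = 0 := by rw [hs, F.ξv y hy]
  have vx : ip (H (Φ y)) (push Φ v y) (push Φ x y) = 0 := by rw [hs, F.xv y hy]
  -- The components along ξ, X and V are the three expressions times f², -f² and 2f², all nonzero.
  have iξ : ip (H (Φ y)) (bitensionCoord G H Φ y) (ξ y) = f y ^ 2 *
      (dd x (dd x κ) y - κ y ^ 3 - 2 * κ y * τ y ^ 2 + κ y * Rξ + 2 * dd x κ y * dd x L y
          + κ y * (dd x (dd x L) y + dd v (dd v L) y + dd x L y ^ 2 + dd v L y ^ 2)) := by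
    rw [hb]
    simp only [ip_smul_left, ip_add_left, ip_sub_left, tr, F.ξξ y hy, xξ, vξ, hu]
    ring
  have ix : ip (H (Φ y)) (bitensionCoord G H Φ y) (push Φ x y) = -f y ^ 2 *
      (3 * κ y * dd x κ y - 2 * κ y * Rx + 2 * κ y ^ 2 * dd x L y
        - 2 * κ y * τ y * dd v L y) := by
    rw [hb]
    simp only [ip_smul_left, ip_add_left, ip_sub_left, tr, F.xx y hy, F.ξx y hy, vx, hu, ← rx]
    ring
  have iv : ip (H (Φ y)) (bitensionCoord G H Φ y) (push Φ v y) = 2 * f y ^ 2 *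
      (dd x κ y * τ y + κ y * Rv + κ y * τ y * dd x L y) := by
    rw [hb]
    simp only [ip_smul_left, ip_add_left, ip_sub_left, tr, F.vv y hy, F.ξv y hy, F.xv y hy, hu,
      ← rv]
    ring
  have hz : (∀ a, bitensionCoord G H Φ y a = 0) ↔ bitensionCoord G H Φ y = 0 :=
    ⟨fun h => funext h, fun h a => congrFun h a⟩
  rw [hz]
  constructor
  · intro h
    rw [h, ip_zero_left] at iξ ix iv
    refine ⟨?_, ?_, ?_⟩
    · simpa [hf] using iξ.symm
    · simpa [hf] using ix.symm
    · simpa [hf] using iv.symm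
  · rintro ⟨h1, h2, h3⟩
    rw [F.expand hy (bitensionCoord G H Φ y), iξ, ix, iv, h1, h2, h3]
    simp

end Biharmonic

/-! ### Riemannian submersions in coordinates -/

section Submersion

variable {H : EuclideanSpace ℝ (Fin 3) → Matrix (Fin 3) (Fin 3) ℝ}
    {K : EuclideanSpace ℝ (Fin 2) → Matrix (Fin 2) (Fin 2) ℝ}
    {Φ : EuclideanSpace ℝ (Fin 2) → EuclideanSpace ℝ (Fin 3)}
    {P : EuclideanSpace ℝ (Fin 3) → EuclideanSpace ℝ (Fin 2)}
    {x v : EuclideanSpace ℝ (Fin 2) → Fin 2 → ℝ} {ξ : EuclideanSpace ℝ (Fin 2) → Fin 3 → ℝ}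
    {U : Set (EuclideanSpace ℝ (Fin 2))} {Ω : Set (EuclideanSpace ℝ (Fin 3))}
    {Ω' : Set (EuclideanSpace ℝ (Fin 2))} {y : EuclideanSpace ℝ (Fin 2)}

/-- The differential of `P` at `z`, in components. -/
def diffAt (P : EuclideanSpace ℝ (Fin 3) → EuclideanSpace ℝ (Fin 2))
    (z : EuclideanSpace ℝ (Fin 3)) (w : Fin 3 → ℝ) : Fin 2 → ℝ :=
  ∑ b, w b • dmap P b z

/-- The difference of the metric `H` and the pull-back of `K`. -/
def defect (H : EuclideanSpace ℝ (Fin 3) → Matrix (Fin 3) (Fin 3) ℝ)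
    (K : EuclideanSpace ℝ (Fin 2) → Matrix (Fin 2) (Fin 2) ℝ)
    (P : EuclideanSpace ℝ (Fin 3) → EuclideanSpace ℝ (Fin 2)) (z : EuclideanSpace ℝ (Fin 3)) :
    Matrix (Fin 3) (Fin 3) ℝ :=
  Matrix.of fun i j => H z i j - ip (K (P z)) (dmap P i z) (dmap P j z)

theorem ip_defect (z : EuclideanSpace ℝ (Fin 3)) (a b : Fin 3 → ℝ) :
    ip (defect H K P z) a b = ip (H z) a b - ip (K (P z)) (diffAt P z a) (diffAt P z b) := by
  have h : ip (K (P z)) (diffAt P z a) (diffAt P z b) =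
      ∑ i, ∑ j, ip (K (P z)) (dmap P i z) (dmap P j z) * a i * b j := by
    rw [diffAt, diffAt, ip_sum_left]
    refine Finset.sum_congr rfl fun i _ => ?_
    rw [ip_sum_right]
    refine Finset.sum_congr rfl fun j _ => ?_
    rw [ip_smul_left, ip_smul_right]
    ring
  rw [h]
  simp only [ip, defect, Matrix.of_apply, sub_mul, Finset.sum_sub_distrib]

/-- A map with non-negative defect, along which `X`, `ξ` are horizontal and `V` is vertical. -/
structure IsSubmersionOn (H : EuclideanSpace ℝ (Fin 3) → Matrix (Fin 3) (Fin 3) ℝ)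
    (K : EuclideanSpace ℝ (Fin 2) → Matrix (Fin 2) (Fin 2) ℝ)
    (Φ : EuclideanSpace ℝ (Fin 2) → EuclideanSpace ℝ (Fin 3))
    (P : EuclideanSpace ℝ (Fin 3) → EuclideanSpace ℝ (Fin 2))
    (x v : EuclideanSpace ℝ (Fin 2) → Fin 2 → ℝ) (ξ : EuclideanSpace ℝ (Fin 2) → Fin 3 → ℝ)
    (U : Set (EuclideanSpace ℝ (Fin 2))) (Ω : Set (EuclideanSpace ℝ (Fin 3)))
    (Ω' : Set (EuclideanSpace ℝ (Fin 2))) : Prop where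
  base : IsMetricOn K Ω'
  map : IsMapOn P Ω Ω'
  nonneg : ∀ z ∈ Ω, ∀ w, 0 ≤ ip (defect H K P z) w w
  x_horizontal : ∀ y ∈ U, ∀ t, ip (defect H K P (Φ y)) (push Φ x y) t = 0
  ξ_horizontal : ∀ y ∈ U, ∀ t, ip (defect H K P (Φ y)) (ξ y) t = 0
  v_vertical : ∀ y ∈ U, diffAt P (Φ y) (push Φ v y) = 0

namespace IsSubmersionOn

theorem defect_symm (S : IsSubmersionOn H K Φ P x v ξ U Ω Ω') (F : IsFrameOn H Φ x v ξ U Ω)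
    {z : EuclideanSpace ℝ (Fin 3)} (hz : z ∈ Ω) (i j : Fin 3) :
    defect H K P z i j = defect H K P z j i := by
  simp only [defect, Matrix.of_apply]
  rw [F.metric.symm z hz, ip_comm (S.base.symm _ (S.map.mapsTo hz))]

theorem defect_contDiffOn (S : IsSubmersionOn H K Φ P x v ξ U Ω Ω') (F : IsFrameOn H Φ x v ξ U Ω)
    (i j : Fin 3) : ContDiffOn ℝ ∞ (fun z => defect H K P z i j) Ω :=
  (F.metric.smooth i j).sub
    (ip_contDiffOn S.base S.map (S.map.dmap_field i) (S.map.dmap_field j))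

/-- First-kind symbols are linear in the metric, so the difference between covariant differentiation
upstairs and in the base is governed by the symbols of the defect. -/
theorem lowChristoffel_defect (S : IsSubmersionOn H K Φ P x v ξ U Ω Ω')
    (F : IsFrameOn H Φ x v ξ U Ω) {z : EuclideanSpace ℝ (Fin 3)} (hz : z ∈ Ω) (l i j : Fin 3) :
    lowChristoffel (defect H K P) l i j z = lowChristoffel H l i j z
      - lowChristoffel (fun z => Matrix.of fun i j => ip (K (P z)) (dmap P i z) (dmap P j z))
        l i j z := by
  have h : ∀ k i j, pd k (fun z => defect H K P z i j) z = pd k (fun z => H z i j) z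
      - pd k (fun z => ip (K (P z)) (dmap P i z) (dmap P j z)) z := fun k i j =>
    pd_sub ((F.metric.smooth i j).differentiableAt_of_isOpen F.metric.isOpen hz)
      ((ip_contDiffOn S.base S.map (S.map.dmap_field i)
        (S.map.dmap_field j)).differentiableAt_of_isOpen F.metric.isOpen hz)
  simp only [lowChristoffel, h, Matrix.of_apply]
  ring

/-- The defect has vanishing derivative in its null directions. -/
theorem pd_defect (S : IsSubmersionOn H K Φ P x v ξ U Ω Ω') (F : IsFrameOn H Φ x v ξ U Ω)
    (hy : y ∈ U) (q : Fin 3) :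
    ∑ c, ∑ b, pd q (fun z => defect H K P z c b) (Φ y) * push Φ x y c * push Φ x y b = 0 := by
  have hz := F.map.mapsTo hy
  have hΩ := F.metric.isOpen
  set w := push Φ x y with hw
  -- The vector X at `y` is frozen as `w`. The defect is non-negative and `w` is null for it at
  -- Φ(y), so the function has a minimum there and its derivative vanishes.
  have hmin : IsLocalMin (fun z => ip (defect H K P z) w w) (Φ y) := by
    refine Filter.eventually_of_mem (hΩ.mem_nhds hz) fun z hz => ?_
    change ip (defect H K P (Φ y)) w w ≤ _
    rw [S.x_horizontal y hy w]
    exact S.nonneg z hz w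
  have h0 : pd q (fun z => ip (defect H K P z) w w) (Φ y) = 0 := by
    rw [pd, hmin.fderiv_eq_zero]; rfl
  have hd : ∀ {u : EuclideanSpace ℝ (Fin 3) → ℝ}, ContDiffOn ℝ ∞ u Ω →
      DifferentiableAt ℝ u (Φ y) := fun h => h.differentiableAt_of_isOpen hΩ hz
  have hs : ∀ c b, ContDiffOn ℝ ∞ (fun z => defect H K P z c b * w c * w b) Ω := fun c b =>
    ((S.defect_contDiffOn F c b).mul contDiffOn_const).mul contDiffOn_const
  rw [← h0]
  simp only [ip]
  rw [pd_sum fun c _ => hd (ContDiffOn.sum fun b _ => hs c b)]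
  refine Finset.sum_congr rfl fun c _ => ?_
  rw [pd_sum fun b _ => hd (hs c b)]
  refine Finset.sum_congr rfl fun b _ => ?_
  rw [pd_mul (hd ((S.defect_contDiffOn F c b).mul contDiffOn_const)) (differentiableAt_const _),
    pd_mul (hd (S.defect_contDiffOn F c b)) (differentiableAt_const _), pd_const, pd_const]
  ring

/-- Let D be the defect. The first-kind symbol on (X,X), paired with ξ, is (∂_X D)(X,ξ) - ½(∂_ξ
D)(X,X). The last term is zero by `pd_defect`; differentiating D(X,·) = 0 along the cylinder gives
(∂_X D)(X,ξ) = -D(∂_X X,ξ), zero because ξ is null for D. Thus X need not be extended off the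
cylinder. -/
theorem defect_christoffel (S : IsSubmersionOn H K Φ P x v ξ U Ω Ω')
    (F : IsFrameOn H Φ x v ξ U Ω) (hy : y ∈ U) :
    ∑ q, ξ y q * ∑ c, ∑ b, lowChristoffel (defect H K P) q c b (Φ y)
      * push Φ x y c * push Φ x y b = 0 := by
  have hU := F.map.isOpen
  have hz := F.map.mapsTo hy
  have hsym : ∀ k i j, pd k (fun z => defect H K P z i j) (Φ y) =
      pd k (fun z => defect H K P z j i) (Φ y) := fun k i j =>
    pd_congr F.metric.isOpen (fun z hz => S.defect_symm F hz i j) hz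
  have hd : ∀ {u : EuclideanSpace ℝ (Fin 2) → ℝ}, ContDiffOn ℝ ∞ u U →
      DifferentiableAt ℝ u y := fun h => h.differentiableAt_of_isOpen hU hy
  have hB := fun c b => F.map.comp_smooth (S.defect_contDiffOn F c b)
  have hnull : ∀ q, ∀ z ∈ U, ∑ b, defect H K P (Φ z) b q * push Φ x z b = 0 := fun q z hz => by
    have := S.x_horizontal z hz (Pi.single q 1)
    rwa [ip_single_right] at this
  have h1 : ∀ q, ∑ b, dd x (fun z => defect H K P (Φ z) b q) y * push Φ x y b =
      -∑ b, defect H K P (Φ y) b q * dd x (fun z => push Φ x z b) y := by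
    intro q
    have h := dd_eq_zero (x := x) hU (hnull q) hy
    have e : dd x (fun z => ∑ b, defect H K P (Φ z) b q * push Φ x z b) y =
        ∑ b, dd x (fun z => defect H K P (Φ z) b q * push Φ x z b) y := by
      simp only [dd]
      rw [Finset.sum_comm]
      refine Finset.sum_congr rfl fun i _ => ?_
      rw [pd_sum fun b _ => hd ((hB b q).mul (F.fX b)), Finset.mul_sum]
    rw [e] at h
    rw [eq_neg_iff_add_eq_zero, ← Finset.sum_add_distrib, ← h]
    exact Finset.sum_congr rfl fun b _ => by
      rw [dd_mul (hd (hB b q)) (hd (F.fX b)), add_comm]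
  have h2 : ∀ b q, dd x (fun z => defect H K P (Φ z) b q) y =
      ∑ c, push Φ x y c * pd c (fun z => defect H K P z b q) (Φ y) := fun b q =>
    dd_comp F.map F.metric.isOpen (S.defect_contDiffOn F b q) hy
  have h3 : ∀ q, ∑ c, ∑ b, lowChristoffel (defect H K P) q c b (Φ y)
      * push Φ x y c * push Φ x y b =
      -∑ b, defect H K P (Φ y) b q * dd x (fun z => push Φ x z b) y := by
    intro q
    rw [← h1]
    have e1 : ∑ b, dd x (fun z => defect H K P (Φ z) b q) y * push Φ x y b =
        ∑ c, ∑ b, pd c (fun z => defect H K P z b q) (Φ y) * push Φ x y c * push Φ x y b := by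
      simp only [h2, Finset.sum_mul]
      rw [Finset.sum_comm]
      exact Finset.sum_congr rfl fun _ _ => Finset.sum_congr rfl fun _ _ => by ring
    have e2 : ∑ c, ∑ b, pd b (fun z => defect H K P z c q) (Φ y) * push Φ x y c * push Φ x y b =
        ∑ c, ∑ b, pd c (fun z => defect H K P z b q) (Φ y) * push Φ x y c * push Φ x y b := by
      rw [Finset.sum_comm]
      exact Finset.sum_congr rfl fun _ _ => Finset.sum_congr rfl fun _ _ => by ring
    have e3 := S.pd_defect F hy q
    have e4 : ∑ c, ∑ b, lowChristoffel (defect H K P) q c b (Φ y)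
        * push Φ x y c * push Φ x y b = (1 / 2 : ℝ) *
        (∑ c, ∑ b, pd c (fun z => defect H K P z b q) (Φ y) * push Φ x y c * push Φ x y b
        + ∑ c, ∑ b, pd b (fun z => defect H K P z c q) (Φ y) * push Φ x y c * push Φ x y b
        - ∑ c, ∑ b, pd q (fun z => defect H K P z c b) (Φ y) * push Φ x y c * push Φ x y b) := by
      simp only [← Finset.sum_add_distrib, ← Finset.sum_sub_distrib, Finset.mul_sum]
      exact Finset.sum_congr rfl fun _ _ => Finset.sum_congr rfl fun _ _ => by
        simp only [lowChristoffel]; ring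
    rw [e4, e2, e3, e1]
    ring
  simp only [h3]
  have h4 := S.ξ_horizontal y hy (fun b => dd x (fun z => push Φ x z b) y)
  have h5 : ∑ q, ξ y q * -∑ b, defect H K P (Φ y) b q * dd x (fun z => push Φ x z b) y =
      -ip (defect H K P (Φ y)) (ξ y) (fun b => dd x (fun z => push Φ x z b) y) := by
    simp only [ip, mul_neg, Finset.mul_sum, Finset.sum_neg_distrib]
    congr 1
    refine Finset.sum_congr rfl fun q _ => Finset.sum_congr rfl fun b _ => ?_
    rw [S.defect_symm F hz b q]
    ring
  rw [h5, h4, neg_zero]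

theorem pushAlong_push (S : IsSubmersionOn H K Φ P x v ξ U Ω Ω') (F : IsFrameOn H Φ x v ξ U Ω)
    (hy : y ∈ U) (w : EuclideanSpace ℝ (Fin 2) → Fin 2 → ℝ) :
    pushAlong P Φ (push Φ w) y = push (fun z => P (Φ z)) w y := by
  simp only [push, dmap_comp S.map F.map hy, pushAlong, Finset.sum_apply, Pi.smul_apply,
    smul_eq_mul, Finset.sum_smul, Finset.smul_sum, smul_smul]
  rw [Finset.sum_comm]

/-- The geodesic curvature is computed in the base. -/
theorem curvatureFn_eq (S : IsSubmersionOn H K Φ P x v ξ U Ω Ω') (F : IsFrameOn H Φ x v ξ U Ω)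
    (hy : y ∈ U) :
    curvatureFn H Φ x ξ y =
      ip (K (P (Φ y))) (covD K (fun z => P (Φ z)) x (pushAlong P Φ (push Φ x)) y)
        (pushAlong P Φ ξ y) := by
  have hz := F.map.mapsTo hy
  -- The pull-back of the base metric is degenerate, hence the comparison is made through first-kind
  -- symbols only.
  set Q : EuclideanSpace ℝ (Fin 3) → Matrix (Fin 3) (Fin 3) ℝ :=
    fun z => Matrix.of fun i j => ip (K (P z)) (dmap P i z) (dmap P j z) with hQ
  have hid : ∀ W : EuclideanSpace ℝ (Fin 2) → Fin 3 → ℝ, pushAlong (fun z => z) Φ W = W := by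
    intro W; funext y; simp only [pushAlong, dmap_id]; exact (sum_smul_single (W y)).symm
  have a1 : ∀ i q, ip (H (Φ y)) (nabla H Φ i (push Φ x) y) (Pi.single q 1) =
      ∑ b, H (Φ y) b q * pd i (fun z => push Φ x z b) y
        + ∑ c, ∑ b, lowChristoffel H q c b (Φ y) * dmap Φ i y c * push Φ x y b := by
    intro i q
    have h := ip_nabla_pushAlong F.metric F.metric.isMapOn_id F.map (G := H)
      (fun z _ i j => by rw [dmap_id, dmap_id, ip_single_single]) F.fX hy i q
    rwa [hid, dmap_id] at h
  have a2 : ∀ i q, ip (K (P (Φ y))) (nabla K (fun z => P (Φ z)) i (pushAlong P Φ (push Φ x)) y)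
      (dmap P q (Φ y)) = ∑ b, Q (Φ y) b q * pd i (fun z => push Φ x z b) y
        + ∑ c, ∑ b, lowChristoffel Q q c b (Φ y) * dmap Φ i y c * push Φ x y b :=
    fun i q => ip_nabla_pushAlong S.base S.map F.map (G := Q) (fun z _ i j => rfl) F.fX hy i q
  have a3 : ∀ i q, ip (H (Φ y)) (nabla H Φ i (push Φ x) y) (Pi.single q 1)
      - ip (K (P (Φ y))) (nabla K (fun z => P (Φ z)) i (pushAlong P Φ (push Φ x)) y)
        (dmap P q (Φ y)) = ∑ b, defect H K P (Φ y) b q * pd i (fun z => push Φ x z b) y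
        + ∑ c, ∑ b, lowChristoffel (defect H K P) q c b (Φ y) * dmap Φ i y c * push Φ x y b := by
    intro i q
    rw [a1, a2]
    simp only [S.lowChristoffel_defect F hz, sub_mul, Finset.sum_sub_distrib, defect,
      Matrix.of_apply]
    rw [hQ]
    simp only [Matrix.of_apply]
    ring
  have a4 : ∀ q, ip (H (Φ y)) (covD H Φ x (push Φ x) y) (Pi.single q 1)
      - ip (K (P (Φ y))) (covD K (fun z => P (Φ z)) x (pushAlong P Φ (push Φ x)) y)
        (dmap P q (Φ y)) = ∑ b, defect H K P (Φ y) b q * dd x (fun z => push Φ x z b) y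
        + ∑ c, ∑ b, lowChristoffel (defect H K P) q c b (Φ y) * push Φ x y c * push Φ x y b := by
    intro q
    have e1 : ∑ b, defect H K P (Φ y) b q * dd x (fun z => push Φ x z b) y =
        ∑ i, x y i * ∑ b, defect H K P (Φ y) b q * pd i (fun z => push Φ x z b) y := by
      simp only [dd, Finset.mul_sum]
      rw [Finset.sum_comm]
      exact Finset.sum_congr rfl fun _ _ => Finset.sum_congr rfl fun _ _ => by ring
    have e2 : ∑ c, ∑ b, lowChristoffel (defect H K P) q c b (Φ y) * push Φ x y c * push Φ x y b =
        ∑ i, x y i * ∑ c, ∑ b, lowChristoffel (defect H K P) q c b (Φ y) * dmap Φ i y c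
          * push Φ x y b := by
      have h : ∀ T : Fin 3 → ℝ, ∑ c, push Φ x y c * T c = ∑ i, x y i * ∑ c, dmap Φ i y c * T c := by
        intro T
        simp only [push, Finset.sum_apply, Pi.smul_apply, smul_eq_mul, Finset.sum_mul,
          Finset.mul_sum, mul_assoc]
        rw [Finset.sum_comm]
      have h2 : ∀ u : Fin 3 → ℝ, ∑ c, ∑ b, lowChristoffel (defect H K P) q c b (Φ y) * u c
          * push Φ x y b = ∑ c, u c * ∑ b, lowChristoffel (defect H K P) q c b (Φ y)
          * push Φ x y b := fun u => by
        simp only [Finset.mul_sum]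
        exact Finset.sum_congr rfl fun _ _ => Finset.sum_congr rfl fun _ _ => by ring
      simp only [h2, h]
    rw [e1, e2, ← Finset.sum_add_distrib]
    simp only [covD, ip_sum_left, ip_smul_left, ← Finset.sum_sub_distrib, ← mul_sub, ← mul_add, a3]
  -- Pairing with ξ leaves two terms: one is the defect on ξ, hence zero, and the other vanishes by
  -- `defect_christoffel`.
  have a5 : curvatureFn H Φ x ξ y
      - ip (K (P (Φ y))) (covD K (fun z => P (Φ z)) x (pushAlong P Φ (push Φ x)) y)
        (pushAlong P Φ ξ y) = ∑ q, ξ y q *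
        (∑ b, defect H K P (Φ y) b q * dd x (fun z => push Φ x z b) y
        + ∑ c, ∑ b, lowChristoffel (defect H K P) q c b (Φ y) * push Φ x y c * push Φ x y b) := by
    simp only [← a4, mul_sub, Finset.sum_sub_distrib, ← ip_smul_right, ← ip_sum_right]
    rw [← sum_smul_single]
    rfl
  have a6 : ∑ q, ξ y q * ∑ b, defect H K P (Φ y) b q * dd x (fun z => push Φ x z b) y = 0 := by
    rw [← S.ξ_horizontal y hy (fun b => dd x (fun z => push Φ x z b) y)]
    simp only [ip, Finset.mul_sum]
    refine Finset.sum_congr rfl fun q _ => Finset.sum_congr rfl fun b _ => ?_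
    rw [S.defect_symm F hz b q]
    ring
  have a7 := S.defect_christoffel F hy
  simp only [mul_add, Finset.sum_add_distrib, a6, a7, add_zero] at a5
  exact sub_eq_zero.1 a5

/-- The geodesic curvature of the lifts is constant along the fibres. -/
theorem dd_curvatureFn (S : IsSubmersionOn H K Φ P x v ξ U Ω Ω') (F : IsFrameOn H Φ x v ξ U Ω)
    (hy : y ∈ U) : dd v (curvatureFn H Φ x ξ) y = 0 := by
  have hU := F.map.isOpen
  set Ψ : EuclideanSpace ℝ (Fin 2) → EuclideanSpace ℝ (Fin 2) := fun z => P (Φ z) with hΨ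
  have mΨ : IsMapOn Ψ U Ω' := S.map.comp F.map
  have fX := pushAlong_field S.map F.map F.fX
  have fη := pushAlong_field S.map F.map F.fξ
  have fA := covD_field S.base mΨ F.fx fX
  have hX : ∀ y ∈ U, pushAlong P Φ (push Φ x) y = push Ψ x y := fun y hy =>
    S.pushAlong_push F hy x
  have hV : ∀ y ∈ U, push Ψ v y = 0 := fun y hy => by
    rw [← S.pushAlong_push F hy v]; exact S.v_vertical y hy
  have kx : ∀ W Z : EuclideanSpace ℝ (Fin 2) → Fin 3 → ℝ,
      (∀ y ∈ U, ∀ t, ip (defect H K P (Φ y)) (W y) t = 0) → ∀ y ∈ U,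
      ip (K (Ψ y)) (pushAlong P Φ W y) (pushAlong P Φ Z y) = ip (H (Φ y)) (W y) (Z y) := by
    intro W Z h y hy
    have := h y hy (Z y)
    rw [ip_defect, sub_eq_zero] at this
    exact this.symm
  have oxx : ∀ y ∈ U, ip (K (Ψ y)) (pushAlong P Φ (push Φ x) y) (pushAlong P Φ (push Φ x) y) = 1 :=
    fun y hy => by rw [kx _ _ S.x_horizontal y hy, F.xx y hy]
  have oηη : ∀ y ∈ U, ip (K (Ψ y)) (pushAlong P Φ ξ y) (pushAlong P Φ ξ y) = 1 :=
    fun y hy => by rw [kx _ _ S.ξ_horizontal y hy, F.ξξ y hy]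
  have oηx : ∀ y ∈ U, ip (K (Ψ y)) (pushAlong P Φ ξ y) (pushAlong P Φ (push Φ x) y) = 0 :=
    fun y hy => by rw [kx _ _ S.ξ_horizontal y hy, F.ξx y hy]
  have hs := ip_comm (S.base.symm _ (mΨ.mapsTo hy))
  have b0 : ∀ y ∈ U, ∀ W, covD K Ψ (HopfCyl.brk x v) W y = 0 := fun y hy W => by
    simp [covD, F.brk y hy]
  -- Along Ψ = P ∘ Φ the field `v` is mapped to zero, so torsion-freeness and [x,v] = 0 give ∇_v
  -- dΨ(x) = ∇_x dΨ(v) = 0. The pull-back connection does not require Ψ to be an immersion.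
  have dX : ∀ y ∈ U, covD K Ψ v (pushAlong P Φ (push Φ x)) y = 0 := by
    intro y hy
    have h := covD_push_sub S.base mΨ F.fx F.fv hy
    have h0 : push Ψ (HopfCyl.brk x v) y = 0 := by simp [push, F.brk y hy]
    rw [covD_congr hU hV hy, covD_zero, h0, zero_sub, neg_eq_zero] at h
    rw [covD_congr hU hX hy, h]
  -- ∇_v and ∇_x commute here: the bracket is zero and the curvature has dΨ(v) = 0 as an argument.
  have dA : covD K Ψ v (covD K Ψ x (pushAlong P Φ (push Φ x))) y = 0 := by
    have h := covD_covD_sub S.base mΨ F.fx F.fv fX hy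
    have hc : ∀ z (a b : Fin 2 → ℝ), curv K z a 0 b = 0 := fun z a b => by
      have := curv_smul_middle (H := K) (z := z) 0 a 0 b
      simpa using this
    rw [covD_congr hU dX hy, covD_zero, hV y hy, hc, b0 y hy, zero_sub, add_zero,
      neg_eq_zero] at h
    exact h
  -- In a two-dimensional target, a unit field orthogonal to a unit field parallel along `v` is
  -- itself parallel along `v`.
  have dη : covD K Ψ v (pushAlong P Φ ξ) y = 0 := by
    have h1 := dd_ip (x := v) S.base mΨ fη fη hy
    have h2 := dd_ip (x := v) S.base mΨ fη fX hy
    rw [dd_eq_zero hU oηη hy, hs (pushAlong P Φ ξ y)] at h1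
    rw [dd_eq_zero hU oηx hy, dX y hy, ip_zero_right, add_zero] at h2
    have he : ∀ i j : Fin 2, ip (K (Ψ y)) (![pushAlong P Φ (push Φ x) y, pushAlong P Φ ξ y] i)
        (![pushAlong P Φ (push Φ x) y, pushAlong P Φ ξ y] j) = if i = j then 1 else 0 := by
      intro i j
      fin_cases i <;> fin_cases j <;>
        simp [oxx y hy, oηη y hy, oηx y hy, hs (pushAlong P Φ (push Φ x) y) (pushAlong P Φ ξ y)]
    have h := ip_expand_of_orthonormal he (covD K Ψ v (pushAlong P Φ ξ) y)
    rw [Fin.sum_univ_two] at h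
    rw [h]
    have h3 : ip (K (Ψ y)) (pushAlong P Φ ξ y) (covD K Ψ v (pushAlong P Φ ξ) y) = 0 := by
      rw [hs]; linarith
    have h4 : ip (K (Ψ y)) (pushAlong P Φ (push Φ x) y) (covD K Ψ v (pushAlong P Φ ξ) y) = 0 := by
      rw [hs]; linarith
    simp [h3, h4]
  rw [dd_congr hU (fun z hz => S.curvatureFn_eq F hz) hy, dd_ip S.base mΨ fA fη hy, dA, dη,
    ip_zero_left, ip_zero_right, add_zero]

end IsSubmersionOn

end Submersion

end HopfCyl

end

noncomputable section

namespace HopfCyl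

/-! ### Coordinate expressions on manifolds -/

section Charts

variable {m n : ℕ}
  {M : Type*} [TopologicalSpace M] [ChartedSpace (EuclideanSpace ℝ (Fin m)) M]
  [IsManifold (𝓡 m) ∞ M]
  {N : Type*} [TopologicalSpace N] [ChartedSpace (EuclideanSpace ℝ (Fin n)) N]
  [IsManifold (𝓡 n) ∞ N]

theorem mdifferentiableAt_chart {x₀ q : M} (hq : q ∈ (extChartAt (𝓡 m) x₀).source) :
    MDifferentiableAt (𝓡 m) 𝓘(ℝ, EuclideanSpace ℝ (Fin m)) (extChartAt (𝓡 m) x₀) q :=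
  mdifferentiableAt_extChartAt (by rwa [extChartAt_source] at hq)

theorem mdifferentiableAt_chart_symm {x₀ : M} {y : EuclideanSpace ℝ (Fin m)}
    (hy : y ∈ (extChartAt (𝓡 m) x₀).target) :
    MDifferentiableAt 𝓘(ℝ, EuclideanSpace ℝ (Fin m)) (𝓡 m) (extChartAt (𝓡 m) x₀).symm y := by
  have h := mdifferentiableWithinAt_extChartAt_symm (I := 𝓡 m) hy
  have hr : Set.range (𝓡 m) = Set.univ := by simp
  rwa [hr, mdifferentiableWithinAt_univ] at h

theorem clm_apply_eq_sum {F : Type*} [AddCommGroup F] [Module ℝ F] [TopologicalSpace F]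
    (L : EuclideanSpace ℝ (Fin m) →L[ℝ] F) (w : EuclideanSpace ℝ (Fin m)) :
    L w = ∑ i, w i • L (EuclideanSpace.single i (1 : ℝ)) := by
  have hw : w = ∑ i, w i • EuclideanSpace.single i (1 : ℝ) := by
    ext j; simp [Pi.single_apply]
  conv_lhs => rw [hw]
  simp only [map_sum, map_smul]

theorem mfderiv_chart_comp {x₀ : M} {y : EuclideanSpace ℝ (Fin m)}
    (hy : y ∈ (extChartAt (𝓡 m) x₀).target) (w : EuclideanSpace ℝ (Fin m)) :
    mfderiv (𝓡 m) 𝓘(ℝ, EuclideanSpace ℝ (Fin m)) (extChartAt (𝓡 m) x₀)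
      ((extChartAt (𝓡 m) x₀).symm y)
      (mfderiv 𝓘(ℝ, EuclideanSpace ℝ (Fin m)) (𝓡 m) (extChartAt (𝓡 m) x₀).symm y w) = w := by
  have h := mfderiv_extChartAt_comp_mfderivWithin_extChartAt_symm (I := 𝓡 m) hy
  have hr : Set.range (𝓡 m) = Set.univ := by simp
  rw [hr, mfderivWithin_univ] at h
  exact congrArg (fun L => L w) h

theorem mfderiv_chart_symm_comp {x₀ : M} {y : EuclideanSpace ℝ (Fin m)}
    (hy : y ∈ (extChartAt (𝓡 m) x₀).target)
    (v : TangentSpace (𝓡 m) ((extChartAt (𝓡 m) x₀).symm y)) :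
    mfderiv 𝓘(ℝ, EuclideanSpace ℝ (Fin m)) (𝓡 m) (extChartAt (𝓡 m) x₀).symm y
      (mfderiv (𝓡 m) 𝓘(ℝ, EuclideanSpace ℝ (Fin m)) (extChartAt (𝓡 m) x₀)
      ((extChartAt (𝓡 m) x₀).symm y) v) = v := by
  have h := mfderivWithin_extChartAt_symm_comp_mfderiv_extChartAt (I := 𝓡 m) hy
  have hr : Set.range (𝓡 m) = Set.univ := by simp
  rw [hr, mfderivWithin_univ] at h
  exact congrArg (fun L => L v) h

theorem coords_coordVec {x₀ : M} {y : EuclideanSpace ℝ (Fin m)}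
    (hy : y ∈ (extChartAt (𝓡 m) x₀).target) (i : Fin m) :
    coords x₀ ((extChartAt (𝓡 m) x₀).symm y) (coordVec x₀ i y) = EuclideanSpace.single i 1 :=
  mfderiv_chart_comp hy _

theorem sum_coords_coordVec {x₀ : M} {y : EuclideanSpace ℝ (Fin m)}
    (hy : y ∈ (extChartAt (𝓡 m) x₀).target)
    (v : TangentSpace (𝓡 m) ((extChartAt (𝓡 m) x₀).symm y)) :
    v = ∑ i, coords x₀ ((extChartAt (𝓡 m) x₀).symm y) v i • coordVec x₀ i y := by
  conv_lhs => rw [← mfderiv_chart_symm_comp hy v]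
  exact clm_apply_eq_sum (mfderiv 𝓘(ℝ, EuclideanSpace ℝ (Fin m)) (𝓡 m)
    (extChartAt (𝓡 m) x₀).symm y) _

omit [IsManifold (𝓡 m) ∞ M] in
theorem coords_smul (x₀ q : M) (c : ℝ) (v : TangentSpace (𝓡 m) q) :
    coords x₀ q (c • v) = c • coords x₀ q v :=
  map_smul (mfderiv (𝓡 m) 𝓘(ℝ, EuclideanSpace ℝ (Fin m)) (extChartAt (𝓡 m) x₀) q) c v

theorem coords_injective {x₀ q : M} (hq : q ∈ (extChartAt (𝓡 m) x₀).source) :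
    Function.Injective (coords (m := m) x₀ q) := by
  obtain ⟨y, hy, rfl⟩ : ∃ y ∈ (extChartAt (𝓡 m) x₀).target, (extChartAt (𝓡 m) x₀).symm y = q :=
    ⟨_, (extChartAt (𝓡 m) x₀).map_source hq, (extChartAt (𝓡 m) x₀).left_inv hq⟩
  intro v w h
  rw [sum_coords_coordVec hy v, sum_coords_coordVec hy w, h]

theorem coords_surjective {x₀ q : M} (hq : q ∈ (extChartAt (𝓡 m) x₀).source) :
    Function.Surjective (coords (m := m) x₀ q) := by
  obtain ⟨y, hy, rfl⟩ : ∃ y ∈ (extChartAt (𝓡 m) x₀).target, (extChartAt (𝓡 m) x₀).symm y = q :=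
    ⟨_, (extChartAt (𝓡 m) x₀).map_source hq, (extChartAt (𝓡 m) x₀).left_inv hq⟩
  exact fun w => ⟨_, mfderiv_chart_comp hy w⟩

theorem RiemMetric.form_sum_left (h : RiemMetric m M) (q : M) (c : Fin m → ℝ)
    (e : Fin m → TangentSpace (𝓡 m) q) (w : TangentSpace (𝓡 m) q) :
    h.form q (∑ i, c i • e i) w = ∑ i, c i * h.form q (e i) w := by
  simp [RiemMetric.form, map_sum]

theorem RiemMetric.form_symm (h : RiemMetric m M) (q : M) (v w : TangentSpace (𝓡 m) q) :
    h.form q v w = h.form q w v := h.symm q v w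

/-- A metric in terms of its matrix. -/
theorem RiemMetric.form_eq_ip (h : RiemMetric m M) {x₀ q : M}
    (hq : q ∈ (extChartAt (𝓡 m) x₀).source) (v w : TangentSpace (𝓡 m) q) :
    h.form q v w = ip (coordMetric h.form x₀ (extChartAt (𝓡 m) x₀ q))
      (fun i => coords x₀ q v i) (fun i => coords x₀ q w i) := by
  obtain ⟨y, hy, rfl⟩ : ∃ y ∈ (extChartAt (𝓡 m) x₀).target, (extChartAt (𝓡 m) x₀).symm y = q :=
    ⟨_, (extChartAt (𝓡 m) x₀).map_source hq, (extChartAt (𝓡 m) x₀).left_inv hq⟩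
  rw [(extChartAt (𝓡 m) x₀).right_inv hy]
  conv_lhs => rw [sum_coords_coordVec hy v, sum_coords_coordVec hy w]
  rw [h.form_sum_left, ip]
  refine Finset.sum_congr rfl fun i _ => ?_
  rw [h.form_symm, h.form_sum_left, Finset.mul_sum]
  refine Finset.sum_congr rfl fun j _ => ?_
  rw [h.form_symm, coordMetric, Matrix.of_apply]
  ring

/-- This links smoothness of a map into the tangent bundle to smoothness of the components of the
field in a chart. -/
theorem trivializationAt_snd {x₀ q : M} (hq : q ∈ (chartAt (EuclideanSpace ℝ (Fin m)) x₀).source)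
    (v : TangentSpace (𝓡 m) q) :
    (trivializationAt (EuclideanSpace ℝ (Fin m)) (TangentSpace (𝓡 m)) x₀
      (⟨q, v⟩ : TangentBundle (𝓡 m) M)).2 = coords x₀ q v := by
  have h := TangentBundle.continuousLinearMapAt_trivializationAt (I := 𝓡 m) hq
  have h2 := Bundle.Trivialization.continuousLinearMapAt_apply_of_mem (R := ℝ)
    (trivializationAt (EuclideanSpace ℝ (Fin m)) (TangentSpace (𝓡 m)) x₀) hq v
  rw [h] at h2
  exact h2.symm

theorem coordVec_contMDiffOn (x₀ : M) (i : Fin m) :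
    ContMDiffOn 𝓘(ℝ, EuclideanSpace ℝ (Fin m)) (𝓡 m).tangent ∞
      (fun y => (⟨(extChartAt (𝓡 m) x₀).symm y, coordVec x₀ i y⟩ : TangentBundle (𝓡 m) M))
      (extChartAt (𝓡 m) x₀).target := by
  have hmem : ∀ y ∈ (extChartAt (𝓡 m) x₀).target,
      (extChartAt (𝓡 m) x₀).symm y ∈ (chartAt (EuclideanSpace ℝ (Fin m)) x₀).source := by
    intro y hy
    rw [← extChartAt_source (𝓡 m)]
    exact (extChartAt (𝓡 m) x₀).map_target hy
  refine ((trivializationAt (EuclideanSpace ℝ (Fin m)) (TangentSpace (𝓡 m))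
    x₀).contMDiffOn_iff ?_).2 ⟨contMDiffOn_extChartAt_symm x₀, ?_⟩
  · intro y hy
    rw [Bundle.Trivialization.mem_source]
    exact hmem y hy
  · refine ContMDiffOn.congr (contMDiffOn_const (c := EuclideanSpace.single i (1 : ℝ))) ?_
    intro y hy
    rw [trivializationAt_snd (hmem y hy), coords_coordVec hy]

omit [IsManifold (𝓡 m) ∞ M] in
theorem coords_contMDiffOn {φ : M → N} {O : Set M} (W : ∀ p : M, TangentSpace (𝓡 n) (φ p))
    (hW : ContMDiffOn (𝓡 m) (𝓡 n).tangent ∞ (fun p => (⟨φ p, W p⟩ : TangentBundle (𝓡 n) N)) O)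
    (x₀ : N) (hO : ∀ p ∈ O, φ p ∈ (extChartAt (𝓡 n) x₀).source) :
    ContMDiffOn (𝓡 m) 𝓘(ℝ, EuclideanSpace ℝ (Fin n)) ∞ (fun p => coords x₀ (φ p) (W p)) O := by
  have h := ((trivializationAt (EuclideanSpace ℝ (Fin n)) (TangentSpace (𝓡 n))
    x₀).contMDiffOn_iff (f := fun p => (⟨φ p, W p⟩ : TangentBundle (𝓡 n) N)) (s := O)
      (n := ∞) (IM := 𝓡 m) (IB := 𝓡 n) ?_).1 hW
  · refine h.2.congr fun p hp => ?_
    have := hO p hp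
    rw [extChartAt_source] at this
    exact (trivializationAt_snd this (W p)).symm
  · intro p hp
    have := hO p hp
    rw [extChartAt_source] at this
    rw [Bundle.Trivialization.mem_source]
    exact this

theorem RiemMetric.isMetricOn (h : RiemMetric m M) (x₀ : M) :
    IsMetricOn (coordMetric h.form x₀) (extChartAt (𝓡 m) x₀).target where
  isOpen := isOpen_extChartAt_target x₀
  smooth i j := by
    rw [← contMDiffOn_iff_contDiffOn]
    have h1 := coordVec_contMDiffOn x₀ i
    have h2 := coordVec_contMDiffOn x₀ j
    have h0 : ContMDiffOn 𝓘(ℝ, EuclideanSpace ℝ (Fin m)) _ ∞ _ (extChartAt (𝓡 m) x₀).target :=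
      h.contMDiff.comp_contMDiffOn (contMDiffOn_extChartAt_symm (n := ∞) x₀)
    have h3 := ContMDiffOn.clm_bundle_apply₂ (F₁ := EuclideanSpace ℝ (Fin m))
      (F₂ := EuclideanSpace ℝ (Fin m)) (F₃ := ℝ) (E₁ := fun x : M => TangentSpace (𝓡 m) x)
      (E₂ := fun x : M => TangentSpace (𝓡 m) x) (E₃ := Bundle.Trivial M ℝ)
      (b := (extChartAt (𝓡 m) x₀).symm) (ψ := fun y => h.inner ((extChartAt (𝓡 m) x₀).symm y))
      (v := fun y => coordVec x₀ i y) (w := fun y => coordVec x₀ j y) h0 h1 h2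
    intro y hy
    have h4 := h3 y hy
    rw [Bundle.contMDiffWithinAt_totalSpace] at h4
    exact h4.2
  symm z _ i j := h.form_symm _ _ _
  det z hz := by
    -- A vector in the kernel of the matrix would be a nonzero tangent vector of length zero.
    by_contra hd
    have hd0 : (coordMetric h.form x₀ z).det = 0 := by simpa using hd
    obtain ⟨w, hw, h0⟩ := Matrix.exists_mulVec_eq_zero_iff.2 hd0
    obtain ⟨u, hu⟩ := coords_surjective ((extChartAt (𝓡 m) x₀).map_target hz) (WithLp.toLp 2 w)
    have hne : u ≠ 0 := by
      rintro rfl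
      apply hw
      have : coords x₀ ((extChartAt (𝓡 m) x₀).symm z) 0 = 0 :=
        map_zero (mfderiv (𝓡 m) 𝓘(ℝ, EuclideanSpace ℝ (Fin m)) (extChartAt (𝓡 m) x₀) _)
      rw [this] at hu
      ext i
      simpa using (congrArg (fun v : EuclideanSpace ℝ (Fin m) => v i) hu).symm
    have hpos := h.pos _ u hne
    have := h.form_eq_ip ((extChartAt (𝓡 m) x₀).map_target hz) u u
    rw [(extChartAt (𝓡 m) x₀).right_inv hz, hu] at this
    change h.form _ u u = _ at this
    have h2 : ip (coordMetric h.form x₀ z) w w = 0 := by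
      have : ∀ k, ∑ j, coordMetric h.form x₀ z k j * w j = 0 := fun k => congrFun h0 k
      simp only [ip]
      refine Finset.sum_eq_zero fun k _ => ?_
      have h3 : ∑ b, coordMetric h.form x₀ z k b * w k * w b =
          w k * ∑ b, coordMetric h.form x₀ z k b * w b := by
        rw [Finset.mul_sum]
        exact Finset.sum_congr rfl fun _ _ => by ring
      rw [h3, this, mul_zero]
    exact hpos.ne' (this.trans h2)

end Charts

end HopfCyl

end

noncomputable section

namespace HopfCyl

/-! ### Maps, fields and covariant derivatives read in fixed charts -/

section LocalExpressions

variable {m n : ℕ}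
  {M : Type*} [TopologicalSpace M] [ChartedSpace (EuclideanSpace ℝ (Fin m)) M]
  {N : Type*} [TopologicalSpace N] [ChartedSpace (EuclideanSpace ℝ (Fin n)) N]

/-- The set `S` in the chart at `x₀`. -/
def chartSet (m : ℕ) {M : Type*} [TopologicalSpace M]
    [ChartedSpace (EuclideanSpace ℝ (Fin m)) M] (x₀ : M) (S : Set M) :
    Set (EuclideanSpace ℝ (Fin m)) :=
  (extChartAt (𝓡 m) x₀).target ∩ (extChartAt (𝓡 m) x₀).symm ⁻¹' S

/-- The map `φ` in the charts at `p` and `x₀`. -/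
def localMap (p : M) (x₀ : N) (φ : M → N) (y : EuclideanSpace ℝ (Fin m)) :
    EuclideanSpace ℝ (Fin n) :=
  extChartAt (𝓡 n) x₀ (φ ((extChartAt (𝓡 m) p).symm y))

/-- The vector field `W` along `φ` in the charts at `p` and `x₀`. -/
def localField (p : M) (x₀ : N) (φ : M → N) (W : ∀ p : M, TangentSpace (𝓡 n) (φ p))
    (y : EuclideanSpace ℝ (Fin m)) (b : Fin n) : ℝ :=
  coords x₀ (φ ((extChartAt (𝓡 m) p).symm y)) (W ((extChartAt (𝓡 m) p).symm y)) b

theorem isOpen_chartSet (x₀ : M) {S : Set M} (hS : IsOpen S) : IsOpen (chartSet m x₀ S) :=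
  (continuousOn_extChartAt_symm x₀).isOpen_inter_preimage (isOpen_extChartAt_target x₀) hS

theorem mem_chartSet {x₀ q : M} {S : Set M} (hq : q ∈ (extChartAt (𝓡 m) x₀).source)
    (hS : q ∈ S) : extChartAt (𝓡 m) x₀ q ∈ chartSet m x₀ S :=
  ⟨(extChartAt (𝓡 m) x₀).map_source hq, by
    rwa [Set.mem_preimage, (extChartAt (𝓡 m) x₀).left_inv hq]⟩

/-- The vector is typed in the model space, so that it can be read at both points without a
transport along `h`. -/
theorem coords_congr {x₀ q q' : M} (h : q = q') (u : EuclideanSpace ℝ (Fin m)) :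
    coords (m := m) x₀ q u = coords (m := m) x₀ q' u := by
  subst h; rfl

variable [IsManifold (𝓡 m) ∞ M] [IsManifold (𝓡 n) ∞ N]

theorem chart_symm_contMDiffOn (p : M) (S : Set M) :
    ContMDiffOn 𝓘(ℝ, EuclideanSpace ℝ (Fin m)) (𝓡 m) ∞ (extChartAt (𝓡 m) p).symm
      (chartSet m p S) :=
  (contMDiffOn_extChartAt_symm p).mono Set.inter_subset_left

theorem localMap_isMapOn {p : M} {x₀ : N} {φ : M → N} {S : Set M}
    {Ω : Set (EuclideanSpace ℝ (Fin n))} (hφ : ContMDiff (𝓡 m) (𝓡 n) ∞ φ) (hS : IsOpen S)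
    (hsrc : ∀ q ∈ S, φ q ∈ (extChartAt (𝓡 n) x₀).source)
    (hΩ : ∀ q ∈ S, extChartAt (𝓡 n) x₀ (φ q) ∈ Ω) :
    IsMapOn (localMap p x₀ φ) (chartSet m p S) Ω := by
  refine ⟨isOpen_chartSet p hS, ?_, fun y hy => hΩ _ hy.2⟩
  rw [← contDiffOn_euclidean, ← contMDiffOn_iff_contDiffOn]
  refine (contMDiffOn_extChartAt (x := x₀)).comp
    (hφ.comp_contMDiffOn (chart_symm_contMDiffOn p S)) ?_
  intro y hy
  have := hsrc _ hy.2
  rwa [extChartAt_source] at this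

theorem localField_isFieldOn {p : M} {x₀ : N} {φ : M → N}
    {W : ∀ p : M, TangentSpace (𝓡 n) (φ p)} {S : Set M}
    (hW : ContMDiffOn (𝓡 m) (𝓡 n).tangent ∞ (fun p => (⟨φ p, W p⟩ : TangentBundle (𝓡 n) N)) S)
    (hsrc : ∀ q ∈ S, φ q ∈ (extChartAt (𝓡 n) x₀).source) :
    IsFieldOn (localField p x₀ φ W) (chartSet m p S) := by
  have h := (coords_contMDiffOn W hW x₀ hsrc).comp (chart_symm_contMDiffOn p S)
    fun y hy => hy.2
  rw [contMDiffOn_iff_contDiffOn] at h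
  exact contDiffOn_euclidean.1 h

theorem localFun_contDiffOn {u : M → ℝ} (p : M) (S : Set M)
    (hu : ContMDiff (𝓡 m) 𝓘(ℝ, ℝ) ∞ u) :
    ContDiffOn ℝ ∞ (fun y => u ((extChartAt (𝓡 m) p).symm y)) (chartSet m p S) := by
  rw [← contMDiffOn_iff_contDiffOn]
  exact hu.comp_contMDiffOn (chart_symm_contMDiffOn p S)

theorem dmap_eq_fderiv {Φ : EuclideanSpace ℝ (Fin m) → EuclideanSpace ℝ (Fin n)}
    {y : EuclideanSpace ℝ (Fin m)} (hΦ : DifferentiableAt ℝ Φ y) (i : Fin m) (a : Fin n) :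
    dmap Φ i y a = fderiv ℝ Φ y (EuclideanSpace.single i 1) a := by
  have : HasFDerivAt (fun z => Φ z a)
      ((EuclideanSpace.proj a : EuclideanSpace ℝ (Fin n) →L[ℝ] ℝ).comp (fderiv ℝ Φ y)) y :=
    (EuclideanSpace.proj a : EuclideanSpace ℝ (Fin n) →L[ℝ] ℝ).hasFDerivAt.comp y
      hΦ.hasFDerivAt
  simp [dmap, pd, this.fderiv]

theorem coords_mfderiv_coordVec {p : M} {x₀ : N} {φ : M → N} {y : EuclideanSpace ℝ (Fin m)}
    (hy : y ∈ (extChartAt (𝓡 m) p).target)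
    (hφ : MDifferentiableAt (𝓡 m) (𝓡 n) φ ((extChartAt (𝓡 m) p).symm y))
    (hsrc : φ ((extChartAt (𝓡 m) p).symm y) ∈ (extChartAt (𝓡 n) x₀).source) (i : Fin m) :
    (fun a => coords x₀ (φ ((extChartAt (𝓡 m) p).symm y))
      (mfderiv (𝓡 m) (𝓡 n) φ ((extChartAt (𝓡 m) p).symm y) (coordVec p i y)) a) =
      dmap (localMap p x₀ φ) i y := by
  have h1 := mdifferentiableAt_chart_symm hy
  have h2 := hφ.comp y h1
  have h3 := (mdifferentiableAt_chart hsrc).comp y h2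
  have e : fderiv ℝ (localMap p x₀ φ) y = _ :=
    mfderiv_eq_fderiv.symm.trans (mfderiv_comp y (mdifferentiableAt_chart hsrc) h2)
  have e2 := mfderiv_comp y hφ h1
  have hd : DifferentiableAt ℝ (localMap p x₀ φ) y := h3.differentiableAt
  ext a
  rw [dmap_eq_fderiv hd]
  have e3 : fderiv ℝ (localMap p x₀ φ) y (EuclideanSpace.single i 1) =
      coords x₀ (φ ((extChartAt (𝓡 m) p).symm y))
        (mfderiv (𝓡 m) (𝓡 n) φ ((extChartAt (𝓡 m) p).symm y) (coordVec p i y)) :=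
    (DFunLike.congr_fun e _).trans (congrArg (mfderiv (𝓡 n) 𝓘(ℝ, EuclideanSpace ℝ (Fin n))
      (extChartAt (𝓡 n) x₀) (φ ((extChartAt (𝓡 m) p).symm y))) (DFunLike.congr_fun e2 _))
  rw [e3]

theorem coords_mfderiv {p : M} {x₀ : N} {φ : M → N} {y : EuclideanSpace ℝ (Fin m)}
    (hy : y ∈ (extChartAt (𝓡 m) p).target)
    (hφ : MDifferentiableAt (𝓡 m) (𝓡 n) φ ((extChartAt (𝓡 m) p).symm y))
    (hsrc : φ ((extChartAt (𝓡 m) p).symm y) ∈ (extChartAt (𝓡 n) x₀).source)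
    (v : TangentSpace (𝓡 m) ((extChartAt (𝓡 m) p).symm y)) :
    (fun a => coords x₀ (φ ((extChartAt (𝓡 m) p).symm y))
      (mfderiv (𝓡 m) (𝓡 n) φ ((extChartAt (𝓡 m) p).symm y) v) a) =
      ∑ i, coords p ((extChartAt (𝓡 m) p).symm y) v i • dmap (localMap p x₀ φ) i y := by
  have h := (coords_mfderiv_coordVec hy hφ hsrc)
  have key : coords x₀ (φ ((extChartAt (𝓡 m) p).symm y))
      (mfderiv (𝓡 m) (𝓡 n) φ ((extChartAt (𝓡 m) p).symm y) v) =
      ∑ i, coords p ((extChartAt (𝓡 m) p).symm y) v i •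
        coords x₀ (φ ((extChartAt (𝓡 m) p).symm y))
        (mfderiv (𝓡 m) (𝓡 n) φ ((extChartAt (𝓡 m) p).symm y) (coordVec p i y)) := by
    conv_lhs => rw [sum_coords_coordVec hy v]
    simp only [coords, map_sum, map_smul]
    rfl
  ext a
  rw [key]
  simp only [← h]
  simp [Finset.sum_apply]

theorem coords_coordVec_change {x₁ x₀ : M} {z : EuclideanSpace ℝ (Fin m)}
    (hz : z ∈ (extChartAt (𝓡 m) x₁).target)
    (h0 : (extChartAt (𝓡 m) x₁).symm z ∈ (extChartAt (𝓡 m) x₀).source) (i : Fin m) :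
    (fun a => coords x₀ ((extChartAt (𝓡 m) x₁).symm z) (coordVec x₁ i z) a) =
      dmap (localMap x₁ x₀ fun x => x) i z := by
  rw [← coords_mfderiv_coordVec (φ := fun x : M => x) hz mdifferentiableAt_id h0 i]
  have : mfderiv (𝓡 m) (𝓡 m) (fun x : M => x) ((extChartAt (𝓡 m) x₁).symm z) =
    ContinuousLinearMap.id ℝ _ := mfderiv_id
  rw [this]
  rfl

/-- The change of the components of a tangent vector. -/
theorem coords_change {x₁ x₀ r : M} (h1 : r ∈ (extChartAt (𝓡 m) x₁).source)
    (h0 : r ∈ (extChartAt (𝓡 m) x₀).source) (w : TangentSpace (𝓡 m) r) :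
    (fun a => coords x₀ r w a) =
      ∑ b, coords x₁ r w b • dmap (localMap x₁ x₀ fun x => x) b (extChartAt (𝓡 m) x₁ r) := by
  obtain ⟨z, hz, rfl⟩ : ∃ z ∈ (extChartAt (𝓡 m) x₁).target, (extChartAt (𝓡 m) x₁).symm z = r :=
    ⟨_, (extChartAt (𝓡 m) x₁).map_source h1, (extChartAt (𝓡 m) x₁).left_inv h1⟩
  rw [(extChartAt (𝓡 m) x₁).right_inv hz]
  have h := coords_mfderiv (φ := fun x : M => x) hz mdifferentiableAt_id h0 w
  have : mfderiv (𝓡 m) (𝓡 m) (fun x : M => x) ((extChartAt (𝓡 m) x₁).symm z) =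
    ContinuousLinearMap.id ℝ _ := mfderiv_id
  rw [this] at h
  exact h

theorem nabla_congr_map {H : EuclideanSpace ℝ (Fin n) → Matrix (Fin n) (Fin n) ℝ}
    {Φ Φ' : EuclideanSpace ℝ (Fin m) → EuclideanSpace ℝ (Fin n)}
    {W W' : EuclideanSpace ℝ (Fin m) → Fin n → ℝ} {U : Set (EuclideanSpace ℝ (Fin m))}
    {y : EuclideanSpace ℝ (Fin m)} (hU : IsOpen U)
    (hΦ : ∀ y ∈ U, Φ y = Φ' y) (hW : ∀ y ∈ U, W y = W' y) (hy : y ∈ U) (i : Fin m) :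
    nabla H Φ i W y = nabla H Φ' i W' y := by
  rw [nabla_congr hU hW hy]
  ext a
  simp only [nabla, hΦ y hy]
  congr 1
  refine Finset.sum_congr rfl fun b _ => Finset.sum_congr rfl fun c _ => ?_
  rw [pd_congr hU (fun z hz => by rw [hΦ z hz]) hy]

/-- A transition map is an isometry between the two coordinate expressions of the metric; this is
the hypothesis of `nabla_isometry`. -/
theorem coordMetric_change (h : RiemMetric n N) {x₁ x₀ : N} {z : EuclideanSpace ℝ (Fin n)}
    (hz : z ∈ (extChartAt (𝓡 n) x₁).target)
    (h0 : (extChartAt (𝓡 n) x₁).symm z ∈ (extChartAt (𝓡 n) x₀).source) (i j : Fin n) :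
    coordMetric h.form x₁ z i j =
      ip (coordMetric h.form x₀ (localMap (m := n) (n := n) x₁ x₀ (fun x => x) z))
        (dmap (localMap (m := n) (n := n) x₁ x₀ fun x => x) i z)
        (dmap (localMap (m := n) (n := n) x₁ x₀ fun x => x) j z) := by
  rw [← coords_coordVec_change hz h0 i, ← coords_coordVec_change hz h0 j]
  exact h.form_eq_ip h0 _ _

/-- The covariant derivative in arbitrary charts. -/
theorem coords_covDeriv (h : RiemMetric n N) {φ : M → N} (hφ : ContMDiff (𝓡 m) (𝓡 n) ∞ φ)
    {O : Set M} (hO : IsOpen O) {W : ∀ p : M, TangentSpace (𝓡 n) (φ p)}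
    (hW : ContMDiffOn (𝓡 m) (𝓡 n).tangent ∞ (fun p => (⟨φ p, W p⟩ : TangentBundle (𝓡 n) N)) O)
    {p₀ q : M} {x₀ : N} (hqO : q ∈ O) (hq : q ∈ (extChartAt (𝓡 m) p₀).source)
    (hφq : φ q ∈ (extChartAt (𝓡 n) x₀).source) (v : TangentSpace (𝓡 m) q) :
    (fun a => coords x₀ (φ q) (covDeriv h.form φ W q v) a) =
      ∑ i, coords p₀ q v i • nabla (coordMetric h.form x₀) (localMap p₀ x₀ φ) i
        (localField p₀ x₀ φ W) (extChartAt (𝓡 m) p₀ q) := by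
  -- `covDeriv` at `q` is computed in the charts at `q` and `φ q`. On the neighbourhood where all
  -- charts make sense, the change of target chart is an isometry ψ and the change of source chart a
  -- substitution θ.
  set S : Set M := O ∩ ((extChartAt (𝓡 m) q).source ∩
    φ ⁻¹' ((extChartAt (𝓡 n) (φ q)).source ∩ (extChartAt (𝓡 n) x₀).source)) with hSdef
  have hS : IsOpen S := hO.inter ((isOpen_extChartAt_source q).inter
    (((isOpen_extChartAt_source (φ q)).inter (isOpen_extChartAt_source x₀)).preimage
      hφ.continuous))
  have hqS : q ∈ S := ⟨hqO, mem_extChartAt_source q, mem_extChartAt_source (φ q), hφq⟩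
  set T : Set N := (extChartAt (𝓡 n) (φ q)).source ∩ (extChartAt (𝓡 n) x₀).source with hTdef
  have hT : IsOpen T := (isOpen_extChartAt_source (φ q)).inter (isOpen_extChartAt_source x₀)
  set ψ := localMap (m := n) (n := n) (φ q) x₀ (fun x : N => x) with hψdef
  have hψ : IsMapOn ψ (chartSet n (φ q) T) (extChartAt (𝓡 n) x₀).target :=
    localMap_isMapOn contMDiff_id hT (fun r hr => hr.2)
      fun r hr => (extChartAt (𝓡 n) x₀).map_source hr.2
  have hΦ : IsMapOn (localMap q (φ q) φ) (chartSet m q S) (chartSet n (φ q) T) :=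
    localMap_isMapOn hφ hS (fun r hr => hr.2.2.1) fun r hr => mem_chartSet hr.2.2.1 hr.2.2
  have hθ : IsMapOn (localMap (m := m) (n := m) p₀ q fun x => x) (chartSet m p₀ S) (chartSet m q S) :=
    localMap_isMapOn contMDiff_id hS (fun r hr => hr.2.1) fun r hr => mem_chartSet hr.2.1 hr
  have hF : IsFieldOn (localField q (φ q) φ W) (chartSet m q S) :=
    localField_isFieldOn (hW.mono Set.inter_subset_left) fun r hr => hr.2.2.1
  have hH0 := h.isMetricOn x₀
  have hH1 : IsMetricOn (coordMetric h.form (φ q)) (chartSet n (φ q) T) := by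
    have := h.isMetricOn (φ q)
    exact ⟨isOpen_chartSet _ hT, fun i j => (this.smooth i j).mono Set.inter_subset_left,
      fun z hz => this.symm z hz.1, fun z hz => this.det z hz.1⟩
  have hG : ∀ z ∈ chartSet n (φ q) T, ∀ i j, coordMetric h.form (φ q) z i j =
      ip (coordMetric h.form x₀ (ψ z)) (dmap ψ i z) (dmap ψ j z) := fun z hz i j =>
    coordMetric_change h hz.1 hz.2.2 i j
  have hy0 : extChartAt (𝓡 m) p₀ q ∈ chartSet m p₀ S := mem_chartSet hq hqS
  have hy1 : extChartAt (𝓡 m) q q ∈ chartSet m q S := mem_chartSet (mem_extChartAt_source q) hqS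
  have hθy : localMap (m := m) (n := m) p₀ q (fun x => x) (extChartAt (𝓡 m) p₀ q) = extChartAt (𝓡 m) q q := by
    rw [localMap, (extChartAt (𝓡 m) p₀).left_inv hq]
  have hΦy : localMap q (φ q) φ (extChartAt (𝓡 m) q q) = extChartAt (𝓡 n) (φ q) (φ q) := by
    rw [localMap, (extChartAt (𝓡 m) q).left_inv (mem_extChartAt_source q)]
  have hinv : ∀ y ∈ chartSet m p₀ S, (extChartAt (𝓡 m) q).symm
      (localMap (m := m) (n := m) p₀ q (fun x => x) y) = (extChartAt (𝓡 m) p₀).symm y := fun y hy =>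
    (extChartAt (𝓡 m) q).left_inv hy.2.2.1
  have hmapEq : ∀ y ∈ chartSet m p₀ S, localMap p₀ x₀ φ y =
      ψ (localMap q (φ q) φ (localMap (m := m) (n := m) p₀ q (fun x => x) y)) := by
    intro y hy
    have h1 : localMap q (φ q) φ (localMap (m := m) (n := m) p₀ q (fun x => x) y) =
        extChartAt (𝓡 n) (φ q) (φ ((extChartAt (𝓡 m) p₀).symm y)) := by
      rw [localMap, hinv y hy]
    rw [h1, hψdef, localMap, localMap, (extChartAt (𝓡 n) (φ q)).left_inv hy.2.2.2.1]
  have hfieldEq : ∀ y ∈ chartSet m p₀ S, localField p₀ x₀ φ W y =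
      pushAlong ψ (localMap q (φ q) φ) (localField q (φ q) φ W)
        (localMap (m := m) (n := m) p₀ q (fun x => x) y) := by
    intro y hy
    have h1 : localMap q (φ q) φ (localMap (m := m) (n := m) p₀ q (fun x => x) y) =
        extChartAt (𝓡 n) (φ q) (φ ((extChartAt (𝓡 m) p₀).symm y)) := by
      rw [localMap, hinv y hy]
    have h2 : ∀ b, localField q (φ q) φ W (localMap (m := m) (n := m) p₀ q (fun x => x) y) b =
        coords (φ q) (φ ((extChartAt (𝓡 m) p₀).symm y)) (W ((extChartAt (𝓡 m) p₀).symm y)) b :=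
      fun b => congrArg (fun r => coords (φ q) (φ r) (W r) b) (hinv y hy)
    rw [pushAlong, h1]
    simp only [h2]
    exact coords_change hy.2.2.2.1 hy.2.2.2.2 _
  have hsurj : ∀ t : Fin n → ℝ, ∃ c : Fin n → ℝ,
      t = ∑ b, c b • dmap ψ b (localMap q (φ q) φ (extChartAt (𝓡 m) q q)) := by
    intro t
    obtain ⟨u, hu⟩ := coords_surjective hφq (WithLp.toLp 2 t)
    refine ⟨fun b => coords (φ q) (φ q) u b, ?_⟩
    rw [hΦy, ← coords_change (mem_extChartAt_source (φ q)) hφq u, hu]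
  -- The map and the field in the charts `p₀`, `x₀` come from those in the charts `q`, `φ q` by
  -- composing with θ and pushing by ψ; `nabla_comp_source` and `nabla_isometry` handle the two
  -- changes.
  have hnab : ∀ i, nabla (coordMetric h.form x₀) (localMap p₀ x₀ φ) i (localField p₀ x₀ φ W)
      (extChartAt (𝓡 m) p₀ q) = ∑ j, dmap (localMap (m := m) (n := m) p₀ q fun x => x) i (extChartAt (𝓡 m) p₀ q) j •
        pushAlong ψ (localMap q (φ q) φ) (nabla (coordMetric h.form (φ q)) (localMap q (φ q) φ) j
          (localField q (φ q) φ W)) (extChartAt (𝓡 m) q q) := by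
    intro i
    rw [nabla_congr_map hθ.isOpen hmapEq hfieldEq hy0,
      nabla_comp_source (hψ.comp hΦ) hθ (pushAlong_field hψ hΦ hF) hy0]
    refine Finset.sum_congr rfl fun j _ => ?_
    rw [hθy, nabla_isometry hH0 hH1 hψ hΦ hG hF hy1 hsurj]
  have hv : (fun j => coords q q v j) = _ :=
    coords_change (x₁ := p₀) hq (mem_extChartAt_source q) v
  set c : Fin n → ℝ := fun a => ∑ i, coords q q v i * nabla (coordMetric h.form (φ q))
    (localMap q (φ q) φ) i (localField q (φ q) φ W) (extChartAt (𝓡 m) q q) a with hc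
  have hcov : covDeriv h.form φ W q v = ofCoords (φ q) c := rfl
  have hzt : extChartAt (𝓡 n) (φ q) (φ q) ∈ (extChartAt (𝓡 n) (φ q)).target :=
    mem_extChartAt_target (φ q)
  have hz0 : (extChartAt (𝓡 n) (φ q)).symm (extChartAt (𝓡 n) (φ q) (φ q)) ∈
      (extChartAt (𝓡 n) x₀).source := by rwa [extChartAt_to_inv]
  have hL : (fun a => coords x₀ (φ q) (ofCoords (φ q) c) a) =
      ∑ b, c b • dmap ψ b (extChartAt (𝓡 n) (φ q) (φ q)) := by
    have e1 : coords x₀ (φ q) (ofCoords (φ q) c) =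
        coords (m := n) x₀ ((extChartAt (𝓡 n) (φ q)).symm (extChartAt (𝓡 n) (φ q) (φ q)))
          (ofCoords (φ q) c : EuclideanSpace ℝ (Fin n)) :=
      coords_congr (extChartAt_to_inv (φ q)).symm _
    have e2 : ofCoords (φ q) c = ∑ b, c b • (coordVec (m := n) (φ q) b
        (extChartAt (𝓡 n) (φ q) (φ q)) : EuclideanSpace ℝ (Fin n)) :=
      clm_apply_eq_sum (mfderiv 𝓘(ℝ, EuclideanSpace ℝ (Fin n)) (𝓡 n) (extChartAt (𝓡 n) (φ q)).symm
        (extChartAt (𝓡 n) (φ q) (φ q))) (WithLp.toLp 2 c)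
    have e3 : coords x₀ (φ q) (ofCoords (φ q) c) = ∑ b, c b •
        coords (m := n) x₀ ((extChartAt (𝓡 n) (φ q)).symm (extChartAt (𝓡 n) (φ q) (φ q)))
          (coordVec (m := n) (φ q) b (extChartAt (𝓡 n) (φ q) (φ q))) := by
      rw [e1, e2]
      exact (map_sum (mfderiv (𝓡 n) 𝓘(ℝ, EuclideanSpace ℝ (Fin n)) (extChartAt (𝓡 n) x₀)
        ((extChartAt (𝓡 n) (φ q)).symm (extChartAt (𝓡 n) (φ q) (φ q)))) _ _).trans
        (Finset.sum_congr rfl fun b _ => map_smul _ _ _)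
    ext a
    rw [e3]
    simp only [hψdef, ← coords_coordVec_change hzt hz0]
    simp [Finset.sum_apply]
  rw [hcov, hL]
  simp only [hnab]
  have hv' : ∀ j, coords q q v j = ∑ i, coords p₀ q v i *
      dmap (localMap (m := m) (n := m) p₀ q fun x => x) i (extChartAt (𝓡 m) p₀ q) j := fun j => by
    have := congrFun hv j
    simpa [Finset.sum_apply] using this
  simp only [pushAlong, hc, hΦy, Finset.smul_sum, Finset.sum_smul, smul_smul, hv', Finset.sum_mul]
  rw [Finset.sum_comm_cycle]
  refine Finset.sum_congr rfl fun i _ => ?_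
  rw [Finset.sum_comm]
  exact Finset.sum_congr rfl fun j _ => Finset.sum_congr rfl fun b _ => by rw [mul_assoc]

end LocalExpressions

end HopfCyl

end

noncomputable section

namespace HopfCyl

/-! ### Pointwise geometry of Riemannian submersions and Hopf cylinders -/

section Submersion

variable {N : Type*} [TopologicalSpace N] [ChartedSpace (EuclideanSpace ℝ (Fin 3)) N]
  [IsManifold (𝓡 3) ∞ N]
  {B : Type*} [TopologicalSpace B] [ChartedSpace (EuclideanSpace ℝ (Fin 2)) B]
  [IsManifold (𝓡 2) ∞ B]
  {h : RiemMetric 3 N} {h₁ : RiemMetric 2 B} {π : N → B}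

theorem RiemMetric.form_add_left {n : ℕ} {M : Type*} [TopologicalSpace M]
    [ChartedSpace (EuclideanSpace ℝ (Fin n)) M] [IsManifold (𝓡 n) ∞ M] (g : RiemMetric n M)
    (q : M) (u v w : TangentSpace (𝓡 n) q) :
    g.form q (u + v) w = g.form q u w + g.form q v w := by
  simp [RiemMetric.form]

theorem RiemMetric.form_add_right {n : ℕ} {M : Type*} [TopologicalSpace M]
    [ChartedSpace (EuclideanSpace ℝ (Fin n)) M] [IsManifold (𝓡 n) ∞ M] (g : RiemMetric n M)
    (q : M) (u v w : TangentSpace (𝓡 n) q) :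
    g.form q u (v + w) = g.form q u v + g.form q u w := by
  simp [RiemMetric.form]

theorem RiemMetric.form_smul_left {n : ℕ} {M : Type*} [TopologicalSpace M]
    [ChartedSpace (EuclideanSpace ℝ (Fin n)) M] [IsManifold (𝓡 n) ∞ M] (g : RiemMetric n M)
    (q : M) (c : ℝ) (v w : TangentSpace (𝓡 n) q) :
    g.form q (c • v) w = c * g.form q v w := by
  simp [RiemMetric.form]

theorem RiemMetric.form_smul_right {n : ℕ} {M : Type*} [TopologicalSpace M]
    [ChartedSpace (EuclideanSpace ℝ (Fin n)) M] [IsManifold (𝓡 n) ∞ M] (g : RiemMetric n M)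
    (q : M) (c : ℝ) (v w : TangentSpace (𝓡 n) q) :
    g.form q v (c • w) = c * g.form q v w := by
  simp [RiemMetric.form]

theorem finrank_ker_mfderiv (hπ : IsRiemannianSubmersion h.form h₁.form π) (r : N) :
    Module.finrank ℝ (LinearMap.ker (mfderiv (𝓡 3) (𝓡 2) π r).toLinearMap) = 1 := by
  have : FiniteDimensional ℝ (TangentSpace (𝓡 3) r) :=
    inferInstanceAs (FiniteDimensional ℝ (EuclideanSpace ℝ (Fin 3)))
  have h1 := LinearMap.finrank_range_add_finrank_ker (mfderiv (𝓡 3) (𝓡 2) π r).toLinearMap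
  rw [LinearMap.range_eq_top.2 (hπ.submersion r), finrank_top] at h1
  have e1 : Module.finrank ℝ (TangentSpace (𝓡 2) (π r)) = 2 :=
    finrank_euclideanSpace_fin (𝕜 := ℝ) (n := 2)
  have e2 : Module.finrank ℝ (TangentSpace (𝓡 3) r) = 3 :=
    finrank_euclideanSpace_fin (𝕜 := ℝ) (n := 3)
  omega

/-- The vertical spaces are lines. -/
theorem exists_smul_of_vertical (hπ : IsRiemannianSubmersion h.form h₁.form π) {r : N}
    {e u : TangentSpace (𝓡 3) r} (he : mfderiv (𝓡 3) (𝓡 2) π r e = 0) (he0 : e ≠ 0)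
    (hu : mfderiv (𝓡 3) (𝓡 2) π r u = 0) : ∃ c : ℝ, u = c • e := by
  have h1 := finrank_ker_mfderiv hπ r
  obtain ⟨c, hc⟩ := (finrank_eq_one_iff_of_nonzero'
    (⟨e, he⟩ : LinearMap.ker (mfderiv (𝓡 3) (𝓡 2) π r).toLinearMap)
    (fun h0 => he0 (congrArg Subtype.val h0))).1 h1 ⟨u, hu⟩
  exact ⟨c, (congrArg Subtype.val hc).symm⟩

/-- The splitting of a tangent vector in a horizontal and a vertical one. -/
theorem exists_horizontal_add_vertical (hπ : IsRiemannianSubmersion h.form h₁.form π) {r : N}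
    (w : TangentSpace (𝓡 3) r) : ∃ a e : TangentSpace (𝓡 3) r, w = a + e ∧
      mfderiv (𝓡 3) (𝓡 2) π r e = 0 ∧
      ∀ u : TangentSpace (𝓡 3) r, mfderiv (𝓡 3) (𝓡 2) π r u = 0 → h.form r a u = 0 := by
  have : FiniteDimensional ℝ (TangentSpace (𝓡 3) r) :=
    inferInstanceAs (FiniteDimensional ℝ (EuclideanSpace ℝ (Fin 3)))
  have hpos : 0 < Module.finrank ℝ (LinearMap.ker (mfderiv (𝓡 3) (𝓡 2) π r).toLinearMap) := by
    rw [finrank_ker_mfderiv hπ r]; exact one_pos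
  obtain ⟨⟨e, he⟩, he0⟩ := (Module.finrank_pos_iff_exists_ne_zero (R := ℝ)).1 hpos
  have he0 : e ≠ 0 := fun h0 => he0 (Subtype.ext h0)
  have hee : 0 < h.form r e e := h.pos r e he0
  refine ⟨w - (h.form r w e / h.form r e e) • e, (h.form r w e / h.form r e e) • e, by abel, ?_, ?_⟩
  · rw [map_smul]
    exact (congrArg _ he).trans (smul_zero _)
  · intro u hu
    obtain ⟨c, rfl⟩ := exists_smul_of_vertical hπ he he0 hu
    rw [sub_eq_add_neg, ← neg_smul, h.form_add_left, h.form_smul_left, h.form_smul_right,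
      h.form_smul_right]
    field_simp
    ring

/-- One horizontal argument is enough: the vertical part of the other is killed by dπ on the left
and by orthogonality on the right. It makes horizontal vectors null for the defect. -/
theorem form_mfderiv_of_horizontal (hπ : IsRiemannianSubmersion h.form h₁.form π) {r : N}
    {a : TangentSpace (𝓡 3) r}
    (ha : ∀ u : TangentSpace (𝓡 3) r, mfderiv (𝓡 3) (𝓡 2) π r u = 0 → h.form r a u = 0)
    (t : TangentSpace (𝓡 3) r) :
    h₁.form (π r) (mfderiv (𝓡 3) (𝓡 2) π r a) (mfderiv (𝓡 3) (𝓡 2) π r t) = h.form r a t := by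
  obtain ⟨b, e, rfl, he, hb⟩ := exists_horizontal_add_vertical hπ t
  rw [map_add, he, add_zero, h.form_add_right, ha e he, add_zero, hπ.isometric r a b ha hb]

/-- The difference is the squared length of the vertical part. This supplies the non-negativity of
the defect. -/
theorem form_mfderiv_le (hπ : IsRiemannianSubmersion h.form h₁.form π) {r : N}
    (t : TangentSpace (𝓡 3) r) :
    h₁.form (π r) (mfderiv (𝓡 3) (𝓡 2) π r t) (mfderiv (𝓡 3) (𝓡 2) π r t) ≤ h.form r t t := by
  obtain ⟨b, e, rfl, he, hb⟩ := exists_horizontal_add_vertical hπ t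
  have hee : 0 ≤ h.form r e e := by
    by_cases h0 : e = 0
    · simp [h0, RiemMetric.form]
    · exact (h.pos r e h0).le
  rw [map_add, he, add_zero, hπ.isometric r b b hb hb, h.form_add_left, h.form_add_right,
    h.form_add_right, hb e he, h.form_symm r e b, hb e he]
  linarith

end Submersion

/-! ### The adapted frame and the arclength function on a Hopf cylinder -/

section Cylinder

variable {N : Type*} [TopologicalSpace N] [ChartedSpace (EuclideanSpace ℝ (Fin 3)) N]
  [IsManifold (𝓡 3) ∞ N]
  {B : Type*} [TopologicalSpace B] [ChartedSpace (EuclideanSpace ℝ (Fin 2)) B]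
  [IsManifold (𝓡 2) ∞ B]
  {S : Type*} [TopologicalSpace S] [ChartedSpace (EuclideanSpace ℝ (Fin 2)) S]
  [IsManifold (𝓡 2) ∞ S]
  {h : RiemMetric 3 N} {h₁ : RiemMetric 2 B} {π : N → B} {J : Set ℝ} {γ : ℝ → B} {s : S → ℝ}
  {φ : S → N} {X V : ∀ p : S, TangentSpace (𝓡 2) p} {ξ : ∀ p : S, TangentSpace (𝓡 3) (φ p)}

theorem IsHopfCylinder.mem (hS : IsHopfCylinder π J γ s φ) (p : S) :
    s p ∈ J ∧ π (φ p) = γ (s p) := by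
  have : (s p, φ p) ∈ Set.range (fun p : S => (s p, φ p)) := ⟨p, rfl⟩
  rwa [hS.range_eq] at this

theorem IsAdaptedFrame.dφV_ne_zero (F : IsAdaptedFrame h.form π γ s φ X V ξ) (p : S) :
    mfderiv (𝓡 2) (𝓡 3) φ p (V p) ≠ 0 := by
  intro h0
  have := F.unit_V p
  rw [h0] at this
  simp [RiemMetric.form] at this

/-- The vertical line is spanned by dφ(V), which is tangent to the cylinder and hence orthogonal to
ξ. -/
theorem IsAdaptedFrame.ξ_horizontal (F : IsAdaptedFrame h.form π γ s φ X V ξ)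
    (hπ : IsRiemannianSubmersion h.form h₁.form π) (p : S) (u : TangentSpace (𝓡 3) (φ p))
    (hu : mfderiv (𝓡 3) (𝓡 2) π (φ p) u = 0) : h.form (φ p) (ξ p) u = 0 := by
  obtain ⟨c, rfl⟩ := exists_smul_of_vertical hπ (F.vertical p) (F.dφV_ne_zero p) hu
  rw [h.form_smul_right, F.normal, mul_zero]

theorem RiemMetric.form_congr {n : ℕ} {M : Type*} [TopologicalSpace M]
    [ChartedSpace (EuclideanSpace ℝ (Fin n)) M] [IsManifold (𝓡 n) ∞ M] (g : RiemMetric n M)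
    {q q' : M} (hq : q = q') (v w : EuclideanSpace ℝ (Fin n)) :
    g.form q v w = g.form q' v w := by
  subst hq; rfl

theorem IsAdaptedFrame.unit_X (F : IsAdaptedFrame h.form π γ s φ X V ξ)
    (hπ : IsRiemannianSubmersion h.form h₁.form π) (hγ : IsArclengthCurve h₁.form J γ)
    (hS : IsHopfCylinder π J γ s φ) (p : S) :
    h.form (φ p) (mfderiv (𝓡 2) (𝓡 3) φ p (X p)) (mfderiv (𝓡 2) (𝓡 3) φ p (X p)) = 1 := by
  rw [← hπ.isometric _ _ _ (F.horizontal p) (F.horizontal p), ← hγ.unit _ (hS.mem p).1]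
  have e := F.lift p
  refine (h₁.form_congr (hS.mem p).2 _ _).trans ?_
  exact congrArg (fun w : EuclideanSpace ℝ (Fin 2) => h₁.form (γ (s p)) w w) e

omit [IsManifold (𝓡 2) ∞ B] in
theorem mfderiv_congr_apply {F G : S → B} (hFG : F = G) (p : S) (v : TangentSpace (𝓡 2) p) :
    (mfderiv (𝓡 2) (𝓡 2) F p v : EuclideanSpace ℝ (Fin 2)) = mfderiv (𝓡 2) (𝓡 2) G p v := by
  subst hFG; rfl

/-- The derivative of a function in the direction of a tangent vector. -/
def fnDeriv {m : ℕ} {M : Type*} [TopologicalSpace M] [ChartedSpace (EuclideanSpace ℝ (Fin m)) M]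
    (u : M → ℝ) (p : M) (v : TangentSpace (𝓡 m) p) : ℝ :=
  mfderiv (𝓡 m) 𝓘(ℝ, ℝ) u p v

/-- `dπ(dφ(v)) = ds(v) γ'`. -/
theorem IsHopfCylinder.mfderiv_comp (hS : IsHopfCylinder π J γ s φ)
    (hπ : IsRiemannianSubmersion h.form h₁.form π) (hγ : IsArclengthCurve h₁.form J γ) (p : S)
    (v : TangentSpace (𝓡 2) p) :
    (mfderiv (𝓡 3) (𝓡 2) π (φ p) (mfderiv (𝓡 2) (𝓡 3) φ p v) : EuclideanSpace ℝ (Fin 2)) =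
      fnDeriv s p v • velocity γ (s p) := by
  have e : π ∘ φ = γ ∘ s := funext fun q => (hS.mem q).2
  have h1 := _root_.mfderiv_comp p ((hπ.smooth (φ p)).mdifferentiableAt (by simp))
    ((hS.smooth_φ p).mdifferentiableAt (by simp))
  have hγd : MDifferentiableAt 𝓘(ℝ, ℝ) (𝓡 2) γ (s p) :=
    ((hγ.smooth (s p) (hS.mem p).1).contMDiffAt (hγ.isOpen.mem_nhds (hS.mem p).1)).mdifferentiableAt
      (by simp)
  have h2 := _root_.mfderiv_comp p hγd ((hS.smooth_s p).mdifferentiableAt (by simp))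
  have h3 := mfderiv_congr_apply e p v
  have h4 : (mfderiv (𝓡 2) (𝓡 2) (γ ∘ s) p v : EuclideanSpace ℝ (Fin 2)) =
      mfderiv 𝓘(ℝ, ℝ) (𝓡 2) γ (s p) (mfderiv (𝓡 2) 𝓘(ℝ, ℝ) s p v) := DFunLike.congr_fun h2 v
  have h5 : (mfderiv (𝓡 2) (𝓡 2) (π ∘ φ) p v : EuclideanSpace ℝ (Fin 2)) =
      mfderiv (𝓡 3) (𝓡 2) π (φ p) (mfderiv (𝓡 2) (𝓡 3) φ p v) := DFunLike.congr_fun h1 v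
  rw [← h5, h3, h4]
  have h6 : fnDeriv s p v = fnDeriv s p v • (1 : ℝ) := by simp
  exact (congrArg (mfderiv 𝓘(ℝ, ℝ) (𝓡 2) γ (s p)) h6).trans
    (map_smul (mfderiv 𝓘(ℝ, ℝ) (𝓡 2) γ (s p)) (fnDeriv s p v) (1 : ℝ))

theorem IsArclengthCurve.velocity_ne_zero (hγ : IsArclengthCurve h₁.form J γ) {t : ℝ} (ht : t ∈ J) :
    velocity γ t ≠ 0 := by
  intro h0
  have := hγ.unit t ht
  rw [h0] at this
  simp [RiemMetric.form] at this

/-- Compare dπ(dφ(X)) = γ' with dπ(dφ(X)) = ds(X)γ' and use γ' ≠ 0. -/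
theorem IsAdaptedFrame.dirDeriv_X_s (F : IsAdaptedFrame h.form π γ s φ X V ξ)
    (hπ : IsRiemannianSubmersion h.form h₁.form π) (hγ : IsArclengthCurve h₁.form J γ)
    (hS : IsHopfCylinder π J γ s φ) (p : S) : dirDeriv X s p = 1 := by
  have h1 := hS.mfderiv_comp hπ hγ p (X p)
  rw [F.lift p] at h1
  have h2 : (dirDeriv X s p - 1) • velocity γ (s p) = 0 := by
    rw [sub_smul, one_smul, sub_eq_zero]
    exact h1.symm
  rcases smul_eq_zero.1 h2 with h3 | h3
  · linarith
  · exact absurd h3 (hγ.velocity_ne_zero (hS.mem p).1)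

theorem IsAdaptedFrame.dirDeriv_V_s (F : IsAdaptedFrame h.form π γ s φ X V ξ)
    (hπ : IsRiemannianSubmersion h.form h₁.form π) (hγ : IsArclengthCurve h₁.form J γ)
    (hS : IsHopfCylinder π J γ s φ) (p : S) : dirDeriv V s p = 0 := by
  have h1 := hS.mfderiv_comp hπ hγ p (V p)
  rw [F.vertical p] at h1
  rcases smul_eq_zero.1 h1.symm with h3 | h3
  · exact h3
  · exact absurd h3 (hγ.velocity_ne_zero (hS.mem p).1)

/-- If ds(u) = 0 then dφ(u) is vertical, hence a multiple of dφ(V), and dφ is injective. It is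
applied to the bracket of X and V. -/
theorem IsAdaptedFrame.exists_smul_V (F : IsAdaptedFrame h.form π γ s φ X V ξ)
    (hπ : IsRiemannianSubmersion h.form h₁.form π) (hγ : IsArclengthCurve h₁.form J γ)
    (hS : IsHopfCylinder π J γ s φ) {p : S} {u : TangentSpace (𝓡 2) p}
    (hu : fnDeriv s p u = 0) : ∃ c : ℝ, u = c • V p := by
  have h1 := hS.mfderiv_comp hπ hγ p u
  rw [hu, zero_smul] at h1
  obtain ⟨c, hc⟩ := exists_smul_of_vertical hπ (F.vertical p) (F.dφV_ne_zero p) h1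
  refine ⟨c, hS.immersion p ?_⟩
  rw [hc, map_smul]

theorem contMDiff_mfderiv {φ : S → N} (hφ : ContMDiff (𝓡 2) (𝓡 3) ∞ φ)
    {X : ∀ p : S, TangentSpace (𝓡 2) p}
    (hX : ContMDiff (𝓡 2) (𝓡 2).tangent ∞ (fun p => (⟨p, X p⟩ : TangentBundle (𝓡 2) S))) :
    ContMDiff (𝓡 2) (𝓡 3).tangent ∞
      (fun p => (⟨φ p, mfderiv (𝓡 2) (𝓡 3) φ p (X p)⟩ : TangentBundle (𝓡 3) N)) :=
  (hφ.contMDiff_tangentMap (m := ∞) (by simp)).comp hX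

end Cylinder

end HopfCyl

end

noncomputable section

namespace HopfCyl

/-! ### Tangent fields, derivatives of functions and smoothness in a chart -/

section LocalFrame

variable {m n : ℕ}
  {M : Type*} [TopologicalSpace M] [ChartedSpace (EuclideanSpace ℝ (Fin m)) M]
  [IsManifold (𝓡 m) ∞ M]
  {N : Type*} [TopologicalSpace N] [ChartedSpace (EuclideanSpace ℝ (Fin n)) N]
  [IsManifold (𝓡 n) ∞ N]

theorem localField_mfderiv {p : M} {x₀ : N} {φ : M → N} {y : EuclideanSpace ℝ (Fin m)}
    (hy : y ∈ (extChartAt (𝓡 m) p).target) (hφ : ContMDiff (𝓡 m) (𝓡 n) ∞ φ)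
    (hsrc : φ ((extChartAt (𝓡 m) p).symm y) ∈ (extChartAt (𝓡 n) x₀).source)
    (X : ∀ q : M, TangentSpace (𝓡 m) q) :
    localField p x₀ φ (fun q => mfderiv (𝓡 m) (𝓡 n) φ q (X q)) y =
      push (localMap p x₀ φ) (localField (m := m) (n := m) p p (fun q => q) X) y :=
  coords_mfderiv hy ((hφ _).mdifferentiableAt (by simp)) hsrc _

theorem RiemMetric.form_localField (h : RiemMetric n N) {p : M} {x₀ : N} {φ : M → N}
    {y : EuclideanSpace ℝ (Fin m)}
    (hsrc : φ ((extChartAt (𝓡 m) p).symm y) ∈ (extChartAt (𝓡 n) x₀).source)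
    (W Z : ∀ q : M, TangentSpace (𝓡 n) (φ q)) :
    h.form (φ ((extChartAt (𝓡 m) p).symm y)) (W ((extChartAt (𝓡 m) p).symm y))
      (Z ((extChartAt (𝓡 m) p).symm y)) =
      ip (coordMetric h.form x₀ (localMap p x₀ φ y)) (localField p x₀ φ W y)
        (localField p x₀ φ Z y) :=
  h.form_eq_ip hsrc _ _

theorem localField_covDeriv (h : RiemMetric n N) {φ : M → N}
    (hφ : ContMDiff (𝓡 m) (𝓡 n) ∞ φ) {O : Set M} (hO : IsOpen O)
    {W : ∀ q : M, TangentSpace (𝓡 n) (φ q)}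
    (hW : ContMDiffOn (𝓡 m) (𝓡 n).tangent ∞ (fun q => (⟨φ q, W q⟩ : TangentBundle (𝓡 n) N)) O)
    {p : M} {x₀ : N} {y : EuclideanSpace ℝ (Fin m)} (hy : y ∈ chartSet m p O)
    (hsrc : φ ((extChartAt (𝓡 m) p).symm y) ∈ (extChartAt (𝓡 n) x₀).source)
    (X : ∀ q : M, TangentSpace (𝓡 m) q) :
    localField p x₀ φ (fun q => covDeriv h.form φ W q (X q)) y =
      covD (coordMetric h.form x₀) (localMap p x₀ φ)
        (localField (m := m) (n := m) p p (fun q => q) X) (localField p x₀ φ W) y := by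
  have := coords_covDeriv h hφ hO hW hy.2 ((extChartAt (𝓡 m) p).map_target hy.1) hsrc
    (X ((extChartAt (𝓡 m) p).symm y))
  rw [(extChartAt (𝓡 m) p).right_inv hy.1] at this
  exact this

theorem fnDeriv_eq_sum_of_mem {u : M → ℝ} {p q : M} (hq : q ∈ (extChartAt (𝓡 m) p).source)
    (hu : DifferentiableAt ℝ (fun z => u ((extChartAt (𝓡 m) p).symm z)) (extChartAt (𝓡 m) p q))
    (v : TangentSpace (𝓡 m) q) :
    fnDeriv u q v = ∑ i, coords p q v i *
      pd i (fun z => u ((extChartAt (𝓡 m) p).symm z)) (extChartAt (𝓡 m) p q) := by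
  have heq : u =ᶠ[nhds q] (fun z => u ((extChartAt (𝓡 m) p).symm z)) ∘ extChartAt (𝓡 m) p := by
    filter_upwards [(isOpen_extChartAt_source p).mem_nhds hq] with r hr
    simp only [Function.comp, (extChartAt (𝓡 m) p).left_inv hr]
  have h2 : mfderiv (𝓡 m) 𝓘(ℝ, ℝ) ((fun z => u ((extChartAt (𝓡 m) p).symm z)) ∘
      extChartAt (𝓡 m) p) q = _ := mfderiv_comp q hu.mdifferentiableAt (mdifferentiableAt_chart hq)
  have h3 : fnDeriv u q v = fderiv ℝ (fun z => u ((extChartAt (𝓡 m) p).symm z))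
      (extChartAt (𝓡 m) p q) (coords p q v) := by
    have h4 : fnDeriv u q v = mfderiv (𝓡 m) 𝓘(ℝ, ℝ)
        ((fun z => u ((extChartAt (𝓡 m) p).symm z)) ∘ extChartAt (𝓡 m) p) q v := by
      rw [fnDeriv, heq.mfderiv_eq]
      rfl
    rw [h4, ← mfderiv_eq_fderiv]
    exact DFunLike.congr_fun h2 v
  rw [h3, clm_apply_eq_sum]
  rfl

theorem fnDeriv_eq_sum {u : M → ℝ} {p : M} {y : EuclideanSpace ℝ (Fin m)}
    (hy : y ∈ (extChartAt (𝓡 m) p).target)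
    (hu : DifferentiableAt ℝ (fun z => u ((extChartAt (𝓡 m) p).symm z)) y)
    (v : TangentSpace (𝓡 m) ((extChartAt (𝓡 m) p).symm y)) :
    fnDeriv u ((extChartAt (𝓡 m) p).symm y) v =
      ∑ i, coords p ((extChartAt (𝓡 m) p).symm y) v i *
        pd i (fun z => u ((extChartAt (𝓡 m) p).symm z)) y := by
  have hyq := (extChartAt (𝓡 m) p).right_inv hy
  have := fnDeriv_eq_sum_of_mem ((extChartAt (𝓡 m) p).map_target hy) (by rwa [hyq]) v
  rwa [hyq] at this

theorem dirDeriv_eq_dd {S : Type*} [TopologicalSpace S] [ChartedSpace (EuclideanSpace ℝ (Fin 2)) S]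
    [IsManifold (𝓡 2) ∞ S] {u : S → ℝ} {p : S} {y : EuclideanSpace ℝ (Fin 2)}
    (hy : y ∈ (extChartAt (𝓡 2) p).target)
    (hu : DifferentiableAt ℝ (fun z => u ((extChartAt (𝓡 2) p).symm z)) y)
    (X : ∀ q : S, TangentSpace (𝓡 2) q) :
    dirDeriv X u ((extChartAt (𝓡 2) p).symm y) =
      dd (localField (m := 2) (n := 2) p p (fun q => q) X)
        (fun z => u ((extChartAt (𝓡 2) p).symm z)) y :=
  fnDeriv_eq_sum hy hu _

theorem coords_mfderiv_of_mem {p r : M} {x₀ : N} {φ : M → N}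
    (hr : r ∈ (extChartAt (𝓡 m) p).source) (hφ : MDifferentiableAt (𝓡 m) (𝓡 n) φ r)
    (hsrc : φ r ∈ (extChartAt (𝓡 n) x₀).source) (v : TangentSpace (𝓡 m) r) :
    (fun a => coords x₀ (φ r) (mfderiv (𝓡 m) (𝓡 n) φ r v) a) =
      ∑ i, coords p r v i • dmap (localMap p x₀ φ) i (extChartAt (𝓡 m) p r) := by
  obtain ⟨y, hy, rfl⟩ : ∃ y ∈ (extChartAt (𝓡 m) p).target, (extChartAt (𝓡 m) p).symm y = r :=
    ⟨_, (extChartAt (𝓡 m) p).map_source hr, (extChartAt (𝓡 m) p).left_inv hr⟩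
  rw [(extChartAt (𝓡 m) p).right_inv hy]
  exact coords_mfderiv hy hφ hsrc v

/-- A field along a map is smooth if its components are. -/
theorem contMDiffOn_of_coords {φ : M → N} {O : Set M} {W : ∀ p : M, TangentSpace (𝓡 n) (φ p)}
    {x₀ : N} (hφ : ContMDiffOn (𝓡 m) (𝓡 n) ∞ φ O)
    (hO : ∀ p ∈ O, φ p ∈ (extChartAt (𝓡 n) x₀).source)
    (hW : ContMDiffOn (𝓡 m) 𝓘(ℝ, EuclideanSpace ℝ (Fin n)) ∞ (fun p => coords x₀ (φ p) (W p)) O) :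
    ContMDiffOn (𝓡 m) (𝓡 n).tangent ∞ (fun p => (⟨φ p, W p⟩ : TangentBundle (𝓡 n) N)) O := by
  have hO' : ∀ p ∈ O, φ p ∈ (chartAt (EuclideanSpace ℝ (Fin n)) x₀).source := fun p hp => by
    have := hO p hp
    rwa [extChartAt_source] at this
  refine ((trivializationAt (EuclideanSpace ℝ (Fin n)) (TangentSpace (𝓡 n))
    x₀).contMDiffOn_iff ?_).2 ⟨hφ, ?_⟩
  · intro p hp
    rw [Bundle.Trivialization.mem_source]
    exact hO' p hp
  · exact hW.congr fun p hp => trivializationAt_snd (hO' p hp) (W p)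

end LocalFrame

/-! ### An explicit vertical field of a submersion from three to two dimensions -/

section VerticalField

variable {P : EuclideanSpace ℝ (Fin 3) → EuclideanSpace ℝ (Fin 2)}

/-- A field spanning the kernel of the differential of a submersion `ℝ³ → ℝ²`. -/
def verticalField (P : EuclideanSpace ℝ (Fin 3) → EuclideanSpace ℝ (Fin 2))
    (z : EuclideanSpace ℝ (Fin 3)) : Fin 3 → ℝ :=
  crossProduct (fun j => dmap P j z 0) (fun j => dmap P j z 1)

theorem diffAt_verticalField (z : EuclideanSpace ℝ (Fin 3)) :
    diffAt P z (verticalField P z) = 0 := by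
  ext a
  simp only [diffAt, Finset.sum_apply, Pi.smul_apply, smul_eq_mul, Pi.zero_apply]
  fin_cases a
  · have := dot_self_cross (fun j => dmap P j z 0) (fun j => dmap P j z 1)
    simpa [dotProduct, verticalField, mul_comm] using this
  · have := dot_cross_self (fun j => dmap P j z 0) (fun j => dmap P j z 1)
    simpa [dotProduct, verticalField, mul_comm] using this

theorem verticalField_ne_zero {z : EuclideanSpace ℝ (Fin 3)}
    (hP : Function.Surjective (diffAt P z)) : verticalField P z ≠ 0 := by
  rw [verticalField, crossProduct_ne_zero_iff_linearIndependent, LinearIndependent.pair_iff]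
  intro α β h
  -- A linear relation between the rows of the differential annihilates its image, which is
  -- everything.
  have key : ∀ t : Fin 2 → ℝ, α * t 0 + β * t 1 = 0 := by
    intro t
    obtain ⟨w, rfl⟩ := hP t
    have h' : ∀ j, α * dmap P j z 0 + β * dmap P j z 1 = 0 := fun j => congrFun h j
    simp only [diffAt, Finset.sum_apply, Pi.smul_apply, smul_eq_mul, Finset.mul_sum,
      ← Finset.sum_add_distrib]
    refine Finset.sum_eq_zero fun j _ => ?_
    linear_combination w j * h' j
  have h1 := key ![1, 0]
  have h2 := key ![0, 1]
  simp at h1 h2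
  exact ⟨h1, h2⟩

theorem verticalField_isFieldOn {Ω : Set (EuclideanSpace ℝ (Fin 3))}
    {Ω' : Set (EuclideanSpace ℝ (Fin 2))} (hP : IsMapOn P Ω Ω') :
    IsFieldOn (verticalField P) Ω := by
  have h := fun j => hP.dmap_field j
  intro a
  simp only [verticalField, cross_apply]
  fin_cases a
  · exact ((h 1 0).mul (h 2 1)).sub ((h 2 0).mul (h 1 1))
  · exact ((h 2 0).mul (h 0 1)).sub ((h 0 0).mul (h 2 1))
  · exact ((h 0 0).mul (h 1 1)).sub ((h 1 0).mul (h 0 1))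

end VerticalField

end HopfCyl

end

noncomputable section

namespace HopfCyl

/-! ### Unit fields proportional to a given field -/

section UnitFields

variable {m n : ℕ} {H : EuclideanSpace ℝ (Fin n) → Matrix (Fin n) (Fin n) ℝ}
  {Φ : EuclideanSpace ℝ (Fin m) → EuclideanSpace ℝ (Fin n)}
  {v : EuclideanSpace ℝ (Fin m) → Fin m → ℝ}
  {U : Set (EuclideanSpace ℝ (Fin m))} {Ω : Set (EuclideanSpace ℝ (Fin n))}
  {y : EuclideanSpace ℝ (Fin m)}

theorem ip_covD_of_unit {x : EuclideanSpace ℝ (Fin m) → Fin m → ℝ} (hH : IsMetricOn H Ω)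
    (hΦ : IsMapOn Φ U Ω) {W : EuclideanSpace ℝ (Fin m) → Fin n → ℝ} (hW : IsFieldOn W U)
    (hunit : ∀ z ∈ U, ip (H (Φ z)) (W z) (W z) = 1) (hy : y ∈ U) :
    ip (H (Φ y)) (covD H Φ x W y) (W y) = 0 := by
  have h1 := dd_ip (x := x) hH hΦ hW hW hy
  rw [dd_eq_zero hΦ.isOpen hunit hy,
    ip_comm (hH.symm _ (hΦ.mapsTo hy)) (W y) (covD H Φ x W y)] at h1
  linarith

/-- A unit field which is proportional to a field whose covariant derivative stays proportional is
parallel. -/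
theorem covD_eq_zero_of_proportional (hH : IsMetricOn H Ω) (hΦ : IsMapOn Φ U Ω)
    (hv : IsFieldOn v U) {w : EuclideanSpace ℝ (Fin n) → Fin n → ℝ} (hw : IsFieldOn w Ω)
    (hunit : ∀ z ∈ U, ip (H (Φ z)) (push Φ v z) (push Φ v z) = 1)
    (hprop : ∀ z ∈ U, ∃ c : ℝ, w (Φ z) = c • push Φ v z) (hy : y ∈ U) (hne : w (Φ y) ≠ 0)
    (hcov : ∃ c : ℝ, ∑ i, push Φ v y i • nabla H (fun z => z) i w (Φ y) = c • push Φ v y) :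
    covD H Φ v (push Φ v) y = 0 := by
  have hV := push_field hΦ hv
  have hwΦ : IsFieldOn (fun z => w (Φ z)) U := fun a => comp_contDiffOn (hw a) hΦ.smooth hΦ.mapsTo
  -- The factor of proportionality is written as an inner product with the unit field, which shows
  -- that it is smooth.
  set μ : EuclideanSpace ℝ (Fin m) → ℝ := fun z => ip (H (Φ z)) (w (Φ z)) (push Φ v z) with hμ
  have hμs : ContDiffOn ℝ ∞ μ U := ip_contDiffOn hH hΦ hwΦ hV
  have hμe : ∀ z ∈ U, w (Φ z) = μ z • push Φ v z := by
    intro z hz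
    obtain ⟨c, hc⟩ := hprop z hz
    simp only [hμ]
    rw [hc, ip_smul_left, hunit z hz, mul_one]
  have hμ0 : μ y ≠ 0 := by
    intro h0
    apply hne
    rw [hμe y hy, h0, zero_smul]
  obtain ⟨c, hc⟩ := hcov
  have h1 : covD H Φ v (fun z => w (Φ z)) y = c • push Φ v y := by
    rw [← hc]
    have h2 : ∀ j, nabla H Φ j (fun z => w (Φ z)) y =
        ∑ i, dmap Φ j y i • nabla H (fun z => z) i w (Φ y) := fun j =>
      nabla_comp_source hH.isMapOn_id hΦ hw hy j
    simp only [covD, h2, push, Finset.sum_apply, Finset.smul_sum, Finset.sum_smul, smul_smul,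
      Pi.smul_apply, smul_eq_mul]
    exact Finset.sum_comm
  rw [covD_congr hΦ.isOpen hμe hy, covD_smul hΦ.isOpen hV hμs hy] at h1
  -- The left side is orthogonal to the unit field and the right side is a multiple of it, so both
  -- vanish; μ is nonzero at `y`.
  have h3 : μ y • covD H Φ v (push Φ v) y = (c - dd v μ y) • push Φ v y := by
    rw [sub_smul, ← h1]
    abel
  have h4 : c - dd v μ y = 0 := by
    have := congrArg (fun t => ip (H (Φ y)) t (push Φ v y)) h3
    simpa only [ip_smul_left, ip_covD_of_unit hH hΦ hV hunit hy, hunit y hy, mul_zero, mul_one]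
      using this.symm
  rw [h4, zero_smul] at h3
  exact (smul_eq_zero.1 h3).resolve_left hμ0

end UnitFields

/-! ### Coordinate neighbourhoods adapted to the submersion and the cylinder -/

section Neighbourhood

variable {N : Type*} [TopologicalSpace N] [ChartedSpace (EuclideanSpace ℝ (Fin 3)) N]
  [IsManifold (𝓡 3) ∞ N]
  {B : Type*} [TopologicalSpace B] [ChartedSpace (EuclideanSpace ℝ (Fin 2)) B]
  [IsManifold (𝓡 2) ∞ B]
  {h : RiemMetric 3 N} {h₁ : RiemMetric 2 B} {π : N → B}

/-- A neighbourhood of `r₀` in the domain of a chart, whose image under `π` lies in the domain of a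
chart. -/
def nbhd (π : N → B) (r₀ : N) : Set N :=
  (extChartAt (𝓡 3) r₀).source ∩ π ⁻¹' (extChartAt (𝓡 2) (π r₀)).source

theorem isOpen_nbhd (hπ : Continuous π) (r₀ : N) : IsOpen (nbhd π r₀) :=
  (isOpen_extChartAt_source r₀).inter ((isOpen_extChartAt_source (π r₀)).preimage hπ)

theorem mem_nbhd (r₀ : N) : r₀ ∈ nbhd π r₀ :=
  ⟨mem_extChartAt_source r₀, mem_extChartAt_source (π r₀)⟩

theorem isMetricOn_nbhd (h : RiemMetric 3 N) (hπ : Continuous π) (r₀ : N) :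
    IsMetricOn (coordMetric h.form r₀) (chartSet 3 r₀ (nbhd π r₀)) := by
  have h0 := h.isMetricOn r₀
  exact ⟨isOpen_chartSet r₀ (isOpen_nbhd hπ r₀),
    fun i j => (h0.smooth i j).mono Set.inter_subset_left,
    fun z hz => h0.symm z hz.1, fun z hz => h0.det z hz.1⟩

theorem isMapOn_nbhd (hπ : ContMDiff (𝓡 3) (𝓡 2) ∞ π) (r₀ : N) :
    IsMapOn (localMap r₀ (π r₀) π) (chartSet 3 r₀ (nbhd π r₀)) (extChartAt (𝓡 2) (π r₀)).target :=
  localMap_isMapOn hπ (isOpen_nbhd hπ.continuous r₀) (fun _ hr => hr.2)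
    fun _ hr => (extChartAt (𝓡 2) (π r₀)).map_source hr.2

theorem diffAt_coords (hπ : ContMDiff (𝓡 3) (𝓡 2) ∞ π) {r₀ r : N} (hr : r ∈ nbhd π r₀)
    (w : TangentSpace (𝓡 3) r) :
    diffAt (localMap r₀ (π r₀) π) (extChartAt (𝓡 3) r₀ r) (fun a => coords r₀ r w a) =
      fun a => coords (π r₀) (π r) (mfderiv (𝓡 3) (𝓡 2) π r w) a :=
  (coords_mfderiv_of_mem hr.1 ((hπ r).mdifferentiableAt (by simp)) hr.2 w).symm

theorem ip_defect_coords (hπ : ContMDiff (𝓡 3) (𝓡 2) ∞ π) {r₀ r : N} (hr : r ∈ nbhd π r₀)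
    (a t : TangentSpace (𝓡 3) r) :
    ip (defect (coordMetric h.form r₀) (coordMetric h₁.form (π r₀)) (localMap r₀ (π r₀) π)
        (extChartAt (𝓡 3) r₀ r)) (fun i => coords r₀ r a i) (fun i => coords r₀ r t i) =
      h.form r a t -
        h₁.form (π r) (mfderiv (𝓡 3) (𝓡 2) π r a) (mfderiv (𝓡 3) (𝓡 2) π r t) := by
  rw [ip_defect, diffAt_coords hπ hr, diffAt_coords hπ hr, h.form_eq_ip hr.1,
    h₁.form_eq_ip hr.2, localMap, (extChartAt (𝓡 3) r₀).left_inv hr.1]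

theorem exists_coords_eq {n : ℕ} {M : Type*} [TopologicalSpace M]
    [ChartedSpace (EuclideanSpace ℝ (Fin n)) M] [IsManifold (𝓡 n) ∞ M] {x₀ q : M}
    (hq : q ∈ (extChartAt (𝓡 n) x₀).source) (t : Fin n → ℝ) :
    ∃ u : TangentSpace (𝓡 n) q, (fun i => coords x₀ q u i) = t := by
  obtain ⟨u, hu⟩ := coords_surjective hq (WithLp.toLp 2 t)
  exact ⟨u, by rw [hu]⟩

theorem eq_of_coords_eq {n : ℕ} {M : Type*} [TopologicalSpace M]
    [ChartedSpace (EuclideanSpace ℝ (Fin n)) M] [IsManifold (𝓡 n) ∞ M] {x₀ q : M}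
    (hq : q ∈ (extChartAt (𝓡 n) x₀).source) {u w : TangentSpace (𝓡 n) q}
    (huw : (fun i => coords x₀ q u i) = fun i => coords x₀ q w i) : u = w :=
  coords_injective hq (by ext i; exact congrFun huw i)

theorem diffAt_surjective (hπ : IsRiemannianSubmersion h.form h₁.form π) {r₀ r : N}
    (hr : r ∈ nbhd π r₀) :
    Function.Surjective (diffAt (localMap r₀ (π r₀) π) (extChartAt (𝓡 3) r₀ r)) := by
  intro t
  obtain ⟨u, hu⟩ := exists_coords_eq hr.2 t
  obtain ⟨w, rfl⟩ := hπ.submersion r u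
  exact ⟨_, (diffAt_coords hπ.smooth hr w).trans hu⟩

variable {J : Set ℝ} {γ : ℝ → B}
  {S : Type*} [TopologicalSpace S] [ChartedSpace (EuclideanSpace ℝ (Fin 2)) S]
  [IsManifold (𝓡 2) ∞ S] {s : S → ℝ}
  {φ : S → N} {X V : ∀ p : S, TangentSpace (𝓡 2) p} {ξ : ∀ p : S, TangentSpace (𝓡 3) (φ p)}

/-- The coordinate neighbourhood of `p` in which the Hopf cylinder is studied. -/
def cylSet (π : N → B) (φ : S → N) (p : S) : Set (EuclideanSpace ℝ (Fin 2)) :=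
  chartSet 2 p (φ ⁻¹' nbhd π (φ p))

theorem isMapOn_cylSet (hπ : Continuous π) (hφ : ContMDiff (𝓡 2) (𝓡 3) ∞ φ) (p : S) :
    IsMapOn (localMap p (φ p) φ) (cylSet π φ p) (chartSet 3 (φ p) (nbhd π (φ p))) :=
  localMap_isMapOn hφ ((isOpen_nbhd hπ _).preimage hφ.continuous) (fun _ hq => hq.1)
    fun _ hq => mem_chartSet hq.1 hq

theorem isFieldOn_cylSet {W : ∀ q : S, TangentSpace (𝓡 3) (φ q)}
    (hW : ContMDiff (𝓡 2) (𝓡 3).tangent ∞ (fun q => (⟨φ q, W q⟩ : TangentBundle (𝓡 3) N)))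
    (p : S) : IsFieldOn (localField p (φ p) φ W) (cylSet π φ p) :=
  localField_isFieldOn hW.contMDiffOn fun _ hq => hq.1

theorem isFieldOn_cylSet_of_tangent {X : ∀ q : S, TangentSpace (𝓡 2) q}
    (hX : ContMDiff (𝓡 2) (𝓡 2).tangent ∞ (fun q => (⟨q, X q⟩ : TangentBundle (𝓡 2) S)))
    (p : S) : IsFieldOn (localField (m := 2) (n := 2) p p (fun q => q) X) (cylSet π φ p) := by
  have h1 := localField_isFieldOn (p := p) (x₀ := p) (φ := fun q : S => q) (W := X)
    (S := (extChartAt (𝓡 2) p).source) hX.contMDiffOn fun _ hq => hq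
  intro a
  exact (h1 a).mono fun y hy => ⟨hy.1, (extChartAt (𝓡 2) p).map_target hy.1⟩

end Neighbourhood

end HopfCyl

end

noncomputable section

namespace HopfCyl

/-! ### From the adapted frame on the manifold to its coordinate data -/

section AdaptedFrame

variable {N : Type*} [TopologicalSpace N] [ChartedSpace (EuclideanSpace ℝ (Fin 3)) N]
  [IsManifold (𝓡 3) ∞ N]
  {B : Type*} [TopologicalSpace B] [ChartedSpace (EuclideanSpace ℝ (Fin 2)) B]
  [IsManifold (𝓡 2) ∞ B]
  {S : Type*} [TopologicalSpace S] [ChartedSpace (EuclideanSpace ℝ (Fin 2)) S]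
  [IsManifold (𝓡 2) ∞ S]
  {h : RiemMetric 3 N} {h₁ : RiemMetric 2 B} {π : N → B} {J : Set ℝ} {γ : ℝ → B} {s : S → ℝ}
  {φ : S → N} {X V : ∀ p : S, TangentSpace (𝓡 2) p} {ξ : ∀ p : S, TangentSpace (𝓡 3) (φ p)}

theorem localMap_cylSet {p : S} {y : EuclideanSpace ℝ (Fin 2)} :
    localMap p (φ p) φ y = extChartAt (𝓡 3) (φ p) (φ ((extChartAt (𝓡 2) p).symm y)) := rfl

theorem push_eq_coords (hφ : ContMDiff (𝓡 2) (𝓡 3) ∞ φ) {p : S} {y : EuclideanSpace ℝ (Fin 2)}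
    (hy : y ∈ cylSet π φ p) (X : ∀ q : S, TangentSpace (𝓡 2) q) :
    push (localMap p (φ p) φ) (localField (m := 2) (n := 2) p p (fun q => q) X) y =
      localField p (φ p) φ (fun q => mfderiv (𝓡 2) (𝓡 3) φ q (X q)) y :=
  (localField_mfderiv hy.1 hφ hy.2.1 X).symm

/-- A smooth vertical field near a point of `N`. -/
theorem exists_verticalField (hπ : IsRiemannianSubmersion h.form h₁.form π) (r₀ : N) :
    ∃ W : ∀ r : N, TangentSpace (𝓡 3) r,
      ContMDiffOn (𝓡 3) (𝓡 3).tangent ∞ (fun r => (⟨r, W r⟩ : TangentBundle (𝓡 3) N))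
        (nbhd π r₀) ∧
      (∀ r ∈ nbhd π r₀, mfderiv (𝓡 3) (𝓡 2) π r (W r) = 0) ∧
      ∀ r ∈ nbhd π r₀, (fun a => coords r₀ r (W r) a) =
        verticalField (localMap r₀ (π r₀) π) (extChartAt (𝓡 3) r₀ r) := by
  -- The field must be defined on all of `N`; off the neighbourhood its value 0 is arbitrary.
  have hex : ∀ r : N, ∃ u : TangentSpace (𝓡 3) r, r ∈ nbhd π r₀ → coords r₀ r u =
      WithLp.toLp 2 (verticalField (localMap r₀ (π r₀) π) (extChartAt (𝓡 3) r₀ r)) := by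
    intro r
    by_cases hr : r ∈ nbhd π r₀
    · obtain ⟨u, hu⟩ := coords_surjective hr.1
        (WithLp.toLp 2 (verticalField (localMap r₀ (π r₀) π) (extChartAt (𝓡 3) r₀ r)))
      exact ⟨u, fun _ => hu⟩
    · exact ⟨0, fun h => absurd h hr⟩
  choose W hW using hex
  have hW' : ∀ r ∈ nbhd π r₀, (fun a => coords r₀ r (W r) a) =
      verticalField (localMap r₀ (π r₀) π) (extChartAt (𝓡 3) r₀ r) := fun r hr => by
    rw [hW r hr]
  refine ⟨W, contMDiffOn_of_coords (φ := fun r : N => r) contMDiffOn_id (fun r hr => hr.1) ?_,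
    fun r hr => ?_, hW'⟩
  · have h1 : ContDiffOn ℝ ∞ (fun z => (WithLp.toLp 2 (verticalField (localMap r₀ (π r₀) π) z) :
        EuclideanSpace ℝ (Fin 3))) (chartSet 3 r₀ (nbhd π r₀)) :=
      contDiffOn_euclidean.2 fun a => verticalField_isFieldOn (isMapOn_nbhd hπ.smooth r₀) a
    have h2 : ContMDiffOn (𝓡 3) 𝓘(ℝ, EuclideanSpace ℝ (Fin 3)) ∞ (extChartAt (𝓡 3) r₀)
        (nbhd π r₀) := (contMDiffOn_extChartAt (x := r₀)).mono fun r hr => by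
      have := hr.1
      rwa [extChartAt_source] at this
    exact (h1.contMDiffOn.comp h2 fun r hr => mem_chartSet hr.1 hr).congr fun r hr => hW r hr
  · refine eq_of_coords_eq hr.2 ?_
    rw [← diffAt_coords hπ.smooth hr, hW' r hr, diffAt_verticalField]
    ext a
    exact (congrArg (fun t : EuclideanSpace ℝ (Fin 2) => t a) (map_zero (mfderiv (𝓡 2)
      𝓘(ℝ, EuclideanSpace ℝ (Fin 2)) (extChartAt (𝓡 2) (π r₀)) (π r)))).symm

theorem coords_smul_fun {n : ℕ} {M : Type*} [TopologicalSpace M]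
    [ChartedSpace (EuclideanSpace ℝ (Fin n)) M] [IsManifold (𝓡 n) ∞ M] (x₀ q : M) (c : ℝ)
    (v : TangentSpace (𝓡 n) q) :
    (fun a => coords x₀ q (c • v) a) = c • fun a => coords x₀ q v a := by
  rw [coords_smul]
  rfl

theorem IsAdaptedFrame.push_unit_V (F : IsAdaptedFrame h.form π γ s φ X V ξ)
    (hφ : ContMDiff (𝓡 2) (𝓡 3) ∞ φ) {p : S} {y : EuclideanSpace ℝ (Fin 2)}
    (hy : y ∈ cylSet π φ p) :
    ip (coordMetric h.form (φ p) (localMap p (φ p) φ y))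
      (push (localMap p (φ p) φ) (localField (m := 2) (n := 2) p p (fun q => q) V) y)
      (push (localMap p (φ p) φ) (localField (m := 2) (n := 2) p p (fun q => q) V) y) = 1 := by
  rw [push_eq_coords hφ hy, ← h.form_localField hy.2.1, F.unit_V]

/-- The fibres are geodesics. -/
theorem IsAdaptedFrame.covD_V_V (F : IsAdaptedFrame h.form π γ s φ X V ξ)
    (hπ : IsRiemannianSubmersion h.form h₁.form π)
    (hfib : HasTotallyGeodesicFibres (m := 2) h.form π) (hφ : ContMDiff (𝓡 2) (𝓡 3) ∞ φ)
    {p : S} {y : EuclideanSpace ℝ (Fin 2)} (hy : y ∈ cylSet π φ p) :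
    covD (coordMetric h.form (φ p)) (localMap p (φ p) φ)
      (localField (m := 2) (n := 2) p p (fun q => q) V)
      (push (localMap p (φ p) φ) (localField (m := 2) (n := 2) p p (fun q => q) V)) y = 0 := by
  -- Totally geodesic fibres are formulated with fields on open subsets of `N`, whereas V exists
  -- only along the cylinder. A nonvanishing vertical `W` is proportional to V there, so ∇_V W being
  -- vertical yields ∇_V V = 0.
  obtain ⟨W, hW, hWv, hWc⟩ := exists_verticalField hπ (φ p)
  have hc := hπ.smooth.continuous
  refine covD_eq_zero_of_proportional (isMetricOn_nbhd h hc (φ p)) (isMapOn_cylSet hc hφ p)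
    (isFieldOn_cylSet_of_tangent F.smooth_V p) (verticalField_isFieldOn (isMapOn_nbhd hπ.smooth _))
    (fun z hz => F.push_unit_V hφ hz) ?_ hy ?_ ?_
  · intro z hz
    obtain ⟨c, hc⟩ := exists_smul_of_vertical hπ (F.vertical ((extChartAt (𝓡 2) p).symm z))
      (F.dφV_ne_zero _) (hWv _ hz.2)
    refine ⟨c, ?_⟩
    rw [push_eq_coords hφ hz, localMap_cylSet, ← hWc _ hz.2, hc, coords_smul_fun]
    rfl
  · exact verticalField_ne_zero (diffAt_surjective hπ hy.2)
  · have hu := F.vertical ((extChartAt (𝓡 2) p).symm y)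
    have h1 := hfib (nbhd π (φ p)) W (isOpen_nbhd hc _) hW hWv _ hy.2 _ hu
    obtain ⟨c, hc'⟩ := exists_smul_of_vertical hπ hu (F.dφV_ne_zero _) h1
    refine ⟨c, ?_⟩
    have h2 := coords_covDeriv h (φ := fun r : N => r) contMDiff_id (isOpen_nbhd hc (φ p)) hW hy.2
      hy.2.1 hy.2.1 (mfderiv (𝓡 2) (𝓡 3) φ ((extChartAt (𝓡 2) p).symm y)
        (V ((extChartAt (𝓡 2) p).symm y)))
    rw [hc', coords_smul_fun] at h2
    have h3 : ∀ i, nabla (coordMetric h.form (φ p))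
        (localMap (m := 3) (n := 3) (φ p) (φ p) fun r : N => r) i
        (localField (m := 3) (n := 3) (φ p) (φ p) (fun r : N => r) W) (localMap p (φ p) φ y) =
        nabla (coordMetric h.form (φ p)) (fun z => z) i
          (verticalField (localMap (φ p) (π (φ p)) π)) (localMap p (φ p) φ y) := by
      intro i
      refine nabla_congr_map (isOpen_chartSet (φ p) (isOpen_nbhd hc (φ p)))
        (fun z hz => (extChartAt (𝓡 3) (φ p)).right_inv hz.1) (fun z hz => ?_)
        (mem_chartSet hy.2.1 hy.2) i
      refine (hWc _ hz.2).trans ?_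
      rw [(extChartAt (𝓡 3) (φ p)).right_inv hz.1]
    simp only [← h3, push_eq_coords hφ hy]
    exact h2.symm

theorem dd_eq_fnDeriv {u : S → ℝ} {p : S} {y : EuclideanSpace ℝ (Fin 2)}
    (hy : y ∈ (extChartAt (𝓡 2) p).target)
    (hu : DifferentiableAt ℝ (fun z => u ((extChartAt (𝓡 2) p).symm z)) y)
    {b : EuclideanSpace ℝ (Fin 2) → Fin 2 → ℝ}
    {v : TangentSpace (𝓡 2) ((extChartAt (𝓡 2) p).symm y)}
    (hb : (fun i => coords p ((extChartAt (𝓡 2) p).symm y) v i) = b y) :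
    dd b (fun z => u ((extChartAt (𝓡 2) p).symm z)) y =
      fnDeriv u ((extChartAt (𝓡 2) p).symm y) v := by
  rw [fnDeriv_eq_sum hy hu, dd, ← hb]

theorem isOpen_cylSet (hπ : Continuous π) (hφ : Continuous φ) (p : S) : IsOpen (cylSet π φ p) :=
  isOpen_chartSet p ((isOpen_nbhd hπ _).preimage hφ)

/-- The adapted fields commute. -/
theorem IsAdaptedFrame.brk_eq_zero (F : IsAdaptedFrame h.form π γ s φ X V ξ)
    (hπ : IsRiemannianSubmersion h.form h₁.form π)
    (hfib : HasTotallyGeodesicFibres (m := 2) h.form π) (hγ : IsArclengthCurve h₁.form J γ)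
    (hS : IsHopfCylinder π J γ s φ) {p : S} {y : EuclideanSpace ℝ (Fin 2)}
    (hy : y ∈ cylSet π φ p) :
    brk (localField (m := 2) (n := 2) p p (fun q => q) X)
      (localField (m := 2) (n := 2) p p (fun q => q) V) y = 0 := by
  have hφ := hS.smooth_φ
  have hc := hπ.smooth.continuous
  set x := localField (m := 2) (n := 2) p p (fun q => q) X with hx
  set v := localField (m := 2) (n := 2) p p (fun q => q) V with hv
  set U := cylSet π φ p
  have hU : IsOpen U := isOpen_cylSet hc hφ.continuous p
  have hH := isMetricOn_nbhd h hc (φ p)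
  have hΦ := isMapOn_cylSet hc hφ p
  have fx : IsFieldOn x U := isFieldOn_cylSet_of_tangent F.smooth_X p
  have fv : IsFieldOn v U := isFieldOn_cylSet_of_tangent F.smooth_V p
  have hs : ContDiffOn ℝ ∞ (fun z => s ((extChartAt (𝓡 2) p).symm z)) U :=
    localFun_contDiffOn p _ hS.smooth_s
  have hsd : ∀ z ∈ U, DifferentiableAt ℝ (fun z => s ((extChartAt (𝓡 2) p).symm z)) z :=
    fun z hz => hs.differentiableAt_of_isOpen hU hz
  have hxs : ∀ z ∈ U, dd x (fun z => s ((extChartAt (𝓡 2) p).symm z)) z = 1 := fun z hz => by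
    rw [hx, ← dirDeriv_eq_dd hz.1 (hsd z hz), F.dirDeriv_X_s hπ hγ hS]
  have hvs : ∀ z ∈ U, dd v (fun z => s ((extChartAt (𝓡 2) p).symm z)) z = 0 := fun z hz => by
    rw [hv, ← dirDeriv_eq_dd hz.1 (hsd z hz), F.dirDeriv_V_s hπ hγ hS]
  -- Both xs = 1 and vs = 0 are constant, so the bracket annihilates s and is therefore a multiple
  -- `c` of `v`.
  have hbs : dd (brk x v) (fun z => s ((extChartAt (𝓡 2) p).symm z)) y = 0 := by
    rw [← dd_comm hU fx fv hs hy, dd_eq_zero hU hvs hy, dd_eq_zero hU hxs hy, sub_zero]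
  obtain ⟨u, hu⟩ := exists_coords_eq ((extChartAt (𝓡 2) p).map_target hy.1) (brk x v y)
  rw [dd_eq_fnDeriv hy.1 (hsd y hy) hu] at hbs
  obtain ⟨c, rfl⟩ := F.exists_smul_V hπ hγ hS hbs
  have hbrk : brk x v y = c • v y := by
    rw [← hu, coords_smul_fun]
    rfl
  have hpush : push (localMap (m := 2) (n := 3) p (φ p) φ) (brk x v) y =
      c • push (localMap (m := 2) (n := 3) p (φ p) φ) v y := by
    simp only [push, hbrk, Pi.smul_apply, smul_eq_mul, mul_smul, Finset.smul_sum]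
  have hxv : ∀ z ∈ U, ip (coordMetric h.form (φ p) (localMap p (φ p) φ z))
      (push (localMap p (φ p) φ) x z) (push (localMap p (φ p) φ) v z) = 0 := fun z hz => by
    rw [hx, hv, push_eq_coords hφ hz, push_eq_coords hφ hz, ← h.form_localField hz.2.1,
      F.horizontal _ _ (F.vertical _)]
  -- The factor is c = ⟨∇_X V,V⟩ - ⟨∇_V X,V⟩. The first term vanishes since V is unit, the second
  -- since ⟨X,V⟩ = 0 and ∇_V V = 0.
  have h1 := covD_push_sub hH hΦ fx fv hy
  have h2 := dd_ip (x := v) hH hΦ (push_field hΦ fx) (push_field hΦ fv) hy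
  rw [dd_eq_zero hU hxv hy, F.covD_V_V hπ hfib hφ hy, ip_zero_right, add_zero] at h2
  have h3 := ip_covD_of_unit (x := x) hH hΦ (push_field hΦ fv)
    (fun z hz => F.push_unit_V hφ hz) hy
  have h4 := congrArg (fun t => ip (coordMetric h.form (φ p) (localMap p (φ p) φ y)) t
    (push (localMap p (φ p) φ) v y)) h1
  simp only [hpush, ip_sub_left, h3, ip_smul_left, hv ▸ F.push_unit_V hφ hy, ← h2, sub_zero,
    mul_one] at h4
  rw [hbrk, ← h4, zero_smul]

/-- The adapted frame in coordinates. -/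
theorem IsAdaptedFrame.isFrameOn (F : IsAdaptedFrame h.form π γ s φ X V ξ)
    (hπ : IsRiemannianSubmersion h.form h₁.form π)
    (hfib : HasTotallyGeodesicFibres (m := 2) h.form π) (hγ : IsArclengthCurve h₁.form J γ)
    (hS : IsHopfCylinder π J γ s φ) (p : S) :
    IsFrameOn (coordMetric h.form (φ p)) (localMap p (φ p) φ)
      (localField (m := 2) (n := 2) p p (fun q => q) X)
      (localField (m := 2) (n := 2) p p (fun q => q) V) (localField p (φ p) φ ξ)
      (cylSet π φ p) (chartSet 3 (φ p) (nbhd π (φ p))) where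
  metric := isMetricOn_nbhd h hπ.smooth.continuous _
  map := isMapOn_cylSet hπ.smooth.continuous hS.smooth_φ p
  fx := isFieldOn_cylSet_of_tangent F.smooth_X p
  fv := isFieldOn_cylSet_of_tangent F.smooth_V p
  fξ := isFieldOn_cylSet F.smooth_ξ p
  xx y hy := by
    rw [push_eq_coords hS.smooth_φ hy, ← h.form_localField hy.2.1, F.unit_X hπ hγ hS]
  vv y hy := F.push_unit_V hS.smooth_φ hy
  ξξ y hy := by rw [← h.form_localField hy.2.1, F.unit_ξ]
  xv y hy := by
    rw [push_eq_coords hS.smooth_φ hy, push_eq_coords hS.smooth_φ hy,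
      ← h.form_localField hy.2.1, F.horizontal _ _ (F.vertical _)]
  ξx y hy := by
    rw [push_eq_coords hS.smooth_φ hy, ← h.form_localField hy.2.1, F.normal]
  ξv y hy := by
    rw [push_eq_coords hS.smooth_φ hy, ← h.form_localField hy.2.1, F.normal]
  brk y hy := F.brk_eq_zero hπ hfib hγ hS hy
  geod y hy := F.covD_V_V hπ hfib hS.smooth_φ hy

/-- A horizontal vector is in the kernel of the defect of the submersion. -/
theorem ip_defect_of_horizontal (hπ : IsRiemannianSubmersion h.form h₁.form π) {r₀ r : N}
    (hr : r ∈ nbhd π r₀) {a : TangentSpace (𝓡 3) r}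
    (ha : ∀ u : TangentSpace (𝓡 3) r, mfderiv (𝓡 3) (𝓡 2) π r u = 0 → h.form r a u = 0)
    (t : Fin 3 → ℝ) :
    ip (defect (coordMetric h.form r₀) (coordMetric h₁.form (π r₀)) (localMap r₀ (π r₀) π)
        (extChartAt (𝓡 3) r₀ r)) (fun i => coords r₀ r a i) t = 0 := by
  obtain ⟨u, rfl⟩ := exists_coords_eq hr.1 t
  rw [ip_defect_coords hπ.smooth hr, form_mfderiv_of_horizontal hπ ha, sub_self]

theorem IsAdaptedFrame.isSubmersionOn (F : IsAdaptedFrame h.form π γ s φ X V ξ)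
    (hπ : IsRiemannianSubmersion h.form h₁.form π) (hφ : ContMDiff (𝓡 2) (𝓡 3) ∞ φ) (p : S) :
    IsSubmersionOn (coordMetric h.form (φ p)) (coordMetric h₁.form (π (φ p)))
      (localMap p (φ p) φ) (localMap (φ p) (π (φ p)) π)
      (localField (m := 2) (n := 2) p p (fun q => q) X)
      (localField (m := 2) (n := 2) p p (fun q => q) V) (localField p (φ p) φ ξ)
      (cylSet π φ p) (chartSet 3 (φ p) (nbhd π (φ p))) (extChartAt (𝓡 2) (π (φ p))).target where
  base := h₁.isMetricOn _
  map := isMapOn_nbhd hπ.smooth _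
  nonneg z hz w := by
    obtain ⟨u, rfl⟩ := exists_coords_eq hz.2.1 w
    have := ip_defect_coords (h := h) (h₁ := h₁) hπ.smooth hz.2 u u
    rw [(extChartAt (𝓡 3) (φ p)).right_inv hz.1] at this
    rw [this]
    exact sub_nonneg.2 (form_mfderiv_le hπ u)
  x_horizontal y hy t := by
    rw [push_eq_coords hφ hy]
    exact ip_defect_of_horizontal hπ hy.2 (F.horizontal _) t
  ξ_horizontal y hy t := ip_defect_of_horizontal hπ hy.2 (F.ξ_horizontal hπ _) t
  v_vertical y hy := by
    rw [push_eq_coords hφ hy]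
    refine (diffAt_coords hπ.smooth hy.2 _).trans ?_
    rw [F.vertical]
    ext a
    exact congrArg (fun t : EuclideanSpace ℝ (Fin 2) => t a) (map_zero (mfderiv (𝓡 2)
      𝓘(ℝ, EuclideanSpace ℝ (Fin 2)) (extChartAt (𝓡 2) (π (φ p))) _))

theorem isConformalOn_conformalPullback {f : S → ℝ} (hf : ContMDiff (𝓡 2) 𝓘(ℝ, ℝ) ∞ f)
    (hfpos : ∀ p, 0 < f p) (hφ : ContMDiff (𝓡 2) (𝓡 3) ∞ φ) (p : S) :
    IsConformalOn (coordMetric (conformalPullback f φ h.form) p) (coordMetric h.form (φ p))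
      (localMap p (φ p) φ) (fun y => f ((extChartAt (𝓡 2) p).symm y)) (cylSet π φ p) where
  smooth := localFun_contDiffOn p _ hf
  pos y _ := hfpos _
  eq y hy i j := by
    have hd := (hφ ((extChartAt (𝓡 2) p).symm y)).mdifferentiableAt (n := ∞) (by simp)
    rw [← coords_mfderiv_coordVec hy.1 hd hy.2.1 i, ← coords_mfderiv_coordVec hy.1 hd hy.2.1 j]
    exact congrArg _ (h.form_eq_ip hy.2.1 _ _)

end AdaptedFrame

end HopfCyl

end

noncomputable section

namespace HopfCyl

/-! ### Curvature, torsion, Ricci terms and derivatives in the chart at a point -/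

section Main

variable {N : Type*} [TopologicalSpace N] [ChartedSpace (EuclideanSpace ℝ (Fin 3)) N]
  [IsManifold (𝓡 3) ∞ N]
  {B : Type*} [TopologicalSpace B] [ChartedSpace (EuclideanSpace ℝ (Fin 2)) B]
  [IsManifold (𝓡 2) ∞ B]
  {S : Type*} [TopologicalSpace S] [ChartedSpace (EuclideanSpace ℝ (Fin 2)) S]
  [IsManifold (𝓡 2) ∞ S]
  {h : RiemMetric 3 N} {h₁ : RiemMetric 2 B} {π : N → B} {J : Set ℝ} {γ : ℝ → B} {s : S → ℝ}
  {φ : S → N} {X V : ∀ p : S, TangentSpace (𝓡 2) p} {ξ : ∀ p : S, TangentSpace (𝓡 3) (φ p)}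

/-- The identity is obtained on the whole open set and has the shape of its own hypothesis `heq`, so
it can be iterated to second derivatives. -/
theorem dirDeriv_eq_dd_of_eqOn {u : S → ℝ} {p : S} {U : Set (EuclideanSpace ℝ (Fin 2))}
    (hU : IsOpen U) (hUt : U ⊆ (extChartAt (𝓡 2) p).target)
    {û : EuclideanSpace ℝ (Fin 2) → ℝ} (hû : ContDiffOn ℝ ∞ û U)
    (heq : ∀ z ∈ U, u ((extChartAt (𝓡 2) p).symm z) = û z) (X : ∀ q : S, TangentSpace (𝓡 2) q) :
    ∀ z ∈ U, dirDeriv X u ((extChartAt (𝓡 2) p).symm z) =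
      dd (localField (m := 2) (n := 2) p p (fun q => q) X) û z := by
  intro z hz
  have hd : DifferentiableAt ℝ (fun z => u ((extChartAt (𝓡 2) p).symm z)) z :=
    (hû.congr heq).differentiableAt_of_isOpen hU hz
  rw [dirDeriv_eq_dd (hUt hz) hd, dd_congr hU heq hz]

theorem localField_self {n : ℕ} {M : Type*} [TopologicalSpace M]
    [ChartedSpace (EuclideanSpace ℝ (Fin n)) M] [IsManifold (𝓡 n) ∞ M] {φ : S → M} (p : S)
    (W : ∀ q : S, TangentSpace (𝓡 n) (φ q)) (a : Fin n) :
    localField p (φ p) φ W (extChartAt (𝓡 2) p p) a = coords (φ p) (φ p) (W p) a := by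
  -- The type of `W q` depends on `q`, so the equality of points is used by substitution of a
  -- variable.
  have key : ∀ q : S, q = p → coords (φ p) (φ q) (W q) a = coords (φ p) (φ p) (W p) a := by
    rintro q rfl; rfl
  exact key _ (extChartAt_to_inv p)

theorem Ric_eq_sum (W Z : ∀ q : S, TangentSpace (𝓡 3) (φ q)) (p : S) :
    Ric h.form (φ p) (W p) (Z p) =
      ∑ j, ∑ k, ricciCoord (coordMetric h.form (φ p)) j k
        (localMap p (φ p) φ (extChartAt (𝓡 2) p p)) *
        localField p (φ p) φ W (extChartAt (𝓡 2) p p) j *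
        localField p (φ p) φ Z (extChartAt (𝓡 2) p p) k := by
  simp only [localField_self, localMap, extChartAt_to_inv]
  rfl

theorem IsAdaptedFrame.geodCurvature_eq (F : IsAdaptedFrame h.form π γ s φ X V ξ)
    (hπ : Continuous π) (hφ : ContMDiff (𝓡 2) (𝓡 3) ∞ φ) {p : S} {y : EuclideanSpace ℝ (Fin 2)}
    (hy : y ∈ cylSet π φ p) :
    geodCurvature h.form φ X ξ ((extChartAt (𝓡 2) p).symm y) =
      curvatureFn (coordMetric h.form (φ p)) (localMap p (φ p) φ)
        (localField (m := 2) (n := 2) p p (fun q => q) X) (localField p (φ p) φ ξ) y := by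
  rw [geodCurvature, curvatureFn, covD_congr (isOpen_cylSet hπ hφ.continuous p)
    (fun z hz => push_eq_coords hφ hz X) hy,
    ← localField_covDeriv h hφ isOpen_univ (contMDiff_mfderiv hφ F.smooth_X).contMDiffOn
      ⟨hy.1, trivial⟩ hy.2.1]
  exact h.form_localField hy.2.1 (fun q => covDeriv h.form φ
    (fun q => mfderiv (𝓡 2) (𝓡 3) φ q (X q)) q (X q)) ξ

theorem IsAdaptedFrame.geodTorsion_eq (F : IsAdaptedFrame h.form π γ s φ X V ξ)
    (hφ : ContMDiff (𝓡 2) (𝓡 3) ∞ φ) {p : S} {y : EuclideanSpace ℝ (Fin 2)}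
    (hy : y ∈ cylSet π φ p) :
    geodTorsion h.form φ X V ξ ((extChartAt (𝓡 2) p).symm y) =
      torsionFn (coordMetric h.form (φ p)) (localMap p (φ p) φ)
        (localField (m := 2) (n := 2) p p (fun q => q) X)
        (localField (m := 2) (n := 2) p p (fun q => q) V) (localField p (φ p) φ ξ) y := by
  rw [geodTorsion, torsionFn, push_eq_coords hφ hy,
    ← localField_covDeriv h hφ isOpen_univ F.smooth_ξ.contMDiffOn ⟨hy.1, trivial⟩ hy.2.1]
  exact h.form_localField hy.2.1 (fun q => covDeriv h.form φ ξ q (X q))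
    (fun q => mfderiv (𝓡 2) (𝓡 3) φ q (V q))

end Main

end HopfCyl

end

theorem mainTheorem5
    {N : Type*} [TopologicalSpace N] [ChartedSpace (EuclideanSpace ℝ (Fin 3)) N]
    [IsManifold (𝓡 3) ∞ N]
    {B : Type*} [TopologicalSpace B] [ChartedSpace (EuclideanSpace ℝ (Fin 2)) B]
    [IsManifold (𝓡 2) ∞ B]
    {S : Type*} [TopologicalSpace S] [ChartedSpace (EuclideanSpace ℝ (Fin 2)) S]
    [IsManifold (𝓡 2) ∞ S]
    (h : HopfCyl.RiemMetric 3 N) (h₁ : HopfCyl.RiemMetric 2 B) (π : N → B)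
    (hπ : HopfCyl.IsRiemannianSubmersion h.form h₁.form π)
    (hfib : HopfCyl.HasTotallyGeodesicFibres (m := 2) h.form π)
    (J : Set ℝ) (γ : ℝ → B) (hγ : HopfCyl.IsArclengthCurve h₁.form J γ)
    (s : S → ℝ) (φ : S → N) (hS : HopfCyl.IsHopfCylinder π J γ s φ)
    (X V : ∀ p : S, TangentSpace (𝓡 2) p) (ξ : ∀ p : S, TangentSpace (𝓡 3) (φ p))
    (hframe : HopfCyl.IsAdaptedFrame h.form π γ s φ X V ξ)
    (κ τ : S → ℝ) (hκ : κ = HopfCyl.geodCurvature h.form φ X ξ)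
    (hτ : τ = HopfCyl.geodTorsion h.form φ X V ξ)
    (f : S → ℝ) (hf : ContMDiff (𝓡 2) 𝓘(ℝ, ℝ) ∞ f) (hfpos : ∀ p, 0 < f p)
    (lnf κ' κ'' : S → ℝ) (hlnf : lnf = fun p => Real.log (f p))
    (hκ' : κ' = HopfCyl.dirDeriv X κ) (hκ'' : κ'' = HopfCyl.dirDeriv X κ') :
    HopfCyl.IsBiharmonic (m := 2) (HopfCyl.conformalPullback f φ h.form) h.form φ ↔
      ∀ p : S,
        κ'' p - κ p ^ 3 - 2 * κ p * τ p ^ 2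
            + κ p * HopfCyl.Ric h.form (φ p) (ξ p) (ξ p)
            + 2 * κ' p * HopfCyl.dirDeriv X lnf p
            + κ p * (HopfCyl.dirDeriv X (HopfCyl.dirDeriv X lnf) p
              + HopfCyl.dirDeriv V (HopfCyl.dirDeriv V lnf) p
              + HopfCyl.dirDeriv X lnf p ^ 2 + HopfCyl.dirDeriv V lnf p ^ 2) = 0 ∧
        3 * κ p * κ' p
            - 2 * κ p * HopfCyl.Ric h.form (φ p) (ξ p) (mfderiv (𝓡 2) (𝓡 3) φ p (X p))
            + 2 * κ p ^ 2 * HopfCyl.dirDeriv X lnf p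
            - 2 * κ p * τ p * HopfCyl.dirDeriv V lnf p = 0 ∧
        κ' p * τ p
            + κ p * HopfCyl.Ric h.form (φ p) (ξ p) (mfderiv (𝓡 2) (𝓡 3) φ p (V p))
            + κ p * τ p * HopfCyl.dirDeriv X lnf p = 0 := by
  -- The equivalence holds point by point: at `p` the bitension field is computed in the charts at
  -- `p` and `φ p`, the charts of the local frame.
  refine forall_congr' fun p => ?_
  have hc := hπ.smooth.continuous
  have hφ := hS.smooth_φ
  have hU := HopfCyl.isOpen_cylSet hc hφ.continuous p
  have F := hframe.isFrameOn hπ hfib hγ hS p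
  have C := HopfCyl.isConformalOn_conformalPullback (h := h) (π := π) hf hfpos hφ p
  have hUt : HopfCyl.cylSet π φ p ⊆ (extChartAt (𝓡 2) p).target := Set.inter_subset_left
  have hy : extChartAt (𝓡 2) p p ∈ HopfCyl.cylSet π φ p :=
    HopfCyl.mem_chartSet (mem_extChartAt_source p) (HopfCyl.mem_nbhd (φ p))
  have hp : (extChartAt (𝓡 2) p).symm (extChartAt (𝓡 2) p p) = p := extChartAt_to_inv p
  have hV := fun y hy => (hframe.isSubmersionOn hπ hφ p).dd_curvatureFn F (y := y) hy
  -- The coordinate expressions are identified on the whole neighbourhood, not only at `p`, because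
  -- they are differentiated up to twice afterwards.
  have eκ : ∀ z ∈ HopfCyl.cylSet π φ p, κ ((extChartAt (𝓡 2) p).symm z) = _ := fun z hz =>
    (congrFun hκ _).trans (hframe.geodCurvature_eq hc hφ hz)
  have eτ : ∀ z ∈ HopfCyl.cylSet π φ p, τ ((extChartAt (𝓡 2) p).symm z) = _ := fun z hz =>
    (congrFun hτ _).trans (hframe.geodTorsion_eq hφ hz)
  have eL : ∀ z ∈ HopfCyl.cylSet π φ p, lnf ((extChartAt (𝓡 2) p).symm z) =
      (fun z => Real.log (f ((extChartAt (𝓡 2) p).symm z))) z := fun z _ => congrFun hlnf _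
  have sκ := F.curvatureFn_contDiffOn
  have sL : ContDiffOn ℝ ∞ (fun z => Real.log (f ((extChartAt (𝓡 2) p).symm z)))
      (HopfCyl.cylSet π φ p) := C.smooth.log fun z hz => (C.pos z hz).ne'
  have eκ' := HopfCyl.dirDeriv_eq_dd_of_eqOn hU hUt sκ eκ X
  rw [← hκ'] at eκ'
  have eκ'' := HopfCyl.dirDeriv_eq_dd_of_eqOn hU hUt (HopfCyl.dd_contDiffOn hU F.fx sκ) eκ' X
  rw [← hκ''] at eκ''
  have eXL := HopfCyl.dirDeriv_eq_dd_of_eqOn hU hUt sL eL X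
  have eVL := HopfCyl.dirDeriv_eq_dd_of_eqOn hU hUt sL eL V
  have eXXL := HopfCyl.dirDeriv_eq_dd_of_eqOn hU hUt (HopfCyl.dd_contDiffOn hU F.fx sL) eXL X
  have eVVL := HopfCyl.dirDeriv_eq_dd_of_eqOn hU hUt (HopfCyl.dd_contDiffOn hU F.fv sL) eVL V
  have key := C.bitension_eq_zero_iff F rfl rfl rfl hV hy
  rw [HopfCyl.push_eq_coords hφ hy, HopfCyl.push_eq_coords hφ hy,
    ← HopfCyl.Ric_eq_sum (h := h) ξ ξ p,
    ← HopfCyl.Ric_eq_sum (h := h) ξ (fun q => mfderiv (𝓡 2) (𝓡 3) φ q (X q)) p,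
    ← HopfCyl.Ric_eq_sum (h := h) ξ (fun q => mfderiv (𝓡 2) (𝓡 3) φ q (V q)) p,
    ← eκ _ hy, ← eτ _ hy, ← eκ' _ hy, ← eκ'' _ hy, ← eXXL _ hy, ← eVVL _ hy, ← eXL _ hy,
    ← eVL _ hy, hp] at key
  exact key
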